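/- Let $q\in(-1,1)$ and let $H$ be a real Hilbert space. Definitions. For a real Hilbert space $K$ with complexification $K_{\mathbb C}$, let $\mathcal F_q(K)$ be the $q$-Fock space, i.e. the Hilbert space completion of $\bigoplus_{k\ge 0}K_{\mathbb C}^{\otimes k}$ (with vacuum vector $\Omega$ spanning $K_{\mathbb C}^{\otimes 0}=\mathbb C\Omega$) for the inner product $$\langle \xi_1\otimes\cdots\otimes\xi_j,\eta_1\otimes\cdots\otimes\eta_k\rangle_q=\delta_{j,k}\sum_{\sigma\in S_k}q^{\iota(\sigma)}\prod_{i=1}^k\langle\xi_i,\eta_{\sigma(i)}\rangle ,$$ where $\iota(\sigma)$ is the number of inversions of $\sigma$. Let $c_q(\xi)$, $\xi\in K$, be the creation operator $\xi_1\otimes\cdots\otimes\xi_k\mapsto \xi\otimes\xi_1\otimes\cdots\otimes\xi_k$, let $X_q(\xi)=c_q(\xi)+c_q(\xi)^*$, let $\Gamma_q(K)\subset B(\mathcal F_q(K))$ be the von Neumann algebra generated by $\{X_q(\xi):\xi\in K\}$, with vacuum state $\tau_q(A)=\langle \Omega,A\Omega\rangle_q$, and put $\|x\|_p=\tau_q\big((x^*x)^{p/2}\big)^{1/p}$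 for $1\le p<\infty$ and $\|x\|_\infty=\|x\|$. The $q$-Ornstein--Uhlenbeck semigroup $P_t^q=e^{-tN_q}$ on $\Gamma_q(K)$ is the second quantization of $e^{-t}\,\mathrm{id}_K$: $P_t^qx$ is the element of $\Gamma_q(K)$ for which $(P^q_tx)\Omega$ is the image of $x\Omega$ under $\xi_1\otimes\cdots\otimes\xi_k\mapsto e^{-tk}\,\xi_1\otimes\cdots\otimes\xi_k$; its generator is determined by $(N_qx)\Omega=\lim_{t\to0^+}t^{-1}(x-P_t^qx)\Omega$ with $N_qx\in\Gamma_q(K)$. For $d\ge 0$ let $\mathcal P^{\ge d}$ (resp. $\mathcal P^{\le d}$) be the space of those $x\in\Gamma_q(K)$ for which $x\Omega$ lies in the algebraic direct sum $\bigoplus_{k\ge d}K_{\mathbb C}^{\otimes k}$ (resp. $\bigoplus_{k\le d}K_{\mathbb C}^{\otimes k}$). Now take $K=H\oplus H$ and call the elements of the unital complex algebra generated by $$Z_q(\xi)=\tfrac1{\sqrt2}\big(X_q(\xi,0)+iX_q(0,\xi)\big),\qquad \xi\in H,$$ holomorphic polynomials in $\Gamma_q(H\oplus H)$. Theorem. Let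 $1\le p\le\infty$ and let $d\ge1$ be an integer. For every holomorphic polynomial $x$ in $\Gamma_q(H\oplus H)$, the elements $P_t^qx$ ($t\ge0$) and $N_qx$ exist and are unique, and: (i) if $x\in\mathcal P^{\ge d}$, then $\|P_t^q x\|_p\le e^{-td}\|x\|_p$ for all $t\ge 0$, and $\|N_qx\|_p\ge d\,\|x\|_p$; (ii) if $x\in\mathcal P^{\le d}$, then $\|N_qx\|_p\le d\,\|x\|_p$, and $\|P_t^qx\|_p\ge e^{-td}\|x\|_p$ for all $t\ge0$. The inequalities are sharp: if $H\ne\{0\}$, there is a holomorphic polynomial $x\in\mathcal P^{\ge d}\cap\mathcal P^{\le d}$ with $\|x\|_p>0$, $\|P_t^qx\|_p=e^{-td}\|x\|_p$ for all $t\ge0$ and $\|N_qx\|_p=d\,\|x\|_p$. -/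

import Mathlib

namespace QGaussian

open scoped TensorProduct DirectSum InnerProductSpace

set_option linter.unusedSimpArgs false

noncomputable section

/-- The number of inversions of a permutation. -/
def inversions {n : ℕ} (σ : Equiv.Perm (Fin n)) : ℕ :=
  (Finset.univ.filter fun p : Fin n × Fin n => p.1 < p.2 ∧ σ p.2 < σ p.1).card

section Level

variable (q : ℝ) (H : Type*) [NormedAddCommGroup H] [InnerProductSpace ℝ H]

/-- The bilinear form on the `n`-th tensor power with
`(ξ₁ ⊗ ⋯ ⊗ ξₙ, η₁ ⊗ ⋯ ⊗ ηₙ) ↦ ∏ i, ⟪ξᵢ, ηᵢ⟫`. -/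
def pairing (n : ℕ) : (⨂[ℝ]^n H) →ₗ[ℝ] (⨂[ℝ]^n H) →ₗ[ℝ] ℝ :=
  (TensorPower.pairingDual ℝ H n).comp (PiTensorProduct.map fun _ => innerₗ H)

/-- The form `⟨·,·⟩_q` on the `n`-th tensor power:
`(ξ₁ ⊗ ⋯ ⊗ ξₙ, η₁ ⊗ ⋯ ⊗ ηₙ) ↦ ∑ σ, q ^ inversions σ * ∏ i, ⟪ξᵢ, η_{σ i}⟫`. -/
def levelForm (n : ℕ) : (⨂[ℝ]^n H) →ₗ[ℝ] (⨂[ℝ]^n H) →ₗ[ℝ] ℝ :=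
  ∑ σ : Equiv.Perm (Fin n), q ^ inversions σ •
    (pairing H n).compl₂ (PiTensorProduct.reindex ℝ (fun _ => H) σ.symm).toLinearMap

variable {H}

theorem levelForm_tprod {n : ℕ} (v w : Fin n → H) :
    levelForm q H n (PiTensorProduct.tprod ℝ v) (PiTensorProduct.tprod ℝ w) =
      ∑ σ : Equiv.Perm (Fin n), q ^ inversions σ * ∏ i, ⟪v i, w (σ i)⟫_ℝ := by
  simp [levelForm, pairing]

theorem inversions_inv {n : ℕ} (σ : Equiv.Perm (Fin n)) : inversions σ⁻¹ = inversions σ := by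
  refine Finset.card_bij (fun p _ => (σ⁻¹ p.2, σ⁻¹ p.1)) ?_ ?_ ?_
  · simp +contextual
  · simp +contextual [Prod.ext_iff]
  · rintro ⟨a, b⟩ h
    refine ⟨(σ b, σ a), ?_, by simp⟩
    simpa [and_comm] using h

theorem levelForm_symm {n : ℕ} (u v : ⨂[ℝ]^n H) : levelForm q H n u v = levelForm q H n v u := by
  suffices h : levelForm q H n = (levelForm q H n).flip by
    conv_lhs => rw [h]
    rfl
  ext v w
  simp only [LinearMap.compMultilinearMap_apply, LinearMap.flip_apply, levelForm_tprod]
  rw [← Equiv.sum_comp (Equiv.inv _)]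
  refine Finset.sum_congr rfl fun σ _ => ?_
  rw [Equiv.inv_apply, inversions_inv, ← Equiv.prod_comp σ]
  congr 1
  refine Finset.prod_congr rfl fun i _ => ?_
  rw [real_inner_comm, Equiv.Perm.inv_def, Equiv.symm_apply_apply]

theorem posSemidef_prod {ι κ : Type*} [Finite ι] (s : Finset κ) (M : κ → Matrix ι ι ℝ)
    (h : ∀ k ∈ s, (M k).PosSemidef) :
    (Matrix.of fun i j => ∏ k ∈ s, M k i j).PosSemidef := by
  classical
  induction s using Finset.induction_on with
  | empty =>
    have : (Matrix.of fun i j => ∏ k ∈ (∅ : Finset κ), M k i j) =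
        Matrix.gram ℝ (fun _ : ι => (1 : ℝ)) := by
      ext i j
      simp [Matrix.gram]
    rw [this]
    exact Matrix.posSemidef_gram ℝ _
  | insert a s ha ih =>
    have : (Matrix.of fun i j => ∏ k ∈ insert a s, M k i j) =
        (M a).hadamard (Matrix.of fun i j => ∏ k ∈ s, M k i j) := by
      ext i j
      simp [Finset.prod_insert ha]
    rw [this]
    exact (h a (by simp)).hadamard (ih fun k hk => h k (by simp [hk]))

theorem posSemidef_sign {ι : Type*} [Finite ι] (hq : |q| ≤ 1) (s : ι → Prop)
    [DecidablePred s] :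
    (Matrix.of fun i j => if (s i ↔ s j) then (1 : ℝ) else q).PosSemidef := by
  obtain ⟨h1, h2⟩ := abs_le.mp hq
  have key := ((Matrix.posSemidef_gram ℝ (fun _ : ι => (1 : ℝ))).smul
    (show (0 : ℝ) ≤ (1 + q) / 2 by linarith)).add
    ((Matrix.posSemidef_gram ℝ (fun i : ι => if s i then (1 : ℝ) else -1)).smul
    (show (0 : ℝ) ≤ (1 - q) / 2 by linarith))
  have : (Matrix.of fun i j => if (s i ↔ s j) then (1 : ℝ) else q) =
      ((1 + q) / 2) • Matrix.gram ℝ (fun _ : ι => (1 : ℝ)) +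
        ((1 - q) / 2) • Matrix.gram ℝ (fun i : ι => if s i then (1 : ℝ) else -1) := by
    ext i j
    by_cases hi : s i <;> by_cases hj : s j <;> simp [Matrix.gram, hi, hj] <;> ring
  rw [this]
  exact key

theorem pow_inversions_mul_inv {n : ℕ} (σ τ : Equiv.Perm (Fin n)) :
    q ^ inversions (τ * σ⁻¹) =
      ∏ p ∈ Finset.univ.filter (fun p : Fin n × Fin n => p.1 < p.2),
        if (σ p.1 < σ p.2 ↔ τ p.1 < τ p.2) then (1 : ℝ) else q := by
  rw [Finset.prod_ite, Finset.prod_const_one, one_mul, Finset.prod_const]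
  congr 1
  rw [show inversions (τ * σ⁻¹) = (Finset.univ.filter fun p : Fin n × Fin n =>
    p.1 < p.2 ∧ τ (σ.symm p.2) < τ (σ.symm p.1)).card from rfl]
  refine Finset.card_bij
    (fun p _ => if σ.symm p.1 < σ.symm p.2 then (σ.symm p.1, σ.symm p.2)
      else (σ.symm p.2, σ.symm p.1)) ?_ ?_ ?_
  · rintro ⟨a, b⟩ h
    simp only [Finset.mem_filter, Finset.mem_univ, true_and, Equiv.Perm.mul_apply] at h
    split_ifs with h1
    · simp only at h1
      simp [h1, h.1, h.2.le]
    · simp only at h1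
      have : σ.symm b < σ.symm a := lt_of_le_of_ne (not_lt.mp h1) (by simpa using h.1.ne')
      simp [this, h.1.le, h.2]
  · rintro ⟨a, b⟩ h ⟨c, d⟩ h'
    simp only [Finset.mem_filter, Finset.mem_univ, true_and, Equiv.Perm.mul_apply] at h h'
    have h1 := h.1
    have h2 := h'.1
    split_ifs <;> simp only [Prod.mk.injEq, EmbeddingLike.apply_eq_iff_eq, and_imp] <;>
      rintro rfl rfl
    · simp
    · exact absurd h1 h2.not_gt
    · exact absurd h1 h2.not_gt
    · simp
  · rintro ⟨i, j⟩ h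
    simp only [Finset.mem_filter, Finset.mem_univ, true_and] at h
    obtain ⟨h1, h2⟩ := h
    by_cases h3 : σ i < σ j
    · have h4 : τ j < τ i :=
        lt_of_le_of_ne (not_lt.mp fun h => h2 (by simp [h3, h])) (by simpa using h1.ne')
      exact ⟨(σ i, σ j), by simp [h3, h4], by simp [h1]⟩
    · have h3' : σ j < σ i := lt_of_le_of_ne (not_lt.mp h3) (by simpa using h1.ne')
      have h4 : τ i < τ j := by
        by_contra h
        exact h2 (by simp [h3, h])
      exact ⟨(σ j, σ i), by simp [h3', h4], by simp [h1.not_gt]⟩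

/-- The form `⟨·,·⟩_q` is positive semidefinite for `|q| ≤ 1`. -/
theorem levelForm_nonneg (hq : |q| ≤ 1) {n : ℕ} (u : ⨂[ℝ]^n H) : 0 ≤ levelForm q H n u u := by
  classical
  have hu : u ∈ Submodule.span ℝ
      (Set.range (PiTensorProduct.tprod ℝ (s := fun _ : Fin n => H))) := by
    rw [PiTensorProduct.span_tprod_eq_top]
    trivial
  obtain ⟨c, rfl⟩ := Finsupp.mem_span_range_iff_exists_finsupp.mp hu
  let M : Matrix (c.support × Equiv.Perm (Fin n)) (c.support × Equiv.Perm (Fin n)) ℝ :=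
    Matrix.hadamard
      (Matrix.of fun i j => ∏ p ∈ Finset.univ.filter (fun p : Fin n × Fin n => p.1 < p.2),
        (Matrix.of fun i j : c.support × Equiv.Perm (Fin n) =>
          if (i.2 p.1 < i.2 p.2 ↔ j.2 p.1 < j.2 p.2) then (1 : ℝ) else q) i j)
      (Matrix.of fun i j => ∏ k ∈ Finset.univ,
        Matrix.gram ℝ (fun i : c.support × Equiv.Perm (Fin n) => i.1.1 (i.2 k)) i j)
  have hM : M.PosSemidef :=
    (posSemidef_prod _ _ fun p _ => posSemidef_sign q hq
      (fun i : c.support × Equiv.Perm (Fin n) => i.2 p.1 < i.2 p.2)).hadamard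
      (posSemidef_prod _ _ fun k _ => Matrix.posSemidef_gram ℝ _)
  have key := hM.dotProduct_mulVec_nonneg (fun i => c i.1)
  have hsum : star (fun i : c.support × Equiv.Perm (Fin n) => c i.1) ⬝ᵥ
      (M.mulVec fun i => c i.1) =
      (Fintype.card (Equiv.Perm (Fin n)) : ℝ) * levelForm q H n
        (c.sum fun i a => a • PiTensorProduct.tprod ℝ i)
        (c.sum fun i a => a • PiTensorProduct.tprod ℝ i) := by
    have hM' : ∀ i j, M i j = q ^ inversions (j.2 * i.2⁻¹) *
        ∏ k, ⟪i.1.1 k, j.1.1 ((j.2 * i.2⁻¹) k)⟫_ℝ := by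
      intro i j
      rw [pow_inversions_mul_inv, ← Equiv.prod_comp i.2]
      simp [M, Matrix.gram]
    have h1 : ∀ (v w : c.support), ∑ σ : Equiv.Perm (Fin n), ∑ τ : Equiv.Perm (Fin n),
        M (v, σ) (w, τ) = Fintype.card (Equiv.Perm (Fin n)) *
          levelForm q H n (PiTensorProduct.tprod ℝ v.1) (PiTensorProduct.tprod ℝ w.1) := by
      intro v w
      rw [levelForm_tprod, ← nsmul_eq_mul, ← Finset.card_univ, ← Finset.sum_const]
      refine Finset.sum_congr rfl fun σ _ => ?_
      rw [← Equiv.sum_comp (Equiv.mulRight σ)]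
      simp [hM']
    have h2 : star (fun i : c.support × Equiv.Perm (Fin n) => c i.1) ⬝ᵥ
        (M.mulVec fun i => c i.1) = ∑ v : c.support, ∑ w : c.support,
          c v * (c w * (Fintype.card (Equiv.Perm (Fin n)) *
          levelForm q H n (PiTensorProduct.tprod ℝ v.1) (PiTensorProduct.tprod ℝ w.1))) := by
      simp only [dotProduct, Matrix.mulVec, Fintype.sum_prod_type, Pi.star_apply, star_trivial]
      refine Finset.sum_congr rfl fun v _ => ?_
      rw [← Finset.mul_sum, Finset.sum_comm, Finset.mul_sum]
      refine Finset.sum_congr rfl fun w _ => ?_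
      rw [← h1]
      simp only [Finset.mul_sum]
      refine Finset.sum_congr rfl fun σ _ => Finset.sum_congr rfl fun τ _ => ?_
      ring
    rw [h2]
    simp only [Finsupp.sum, map_sum, map_smul, LinearMap.sum_apply, LinearMap.smul_apply,
      smul_eq_mul]
    rw [Finset.mul_sum, ← Finset.sum_attach c.support, ← Finset.univ_eq_attach]
    refine Finset.sum_congr rfl fun v _ => ?_
    rw [Finset.mul_sum, ← Finset.sum_attach c.support, ← Finset.univ_eq_attach]
    rw [Finset.mul_sum]
    refine Finset.sum_congr rfl fun w _ => ?_
    rw [levelForm_symm]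
    ring
  rw [hsum] at key
  exact nonneg_of_mul_nonneg_right key (by positivity)


/-- `ξ₁ ⊗ ⋯ ⊗ ξₙ ↦ ξ ⊗ ξ₁ ⊗ ⋯ ⊗ ξₙ`. -/
def tensorCons (n : ℕ) (ξ : H) : (⨂[ℝ]^n H) →ₗ[ℝ] (⨂[ℝ]^(n + 1) H) :=
  PiTensorProduct.lift
    ((PiTensorProduct.tprod ℝ : MultilinearMap ℝ (fun _ : Fin (n + 1) => H) _).curryLeft ξ)

theorem tensorCons_tprod {n : ℕ} (ξ : H) (v : Fin n → H) :
    tensorCons n ξ (PiTensorProduct.tprod ℝ v) =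
      PiTensorProduct.tprod ℝ (Fin.cons ξ v : Fin (n + 1) → H) := by
  simp [tensorCons]

/-- The `q`-annihilation, adjoint to `tensorCons`; it is only used to prove that creation is
bounded. -/
def tensorAnnihilate (n : ℕ) (ξ : H) : (⨂[ℝ]^(n + 1) H) →ₗ[ℝ] (⨂[ℝ]^n H) :=
  ∑ j : Fin (n + 1), q ^ (j : ℕ) • PiTensorProduct.lift
    (LinearMap.uncurryMid j ((innerₗ H ξ).smulRight (PiTensorProduct.tprod ℝ)))

theorem tensorAnnihilate_tprod {n : ℕ} (ξ : H) (v : Fin (n + 1) → H) :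
    tensorAnnihilate q n ξ (PiTensorProduct.tprod ℝ v) =
      ∑ j : Fin (n + 1), (q ^ (j : ℕ) * ⟪ξ, v j⟫_ℝ) •
        PiTensorProduct.tprod ℝ (fun i => v (j.succAbove i)) := by
  simp [tensorAnnihilate, LinearMap.uncurryMid, mul_smul]
  rfl

/-- The permutation `0 ↦ j`, `i + 1 ↦ j.succAbove (τ i)`. -/
def consPerm {n : ℕ} (j : Fin (n + 1)) (τ : Equiv.Perm (Fin n)) : Equiv.Perm (Fin (n + 1)) :=
  ((finSuccEquiv' 0).trans (Equiv.optionCongr τ)).trans (finSuccEquiv' j).symm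

theorem consPerm_zero {n : ℕ} (j : Fin (n + 1)) (τ : Equiv.Perm (Fin n)) :
    consPerm j τ 0 = j := by
  simp [consPerm]

theorem consPerm_succ {n : ℕ} (j : Fin (n + 1)) (τ : Equiv.Perm (Fin n)) (i : Fin n) :
    consPerm j τ i.succ = j.succAbove (τ i) := by
  have : finSuccEquiv' (0 : Fin (n + 1)) i.succ = some i := finSuccEquiv'_succAbove 0 i
  simp [consPerm, this]

theorem consPerm_bijective (n : ℕ) : Function.Bijective
    (fun p : Fin (n + 1) × Equiv.Perm (Fin n) => consPerm p.1 p.2) := by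
  rw [Fintype.bijective_iff_injective_and_card]
  refine ⟨?_, by simp [Fintype.card_perm, Nat.factorial_succ]⟩
  rintro ⟨j, τ⟩ ⟨j', τ'⟩ h
  simp only at h
  have h0 : j = j' := by rw [← consPerm_zero j τ, h, consPerm_zero]
  subst h0
  have h1 : τ = τ' := by
    ext i
    have := congrArg (fun σ : Equiv.Perm (Fin (n + 1)) => σ i.succ) h
    simp only [consPerm_succ] at this
    rw [Fin.succAbove_right_injective this]
  rw [h1]

theorem inversions_consPerm {n : ℕ} (j : Fin (n + 1)) (τ : Equiv.Perm (Fin n)) :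
    inversions (consPerm j τ) = j + inversions τ := by
  have h : ∀ {m : ℕ} (σ : Equiv.Perm (Fin m)), inversions σ =
      ∑ a : Fin m, ∑ b : Fin m, if a < b ∧ σ b < σ a then 1 else 0 := by
    intro m σ
    rw [inversions, Finset.card_filter, Fintype.sum_prod_type]
  rw [h, h]
  simp only [Fin.sum_univ_succ, consPerm_zero, consPerm_succ, Fin.succ_pos, Fin.succ_lt_succ_iff,
    Fin.not_lt_zero, lt_self_iff_false, false_and, true_and, if_false, zero_add,
    (Fin.strictMono_succAbove j).lt_iff_lt]
  congr 1
  rw [Equiv.sum_comp τ (fun b => if j.succAbove b < j then 1 else 0)]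
  simp only [Fin.succAbove_lt_iff_castSucc_lt]
  have h2 : (Finset.univ.filter fun i : Fin (n + 1) => i < j).card = (j : ℕ) := by
    rw [show (Finset.univ.filter fun i : Fin (n + 1) => i < j) = Finset.Iio j by ext; simp,
      Fin.card_Iio]
  rw [← h2, Finset.card_filter, Fin.sum_univ_castSucc]
  simp [(Fin.le_last j).not_gt]

theorem levelForm_cons {n : ℕ} (ξ : H) (u : ⨂[ℝ]^n H) (v : ⨂[ℝ]^(n + 1) H) :
    levelForm q H (n + 1) (tensorCons n ξ u) v =
      levelForm q H n u (tensorAnnihilate q n ξ v) := by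
  suffices h : (levelForm q H (n + 1)).comp (tensorCons n ξ) =
      (levelForm q H n).compl₂ (tensorAnnihilate q n ξ) from
    LinearMap.congr_fun (LinearMap.congr_fun h u) v
  ext v w
  simp only [LinearMap.compMultilinearMap_apply, LinearMap.comp_apply, LinearMap.compl₂_apply,
    tensorCons_tprod, tensorAnnihilate_tprod, levelForm_tprod, map_sum, map_smul, smul_eq_mul]
  clear u
  revert v w
  intro (v : Fin n → H) (w : Fin (n + 1) → H)
  rw [← Equiv.sum_comp (Equiv.ofBijective _ (consPerm_bijective n)), Fintype.sum_prod_type]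
  refine Finset.sum_congr rfl fun j _ => ?_
  rw [Finset.mul_sum]
  refine Finset.sum_congr rfl fun τ _ => ?_
  rw [show Equiv.ofBijective _ (consPerm_bijective n) (j, τ) = consPerm j τ from rfl]
  simp only [inversions_consPerm, Fin.prod_univ_succ, consPerm_zero,
    consPerm_succ, Fin.cons_zero, Fin.cons_succ, pow_add]
  ring

theorem tensorAnnihilate_cons_zero (ξ : H) (u : ⨂[ℝ]^0 H) :
    tensorAnnihilate q 0 ξ (tensorCons 0 ξ u) = ⟪ξ, ξ⟫_ℝ • u := by
  suffices h : (tensorAnnihilate q 0 ξ).comp (tensorCons 0 ξ) = ⟪ξ, ξ⟫_ℝ • LinearMap.id from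
    LinearMap.congr_fun h u
  ext v
  simp only [LinearMap.compMultilinearMap_apply, LinearMap.comp_apply,
    tensorCons_tprod, tensorAnnihilate_tprod]
  simp

theorem tensorAnnihilate_cons_succ {n : ℕ} (ξ : H) (u : ⨂[ℝ]^(n + 1) H) :
    tensorAnnihilate q (n + 1) ξ (tensorCons (n + 1) ξ u) =
      ⟪ξ, ξ⟫_ℝ • u + q • tensorCons n ξ (tensorAnnihilate q n ξ u) := by
  suffices h : (tensorAnnihilate q (n + 1) ξ).comp (tensorCons (n + 1) ξ) =
      ⟪ξ, ξ⟫_ℝ • LinearMap.id + q • (tensorCons n ξ).comp (tensorAnnihilate q n ξ) from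
    LinearMap.congr_fun h u
  ext v
  simp only [LinearMap.compMultilinearMap_apply, LinearMap.comp_apply, LinearMap.add_apply,
    LinearMap.smul_apply, LinearMap.id_apply,
    tensorCons_tprod, tensorAnnihilate_tprod, map_sum, map_smul]
  rw [Fin.sum_univ_succ]
  congr 1
  · simp
  · rw [Finset.smul_sum]
    refine Finset.sum_congr rfl fun j _ => ?_
    rw [smul_smul]
    congr 1
    · simp [pow_succ]
      ring
    · congr 1
      ext i
      cases i using Fin.cases <;> simp

/-- The creation operators are bounded for `⟨·,·⟩_q`. -/
theorem levelForm_cons_le (hq : |q| < 1) (ξ : H) (n : ℕ) (u : ⨂[ℝ]^n H) :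
    levelForm q H (n + 1) (tensorCons n ξ u) (tensorCons n ξ u) ≤
      ‖ξ‖ ^ 2 / (1 - |q|) * levelForm q H n u u := by
  have hpos : 0 < 1 - |q| := by linarith
  induction n with
  | zero =>
    rw [levelForm_cons, tensorAnnihilate_cons_zero, map_smul, smul_eq_mul,
      real_inner_self_eq_norm_sq]
    refine mul_le_mul_of_nonneg_right ?_ (levelForm_nonneg q hq.le u)
    rw [le_div_iff₀ hpos]
    nlinarith [sq_nonneg ‖ξ‖, abs_nonneg q]
  | succ n ih =>
    set a := tensorAnnihilate q n ξ u with ha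
    set C := ‖ξ‖ ^ 2 / (1 - |q|) with hC
    have hC0 : 0 ≤ C := by positivity
    have hCe : ‖ξ‖ ^ 2 + |q| * C = C := by
      rw [hC]; field_simp; ring
    have h1 : levelForm q H (n + 1) u (tensorCons n ξ a) = levelForm q H n a a := by
      rw [levelForm_symm, levelForm_cons]
    have hcs : levelForm q H n a a ^ 2 ≤ levelForm q H (n + 1) u u * (C * levelForm q H n a a) := by
      rw [← h1]
      refine (LinearMap.BilinForm.apply_sq_le_of_symm (levelForm q H (n + 1))
        (levelForm_nonneg q hq.le) ⟨fun x y => levelForm_symm q x y⟩ _ _).trans ?_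
      rw [h1]
      exact mul_le_mul_of_nonneg_left (ih a) (levelForm_nonneg q hq.le u)
    have ha0 := levelForm_nonneg q hq.le a
    have hu0 := levelForm_nonneg q hq.le u
    have h2 : levelForm q H n a a ≤ C * levelForm q H (n + 1) u u := by
      rcases ha0.eq_or_lt with h | h
      · rw [← h]; positivity
      · nlinarith
    rw [levelForm_cons, tensorAnnihilate_cons_succ, map_add, map_smul, map_smul, smul_eq_mul,
      smul_eq_mul, real_inner_self_eq_norm_sq, ← ha, h1]
    calc _ ≤ ‖ξ‖ ^ 2 * levelForm q H (n + 1) u u + |q| * (C * levelForm q H (n + 1) u u) := by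
          gcongr
          · exact le_abs_self q
      _ = (‖ξ‖ ^ 2 + |q| * C) * levelForm q H (n + 1) u u := by ring
      _ = _ := by rw [hCe]

end Level

section Complexification

variable {E : Type*} [AddCommGroup E] [Module ℝ E]

/-- The sesquilinear extension of a real bilinear form to the complexification:
`(a ⊗ u, b ⊗ v) ↦ conj a * b * B u v`. -/
def complexForm (B : E →ₗ[ℝ] E →ₗ[ℝ] ℝ) : (ℂ ⊗[ℝ] E) →ₗ[ℝ] (ℂ ⊗[ℝ] E) →ₗ[ℝ] ℂ :=
  (TensorProduct.map₂ ((LinearMap.mul ℝ ℂ).comp Complex.conjAe.toLinearMap) B).compr₂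
    (TensorProduct.rid ℝ ℂ).toLinearMap

theorem complexForm_tmul (B : E →ₗ[ℝ] E →ₗ[ℝ] ℝ) (a b : ℂ) (u v : E) :
    complexForm B (a ⊗ₜ u) (b ⊗ₜ v) = (starRingEnd ℂ) a * b * B u v := by
  simp [complexForm]
  ring

theorem exists_re_im (z : ℂ ⊗[ℝ] E) :
    ∃ x y : E, z = (1 : ℂ) ⊗ₜ[ℝ] x + Complex.I ⊗ₜ[ℝ] y := by
  induction z using TensorProduct.induction_on with
  | zero => exact ⟨0, 0, by simp⟩
  | tmul a u =>
    refine ⟨a.re • u, a.im • u, ?_⟩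
    rw [← TensorProduct.smul_tmul, ← TensorProduct.smul_tmul, ← TensorProduct.add_tmul]
    congr 1
    apply Complex.ext <;> simp
  | add z w hz hw =>
    obtain ⟨x, y, rfl⟩ := hz
    obtain ⟨x', y', rfl⟩ := hw
    exact ⟨x + x', y + y', by simp only [TensorProduct.tmul_add]; abel⟩

theorem complexForm_self {B : E →ₗ[ℝ] E →ₗ[ℝ] ℝ} (hB : ∀ u v, B u v = B v u) (x y : E) :
    complexForm B ((1 : ℂ) ⊗ₜ[ℝ] x + Complex.I ⊗ₜ[ℝ] y)
      ((1 : ℂ) ⊗ₜ[ℝ] x + Complex.I ⊗ₜ[ℝ] y) = ((B x x + B y y : ℝ) : ℂ) := by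
  simp only [map_add, LinearMap.add_apply, complexForm_tmul, hB y x]
  simp

theorem complexForm_conj {B : E →ₗ[ℝ] E →ₗ[ℝ] ℝ} (hB : ∀ u v, B u v = B v u)
    (z w : ℂ ⊗[ℝ] E) : (starRingEnd ℂ) (complexForm B w z) = complexForm B z w := by
  induction z using TensorProduct.induction_on with
  | zero => simp
  | add z z' hz hz' => simp [hz, hz']
  | tmul a u =>
    induction w using TensorProduct.induction_on with
    | zero => simp
    | add w w' hw hw' => simp [hw, hw']
    | tmul b v =>
      simp only [complexForm_tmul, map_mul, Complex.conj_conj, Complex.conj_ofReal, hB v u]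
      ring

theorem complexForm_smul (B : E →ₗ[ℝ] E →ₗ[ℝ] ℝ) (c : ℂ)
    (z w : ℂ ⊗[ℝ] E) : complexForm B (c • z) w = (starRingEnd ℂ) c * complexForm B z w := by
  induction z using TensorProduct.induction_on with
  | zero => simp
  | add z z' hz hz' => simp [hz, hz', mul_add]
  | tmul a u =>
    induction w using TensorProduct.induction_on with
    | zero => simp
    | add w w' hw hw' => simp [hw, hw', mul_add]
    | tmul b v =>
      simp only [TensorProduct.smul_tmul', complexForm_tmul, smul_eq_mul, map_mul]
      ring

end Complexification

section RealFock

variable (q : ℝ) (H : Type*) [NormedAddCommGroup H] [InnerProductSpace ℝ H]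

/-- The real algebraic Fock space `⨁ₙ H^{⊗n}`; its complexification is `⨁ₙ (H_ℂ)^{⊗n}`. -/
abbrev RealFock : Type _ := ⨁ n : ℕ, ⨂[ℝ]^n H

/-- The form `⟨·,·⟩_q` on the real algebraic Fock space; different levels are orthogonal. -/
def fockForm : RealFock H →ₗ[ℝ] RealFock H →ₗ[ℝ] ℝ :=
  DirectSum.toModule ℝ ℕ _ fun n =>
    (levelForm q H n).compl₂ (DirectSum.component ℝ ℕ (fun n => ⨂[ℝ]^n H) n)

variable {H}

theorem fockForm_lof (n : ℕ) (u : ⨂[ℝ]^n H) (v : RealFock H) :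
    fockForm q H (DirectSum.lof ℝ ℕ (fun n => ⨂[ℝ]^n H) n u) v = levelForm q H n u (v n) := by
  simp [fockForm, DirectSum.toModule_lof]
  rfl

open Classical in
theorem eq_sum_lof (u : RealFock H) :
    u = ∑ n ∈ DFinsupp.support u, DirectSum.lof ℝ ℕ (fun n => ⨂[ℝ]^n H) n (u n) :=
  (DirectSum.sum_support_of u).symm

open Classical in
theorem fockForm_eq_sum (u v : RealFock H) :
    fockForm q H u v = ∑ n ∈ DFinsupp.support u, levelForm q H n (u n) (v n) := by
  conv_lhs => rw [eq_sum_lof u]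
  simp only [map_sum, LinearMap.sum_apply, fockForm_lof]

theorem fockForm_symm (u v : RealFock H) : fockForm q H u v = fockForm q H v u := by
  classical
  rw [fockForm_eq_sum, fockForm_eq_sum]
  rw [Finset.sum_subset (Finset.subset_union_left (s₂ := DFinsupp.support v)),
    Finset.sum_subset (Finset.subset_union_right (s₁ := DFinsupp.support u)
      (s₂ := DFinsupp.support v))]
  · exact Finset.sum_congr rfl fun n _ => levelForm_symm q _ _
  · intro n _ hn
    rw [DFinsupp.notMem_support_iff.mp hn]
    simp
  · intro n _ hn
    rw [DFinsupp.notMem_support_iff.mp hn]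
    simp

theorem fockForm_nonneg (hq : |q| ≤ 1) (u : RealFock H) : 0 ≤ fockForm q H u u := by
  classical
  rw [fockForm_eq_sum]
  exact Finset.sum_nonneg fun n _ => levelForm_nonneg q hq _

/-- Creation: `ξ₁ ⊗ ⋯ ⊗ ξₙ ↦ ξ ⊗ ξ₁ ⊗ ⋯ ⊗ ξₙ`. -/
def realCreation (ξ : H) : RealFock H →ₗ[ℝ] RealFock H :=
  DirectSum.toModule ℝ ℕ _ fun n =>
    (DirectSum.lof ℝ ℕ (fun n => ⨂[ℝ]^n H) (n + 1)).comp (tensorCons n ξ)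

theorem realCreation_lof (ξ : H) (n : ℕ) (u : ⨂[ℝ]^n H) :
    realCreation ξ (DirectSum.lof ℝ ℕ (fun n => ⨂[ℝ]^n H) n u) =
      DirectSum.lof ℝ ℕ (fun n => ⨂[ℝ]^n H) (n + 1) (tensorCons n ξ u) := by
  simp [realCreation, DirectSum.toModule_lof]

theorem realCreation_apply_succ (ξ : H) (u : RealFock H) (n : ℕ) :
    realCreation ξ u (n + 1) = tensorCons n ξ (u n) := by
  induction u using DirectSum.induction_on with
  | zero => simp
  | add u v hu hv => simp [hu, hv]
  | of m u =>
    have := realCreation_lof ξ m u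
    rw [DirectSum.lof_eq_of] at this
    rw [this, DirectSum.lof_eq_of]
    by_cases h : m = n
    · subst h
      simp
    · rw [DirectSum.of_eq_of_ne _ _ _ (by omega), DirectSum.of_eq_of_ne _ _ _ (by omega)]
      simp

theorem realCreation_le (hq : |q| < 1) (ξ : H) (u : RealFock H) :
    fockForm q H (realCreation ξ u) (realCreation ξ u) ≤
      ‖ξ‖ ^ 2 / (1 - |q|) * fockForm q H u u := by
  classical
  have h : fockForm q H (realCreation ξ u) (realCreation ξ u) =
      ∑ n ∈ DFinsupp.support u,
        levelForm q H (n + 1) (tensorCons n ξ (u n)) (tensorCons n ξ (u n)) := by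
    conv_lhs => enter [1, 2]; rw [eq_sum_lof u]
    simp only [map_sum, LinearMap.sum_apply, realCreation_lof, fockForm_lof,
      realCreation_apply_succ]
  rw [h, fockForm_eq_sum, Finset.mul_sum]
  exact Finset.sum_le_sum fun n _ => levelForm_cons_le q hq ξ n (u n)

/-- Second quantization of the dilation `r • id`:
`ξ₁ ⊗ ⋯ ⊗ ξₙ ↦ (r • ξ₁) ⊗ ⋯ ⊗ (r • ξₙ)`. -/
def realDilation (r : ℝ) : RealFock H →ₗ[ℝ] RealFock H :=
  DirectSum.toModule ℝ ℕ _ fun n =>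
    (DirectSum.lof ℝ ℕ (fun n => ⨂[ℝ]^n H) n).comp
      (PiTensorProduct.map fun _ => r • (LinearMap.id : H →ₗ[ℝ] H))

theorem map_smul_id (r : ℝ) (n : ℕ) (u : ⨂[ℝ]^n H) :
    PiTensorProduct.map (fun _ => r • (LinearMap.id : H →ₗ[ℝ] H)) u = r ^ n • u := by
  suffices h : PiTensorProduct.map (fun _ : Fin n => r • (LinearMap.id : H →ₗ[ℝ] H)) =
      r ^ n • LinearMap.id from LinearMap.congr_fun h u
  ext v
  simp only [LinearMap.compMultilinearMap_apply, PiTensorProduct.map_tprod, LinearMap.smul_apply,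
    LinearMap.id_apply]
  rw [MultilinearMap.map_smul_univ]
  simp

theorem realDilation_lof (r : ℝ) (n : ℕ) (u : ⨂[ℝ]^n H) :
    realDilation r (DirectSum.lof ℝ ℕ (fun n => ⨂[ℝ]^n H) n u) =
      r ^ n • DirectSum.lof ℝ ℕ (fun n => ⨂[ℝ]^n H) n u := by
  rw [realDilation, DirectSum.toModule_lof, LinearMap.comp_apply, map_smul_id, map_smul]

theorem realDilation_apply (r : ℝ) (u : RealFock H) (n : ℕ) :
    realDilation r u n = r ^ n • u n := by
  induction u using DirectSum.induction_on with
  | zero => simp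
  | add u v hu hv => simp [hu, hv]
  | of m u =>
    have := realDilation_lof r m u
    rw [DirectSum.lof_eq_of] at this
    rw [this, DirectSum.smul_apply]
    by_cases h : m = n
    · subst h
      rfl
    · rw [DirectSum.of_eq_of_ne _ _ _ (Ne.symm h), smul_zero, smul_zero]

theorem realDilation_le (hq : |q| < 1) {r : ℝ} (hr : |r| ≤ 1) (u : RealFock H) :
    fockForm q H (realDilation r u) (realDilation r u) ≤ 1 * fockForm q H u u := by
  classical
  have h2 : fockForm q H (realDilation r u) (realDilation r u) =
      ∑ n ∈ DFinsupp.support u, r ^ n * (r ^ n * levelForm q H n (u n) (u n)) := by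
    conv_lhs => enter [1, 2]; rw [eq_sum_lof u]
    simp only [map_sum, LinearMap.sum_apply, realDilation_lof, map_smul, LinearMap.smul_apply,
      fockForm_lof, realDilation_apply, smul_eq_mul]
  rw [h2, one_mul, fockForm_eq_sum]
  refine Finset.sum_le_sum fun n _ => ?_
  rw [← mul_assoc, ← pow_add, ← two_mul, pow_mul, ← sq_abs, ← pow_mul]
  exact mul_le_of_le_one_left (levelForm_nonneg q hq.le _) (pow_le_one₀ (abs_nonneg r) hr)

end RealFock

section Fock

open scoped NNReal ENNReal

variable (q : Set.Ioo (-1 : ℝ) 1) (H : Type*) [NormedAddCommGroup H] [InnerProductSpace ℝ H]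

theorem abs_lt_one : |(q : ℝ)| < 1 := abs_lt.mpr ⟨q.2.1, q.2.2⟩

/-- The algebraic Fock space `⨁ₙ (H_ℂ)^{⊗n}`, realized as the complexification of `⨁ₙ H^{⊗n}`.
It carries the inner product `⟨·,·⟩_q`. -/
def PreFock (_q : Set.Ioo (-1 : ℝ) 1) (H : Type*) [NormedAddCommGroup H]
    [InnerProductSpace ℝ H] : Type _ := ℂ ⊗[ℝ] RealFock H

instance : AddCommGroup (PreFock q H) := inferInstanceAs (AddCommGroup (ℂ ⊗[ℝ] RealFock H))

instance : Module ℂ (PreFock q H) := inferInstanceAs (Module ℂ (ℂ ⊗[ℝ] RealFock H))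

/-- The inner product `⟨·,·⟩_q`, linear in the second argument. -/
@[reducible]
def preFockCore : PreInnerProductSpace.Core ℂ (PreFock q H) where
  inner z w := complexForm (fockForm q H) z w
  conj_inner_symm := complexForm_conj (fockForm_symm (q : ℝ))
  re_inner_nonneg z := by
    obtain ⟨x, y, rfl⟩ := exists_re_im z
    rw [complexForm_self (fockForm_symm (q : ℝ))]
    exact add_nonneg (fockForm_nonneg _ (abs_lt_one q).le x)
      (fockForm_nonneg _ (abs_lt_one q).le y)
  add_left x y z := LinearMap.map_add₂ (complexForm (fockForm q H)) x y z
  smul_left x y r := complexForm_smul (fockForm q H) r x y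

instance : SeminormedAddCommGroup (PreFock q H) :=
  @InnerProductSpace.Core.toSeminormedAddCommGroup ℂ (PreFock q H) _ _ _ (preFockCore q H)

instance : InnerProductSpace ℂ (PreFock q H) := InnerProductSpace.ofCore (preFockCore q H)

variable {H}

/-- The identification of `ℂ ⊗ ⨁ₙ H^{⊗n}` with the algebraic Fock space. -/
def toPreFock : (ℂ ⊗[ℝ] RealFock H) ≃ₗ[ℂ] PreFock q H := LinearEquiv.refl ℂ _

theorem inner_toPreFock (z w : ℂ ⊗[ℝ] RealFock H) :
    inner ℂ (toPreFock q z) (toPreFock q w) = complexForm (fockForm q H) z w := rfl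

theorem preFock_norm_sq (x y : RealFock H) :
    ‖toPreFock q ((1 : ℂ) ⊗ₜ[ℝ] x + Complex.I ⊗ₜ[ℝ] y)‖ ^ 2 =
      fockForm q H x x + fockForm q H y y := by
  rw [← inner_self_eq_norm_sq (𝕜 := ℂ), inner_toPreFock,
    complexForm_self (fockForm_symm (q : ℝ))]
  simp

/-- The `ℂ`-linear extension to the algebraic Fock space of a real operator that is bounded
for `⟨·,·⟩_q`. -/
def preFockMap (T : RealFock H →ₗ[ℝ] RealFock H) (C : ℝ) (hC : 0 ≤ C)
    (hT : ∀ u, fockForm q H (T u) (T u) ≤ C * fockForm q H u u) :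
    PreFock q H →L[ℂ] PreFock q H :=
  LinearMap.mkContinuous ((toPreFock q).conj (T.baseChange ℂ)) √C fun z => by
    obtain ⟨z, rfl⟩ := (toPreFock q).surjective z
    obtain ⟨x, y, rfl⟩ := exists_re_im z
    rw [LinearEquiv.conj_apply_apply, LinearEquiv.symm_apply_apply, map_add,
      LinearMap.baseChange_tmul, LinearMap.baseChange_tmul,
      ← pow_le_pow_iff_left₀ (norm_nonneg _) (by positivity) two_ne_zero, mul_pow,
      Real.sq_sqrt hC, preFock_norm_sq, preFock_norm_sq, mul_add]
    exact add_le_add (hT x) (hT y)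

variable (H) in
/-- The `q`-Fock space: the Hilbert space completion of the algebraic Fock space. -/
def Fock : Type _ := UniformSpace.Completion (PreFock q H)

instance : NormedAddCommGroup (Fock q H) :=
  inferInstanceAs (NormedAddCommGroup (UniformSpace.Completion (PreFock q H)))

instance : InnerProductSpace ℂ (Fock q H) :=
  inferInstanceAs (InnerProductSpace ℂ (UniformSpace.Completion (PreFock q H)))

instance : CompleteSpace (Fock q H) :=
  inferInstanceAs (CompleteSpace (UniformSpace.Completion (PreFock q H)))

/-- The canonical isometry from the algebraic Fock space to its completion. -/
def toFock : PreFock q H →ₗᵢ[ℂ] Fock q H := UniformSpace.Completion.toComplₗᵢ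

theorem denseRange_toFock : DenseRange (toFock q : PreFock q H → Fock q H) :=
  UniformSpace.Completion.denseRange_coe

/-- The continuous extension to the `q`-Fock space of a bounded operator on the algebraic Fock
space. -/
def fockMap (T : PreFock q H →L[ℂ] PreFock q H) : Fock q H →L[ℂ] Fock q H :=
  ContinuousLinearMap.completion T

theorem fockMap_toFock (T : PreFock q H →L[ℂ] PreFock q H) (z : PreFock q H) :
    fockMap q T (toFock q z) = toFock q (T z) :=
  ContinuousLinearMap.completion_apply_coe T z

/-- The elementary tensor `ξ₁ ⊗ ⋯ ⊗ ξₙ` with `ξᵢ ∈ H`, as a vector of the `q`-Fock space. -/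
def elementaryTensor {n : ℕ} (ξ : Fin n → H) : Fock q H :=
  toFock q (toPreFock q ((1 : ℂ) ⊗ₜ[ℝ]
    DirectSum.lof ℝ ℕ (fun n => ⨂[ℝ]^n H) n (PiTensorProduct.tprod ℝ ξ)))

variable (H) in
/-- The vacuum vector `Ω`. -/
def vacuum : Fock q H := elementaryTensor q (Fin.elim0 : Fin 0 → H)

/-- The creation operator `c_q(ξ)`. -/
def creation (ξ : H) : Fock q H →L[ℂ] Fock q H :=
  fockMap q <| preFockMap q (realCreation ξ) (‖ξ‖ ^ 2 / (1 - |(q : ℝ)|))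
    (div_nonneg (sq_nonneg _) (sub_nonneg.mpr (abs_lt_one q).le))
    (realCreation_le _ (abs_lt_one q) ξ)

theorem creation_elementaryTensor (ξ : H) {n : ℕ} (η : Fin n → H) :
    creation q ξ (elementaryTensor q η) =
      elementaryTensor q (Fin.cons ξ η : Fin (n + 1) → H) := by
  rw [creation, elementaryTensor, fockMap_toFock, preFockMap,
    LinearMap.mkContinuous_apply, LinearEquiv.conj_apply_apply, LinearEquiv.symm_apply_apply,
    LinearMap.baseChange_tmul, realCreation_lof, tensorCons_tprod]
  rfl

/-- The field operator `X_q(ξ) = c_q(ξ) + c_q(ξ)^*`. -/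
def fieldOp (ξ : H) : Fock q H →L[ℂ] Fock q H :=
  creation q ξ + (creation q ξ).adjoint

variable (H) in
/-- The `q`-Gaussian algebra: the von Neumann algebra on the `q`-Fock space generated by the
operators `X_q(ξ)`, that is, the double commutant of this self-adjoint set. -/
def qGaussianAlgebra : VonNeumannAlgebra (Fock q H) where
  toStarSubalgebra := StarSubalgebra.centralizer ℂ
    (StarSubalgebra.centralizer ℂ (Set.range (fieldOp q : H → Fock q H →L[ℂ] Fock q H)) :
      Set (Fock q H →L[ℂ] Fock q H))
  centralizer_centralizer' := by
    change Set.centralizer (Set.centralizer ((StarSubalgebra.centralizer ℂ _ :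
      StarSubalgebra ℂ (Fock q H →L[ℂ] Fock q H)) : Set (Fock q H →L[ℂ] Fock q H))) =
      ((StarSubalgebra.centralizer ℂ _ :
      StarSubalgebra ℂ (Fock q H →L[ℂ] Fock q H)) : Set (Fock q H →L[ℂ] Fock q H))
    simp only [StarSubalgebra.coe_centralizer, Set.centralizer_centralizer_centralizer]

variable (H) in
/-- The vacuum state `τ_q(A) = ⟨Ω, A Ω⟩`. -/
def vacuumState (A : Fock q H →L[ℂ] Fock q H) : ℂ := inner ℂ (vacuum q H) (A (vacuum q H))

/-- The noncommutative `L_p`-norm `‖x‖_p = τ_q((x^* x)^{p/2})^{1/p}` for `p < ∞`, where the power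
of the positive operator `x^* x` is taken by functional calculus, and the operator norm for
`p = ∞`. -/
def lpNorm (p : ℝ≥0∞) (x : Fock q H →L[ℂ] Fock q H) : ℝ :=
  if p = ⊤ then ‖x‖
  else (vacuumState q H ((star x * x) ^ (p.toReal / 2))).re ^ (1 / p.toReal)

/-- The second quantization of `e^{-t} id_H` on the `q`-Fock space:
`ξ₁ ⊗ ⋯ ⊗ ξₙ ↦ (e^{-t} ξ₁) ⊗ ⋯ ⊗ (e^{-t} ξₙ)`. -/
def fockSemigroup (t : ℝ≥0) : Fock q H →L[ℂ] Fock q H :=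
  fockMap q <| preFockMap q (realDilation (Real.exp (-(t : ℝ)))) 1 zero_le_one
    (realDilation_le _ (abs_lt_one q) (by
      rw [abs_of_pos (Real.exp_pos _), Real.exp_le_one_iff]
      simp))

theorem fockSemigroup_elementaryTensor (t : ℝ≥0) {n : ℕ} (ξ : Fin n → H) :
    fockSemigroup q t (elementaryTensor q ξ) =
      elementaryTensor q (fun i => Real.exp (-(t : ℝ)) • ξ i) := by
  rw [fockSemigroup, elementaryTensor, fockMap_toFock, preFockMap,
    LinearMap.mkContinuous_apply, LinearEquiv.conj_apply_apply, LinearEquiv.symm_apply_apply,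
    LinearMap.baseChange_tmul, realDilation, DirectSum.toModule_lof, LinearMap.comp_apply,
    PiTensorProduct.map_tprod]
  rfl

/-- `y = P_t^q x`: the element `y` of the `q`-Gaussian algebra whose vacuum vector `y Ω` is the
image of `x Ω` under the second quantization of `e^{-t} id_H`. -/
def IsOrnsteinUhlenbeck (t : ℝ≥0) (x y : Fock q H →L[ℂ] Fock q H) : Prop :=
  y ∈ qGaussianAlgebra q H ∧ y (vacuum q H) = fockSemigroup q t (x (vacuum q H))

open Classical in
/-- The `q`-Ornstein--Uhlenbeck semigroup `P_t^q = Γ_q(e^{-t} id_H)`. -/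
def ornsteinUhlenbeck (t : ℝ≥0) (x : Fock q H →L[ℂ] Fock q H) : Fock q H →L[ℂ] Fock q H :=
  if h : ∃ y, IsOrnsteinUhlenbeck q t x y then h.choose else 0

/-- `y = N_q x`, where `P_t^q = e^{-t N_q}`: the element `y` of the `q`-Gaussian algebra with
`y = lim_{t → 0+} (x - P_t^q x) / t` in `L_2`, where `L_2` is embedded in the `q`-Fock space
through `a ↦ a Ω`. -/
def IsNumber (x y : Fock q H →L[ℂ] Fock q H) : Prop :=
  y ∈ qGaussianAlgebra q H ∧
    Filter.Tendsto
      (fun t : ℝ≥0 => ((t : ℝ)⁻¹ : ℂ) •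
        (x (vacuum q H) - fockSemigroup q t (x (vacuum q H))))
      (nhdsWithin 0 (Set.Ioi 0)) (nhds (y (vacuum q H)))

open Classical in
/-- The generator `N_q` of the `q`-Ornstein--Uhlenbeck semigroup `P_t^q = e^{-t N_q}`. -/
def numberOperator (x : Fock q H →L[ℂ] Fock q H) : Fock q H →L[ℂ] Fock q H :=
  if h : ∃ y, IsNumber q x y then h.choose else 0

variable (H) in
/-- The space spanned by the elements of the `q`-Gaussian algebra whose degrees lie in `S`:
those `x` in the algebra for which `x Ω` is a linear combination of tensors `ξ₁ ⊗ ⋯ ⊗ ξₙ`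
with `n ∈ S`. -/
def degreeSpace (S : Set ℕ) : Submodule ℂ (Fock q H →L[ℂ] Fock q H) where
  carrier := {x | x ∈ qGaussianAlgebra q H ∧ x (vacuum q H) ∈
    Submodule.span ℂ {v : Fock q H | ∃ n ∈ S, ∃ ξ : Fin n → H, v = elementaryTensor q ξ}}
  add_mem' hx hy := ⟨add_mem hx.1 hy.1, add_mem hx.2 hy.2⟩
  zero_mem' := ⟨zero_mem _, zero_mem _⟩
  smul_mem' c _ hx :=
    ⟨(qGaussianAlgebra q H).toStarSubalgebra.smul_mem hx.1 c, Submodule.smul_mem _ c hx.2⟩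

variable (H) in
/-- The `d`-th tail space `𝒫^{≥ d}`. -/
def tailSpace (d : ℕ) : Submodule ℂ (Fock q H →L[ℂ] Fock q H) := degreeSpace q H (Set.Ici d)

variable (H) in
/-- The low-degree space `𝒫^{≤ d}`. -/
def lowDegreeSpace (d : ℕ) : Submodule ℂ (Fock q H →L[ℂ] Fock q H) :=
  degreeSpace q H (Set.Iic d)

/-- The Hilbert space direct sum `H ⊕ H`. -/
abbrev Double (H : Type*) : Type _ := WithLp 2 (H × H)

/-- The holomorphic variable `Z_q(ξ) = (X_q(ξ, 0) + i X_q(0, ξ)) / √2`. -/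
def holomorphicVar (ξ : H) : Fock q (Double H) →L[ℂ] Fock q (Double H) :=
  ((1 / √2 : ℝ) : ℂ) •
    (fieldOp q (WithLp.toLp 2 (ξ, (0 : H))) +
      Complex.I • fieldOp q (WithLp.toLp 2 ((0 : H), ξ)))

variable (H) in
/-- The `q`-holomorphic algebra, generated by the `Z_q(ξ)`, `ξ ∈ H`; its elements are the
holomorphic polynomials. -/
def holomorphicAlgebra : Subalgebra ℂ (Fock q (Double H) →L[ℂ] Fock q (Double H)) :=
  Algebra.adjoin ℂ (Set.range (holomorphicVar q))

end Fock

end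

end QGaussian

open scoped NNReal ENNReal
open QGaussian

/-!
The rotations `(ξ, η) ↦ (cos θ ξ - sin θ η, sin θ ξ + cos θ η)` of `H ⊕ H` are implemented on the
`q`-Fock space by unitaries fixing the vacuum, hence by automorphisms of the `q`-Gaussian algebra
that preserve every `L_p`-norm. Such an automorphism multiplies each `Z_q(ξ)` by `exp (-iθ)`
(`conj_holomorphicVar`). On the other hand, the annihilation part of `Z_q(η)` and the creation part
of `Z_q(ξ)` satisfy the `q`-commutation relation without its scalar term, because the bilinear
pairing of `(η, iη)` with `(ξ, iξ)` vanishes. A product of `k` holomorphic variables therefore sends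
the vacuum into the `k`-th tensor power, so that the degree of a monomial is at the same time its
frequency under the rotations and its degree in the Fock space (`exists_eq_sum_homogeneous`). For
holomorphic polynomials, `P_t` and `N` are thus the Fourier multipliers `exp (-t k)` and `k` of an
isometric circle action.

The inequalities hold for such multipliers in any seminorm invariant under a circle action
(`CircleInvariant`). The Fejér kernel of degree `m`, discretized at the `2m`-th roots of unity, is a
positive measure of mass `m` with Fourier coefficients `m - k` for `0 ≤ k ≤ m`. Averaging the action
against it bounds the multiplier `b - k` on frequencies in `[a, b]` by `b - a`, and, after a
reflection, the multiplier `k` on `[0, b]` by `b`. Hence the multiplier `1 - s k` is bounded by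
`1 - s a` on `[a, b]` when `s b ≤ 1`. Its `n`-th power with `s = t / n` converges to `exp (-t k)`,
and the triangle inequality gives the lower bound for `k`. The bound `b` for `k` on `[0, b]` is
exponentiated in the same way.

The `L_p`-norm has to be subadditive on the whole algebra, and the vacuum vector has to be
separating, for `P_t x` and `N x` to be unique. Both follow from the right field operators: they
commute with the left ones (`commute_fieldOp_rightFieldOp`) and agree with them on the vacuum, so
the vacuum is cyclic for the commutant and its state is a trace (`isTracialVector_vacuum`).
Minkowski's inequality for the trace (`IsTracialVector.moment_add_le`) is obtained by duality from a
Hölder inequality, itself an instance of the three lines theorem for functions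
`z ↦ τ(a ^ (p (1 - z)) c b ^ (p z))`.
-/


namespace QGaussian

/-! ### The discretized Fejér kernel -/

section FejerKernel

open Finset

theorem sum_pow_eq_ite {n : ℕ} {ω : ℂ} (hω : IsPrimitiveRoot ω n) (e : ℕ) :
    ∑ j ∈ range n, ω ^ (j * e) = if n ∣ e then (n : ℂ) else 0 := by
  have h1 : ∀ j, ω ^ (j * e) = (ω ^ e) ^ j := fun j => by rw [← pow_mul, mul_comm]
  simp only [h1]
  split_ifs with h
  · simp [(hω.pow_eq_one_iff_dvd e).mpr h]
  · have hne : ω ^ e ≠ 1 := fun h' => h ((hω.pow_eq_one_iff_dvd e).mp h')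
    rw [geom_sum_eq hne, ← pow_mul, mul_comm, pow_mul, hω.pow_eq_one]
    simp

/-- The Fourier coefficients of the Fejér kernel `|∑_{l < m} z ^ l| ^ 2`, computed by sampling at
the `2m`-th roots of unity. -/
theorem sum_fejer_mul_pow {m : ℕ} (hm : 0 < m) {ω : ℂ} (hω : IsPrimitiveRoot ω (2 * m)) {k : ℕ}
    (hk : k ≤ m) :
    ∑ j ∈ range (2 * m), ((‖∑ l ∈ range m, ω ^ (j * l)‖ ^ 2 : ℝ) : ℂ) * (ω ^ j) ^ k =
      2 * m * (m - k) := by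
  have hω1 : ‖ω‖ = 1 := hω.norm'_eq_one (by omega)
  have hconj : ∀ j l, l < m → (starRingEnd ℂ) (ω ^ (j * l)) = ω ^ (j * (2 * m - l)) := by
    intro j l hl
    have h : ω ^ (j * l) * ω ^ (j * (2 * m - l)) = 1 := by
      rw [← pow_add, ← mul_add, show l + (2 * m - l) = 2 * m by omega, mul_comm, pow_mul,
        hω.pow_eq_one, one_pow]
    have h' : (starRingEnd ℂ) (ω ^ (j * l)) * ω ^ (j * l) = 1 := by
      rw [Complex.conj_mul']
      simp [hω1]
    exact left_inv_eq_right_inv h' h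
  have hterm : ∀ j, ((‖∑ l ∈ range m, ω ^ (j * l)‖ ^ 2 : ℝ) : ℂ) * (ω ^ j) ^ k =
      ∑ l ∈ range m, ∑ l' ∈ range m, ω ^ (j * (l + (2 * m - l') + k)) := by
    intro j
    rw [Complex.ofReal_pow, ← Complex.mul_conj', map_sum, sum_mul_sum, sum_mul]
    refine sum_congr rfl fun l _ => ?_
    rw [sum_mul]
    refine sum_congr rfl fun l' hl' => ?_
    rw [hconj j l' (mem_range.mp hl'), ← pow_add, ← pow_mul, ← pow_add]
    congr 1
    ring
  simp only [hterm]
  rw [sum_comm]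
  have h2 : ∀ l ∈ range m, ∑ j ∈ range (2 * m), ∑ l' ∈ range m,
      ω ^ (j * (l + (2 * m - l') + k)) = if l < m - k then ((2 * m : ℕ) : ℂ) else 0 := by
    intro l hl
    rw [mem_range] at hl
    rw [sum_comm]
    simp only [sum_pow_eq_ite hω]
    have h3 : ∀ l' ∈ range m, (if 2 * m ∣ l + (2 * m - l') + k then ((2 * m : ℕ) : ℂ) else 0) =
        if l' = l + k then ((2 * m : ℕ) : ℂ) else 0 := by
      intro l' hl'
      rw [mem_range] at hl'
      refine if_congr ⟨?_, ?_⟩ rfl rfl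
      · rintro ⟨c, hc⟩
        have hc1 : c = 1 := by
          have h4 : 0 < c := by
            rcases Nat.eq_zero_or_pos c with h | h
            · subst h; omega
            · exact h
          have h5 : c < 2 := by
            by_contra h
            have : 2 * m * 2 ≤ 2 * m * c := Nat.mul_le_mul_left _ (by omega)
            omega
          omega
        subst hc1
        omega
      · rintro rfl
        exact ⟨1, by omega⟩
    rw [sum_congr rfl h3, sum_ite_eq']
    refine if_congr ?_ rfl rfl
    rw [mem_range]
    omega
  rw [sum_congr rfl h2, sum_ite, sum_const_zero, add_zero, sum_const,
    show (range m).filter (fun l => l < m - k) = range (m - k) by ext; simp; omega]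
  simp [Nat.cast_sub hk]
  ring

/-- A positive measure of mass `m` on the circle, supported on finitely many points, whose Fourier
coefficients of order `0, …, m` are `m, m - 1, …, 0`: the discretized Fejér kernel. -/
theorem exists_fejer_measure (m : ℕ) : ∃ (w : ℕ → ℝ) (u : ℕ → ℂ), (∀ j, 0 ≤ w j) ∧
    (∀ j, ‖u j‖ = 1) ∧ ∀ k ≤ m, ∑ j ∈ range (2 * m), (w j : ℂ) * u j ^ k = m - k := by
  rcases Nat.eq_zero_or_pos m with rfl | hm
  · exact ⟨0, 1, fun _ => le_rfl, by simp, by simp⟩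
  have hω := Complex.isPrimitiveRoot_exp (2 * m) (by omega)
  set ω := Complex.exp (2 * Real.pi * Complex.I / ((2 * m : ℕ) : ℂ))
  have hω1 : ‖ω‖ = 1 := hω.norm'_eq_one (by omega)
  have hm0 : (m : ℂ) ≠ 0 := by exact_mod_cast hm.ne'
  refine ⟨fun j => ‖∑ l ∈ range m, ω ^ (j * l)‖ ^ 2 / (2 * m), fun j => ω ^ j,
    fun j => by positivity, by simp [hω1], fun k hk => ?_⟩
  have := sum_fejer_mul_pow hm hω hk
  simp only [Complex.ofReal_div, div_mul_eq_mul_div, ← sum_div, this]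
  push_cast
  field_simp

end FejerKernel

/-! ### Multipliers for circle actions -/

section Multiplier

open Finset

variable {V : Type*} [AddCommGroup V] [Module ℂ V] (S : Seminorm ℂ V) (v : ℕ → V)

theorem seminorm_sum_le {ι : Type*} (s : Finset ι) (f : ι → V) :
    S (∑ i ∈ s, f i) ≤ ∑ i ∈ s, S (f i) := by
  classical
  induction s using Finset.induction_on with
  | empty => simp
  | insert a s ha ih =>
    rw [sum_insert ha, sum_insert ha]
    exact (map_add_le_add S _ _).trans (by gcongr)

/-- A seminorm is invariant under the circle action that multiplies the `k`-th term of a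
linear combination of `v 0, v 1, …` by `u ^ k`. -/
def CircleInvariant : Prop :=
  ∀ (I : Finset ℕ) (φ : ℕ → ℂ) (u : ℂ), ‖u‖ = 1 →
    S (∑ k ∈ I, (u ^ k * φ k) • v k) = S (∑ k ∈ I, φ k • v k)

variable {S v}

/-- A multiplier that averages the circle action against a positive measure, twisted by scalars of
modulus one, is bounded by the mass of the measure. -/
theorem CircleInvariant.average_le (h : CircleInvariant S v) {ι : Type*} (s : Finset ι)
    (I : Finset ℕ) (w : ι → ℝ) (hw : ∀ j, 0 ≤ w j) (c u : ι → ℂ) (hc : ∀ j, ‖c j‖ = 1)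
    (hu : ∀ j, ‖u j‖ = 1) (φ : ℕ → ℂ) :
    S (∑ k ∈ I, ((∑ j ∈ s, (w j : ℂ) * (c j * u j ^ k)) * φ k) • v k) ≤
      (∑ j ∈ s, w j) * S (∑ k ∈ I, φ k • v k) := by
  have h1 : ∑ k ∈ I, ((∑ j ∈ s, (w j : ℂ) * (c j * u j ^ k)) * φ k) • v k =
      ∑ j ∈ s, ((w j : ℂ) * c j) • ∑ k ∈ I, (u j ^ k * φ k) • v k := by
    simp only [sum_mul, sum_smul, smul_sum, smul_smul]
    rw [sum_comm]
    refine sum_congr rfl fun j _ => sum_congr rfl fun k _ => ?_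
    congr 1
    ring
  rw [h1, sum_mul]
  refine (seminorm_sum_le S _ _).trans (sum_le_sum fun j _ => ?_)
  rw [map_smul_eq_mul, h I φ _ (hu j)]
  simp [hc, abs_of_nonneg (hw j)]

/-- The multiplier `k ↦ b - k` is bounded by `b - a` on frequencies in `[a, b]`: up to a shift of
frequencies, it is an average of the circle action against the Fejér kernel. -/
theorem CircleInvariant.sub_mul_le (h : CircleInvariant S v) {a b : ℕ} (hab : a ≤ b)
    (φ : ℕ → ℂ) :
    S (∑ k ∈ Icc a b, ((b - k : ℂ) * φ k) • v k) ≤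
      ((b : ℝ) - a) * S (∑ k ∈ Icc a b, φ k • v k) := by
  obtain ⟨m, rfl⟩ := Nat.exists_eq_add_of_le hab
  obtain ⟨w, u, hw, hu, hk⟩ := exists_fejer_measure m
  have hmass : ∑ j ∈ range (2 * m), w j = m := by
    have := hk 0 (by omega)
    simp only [pow_zero, mul_one, Nat.cast_zero, sub_zero] at this
    exact_mod_cast this
  -- The factors `(u j ^ a)⁻¹` shift the frequencies from `[a, a + m]` to `[0, m]`.
  have := h.average_le (range (2 * m)) (Icc a (a + m)) w hw
    (fun j => (u j ^ a)⁻¹) u (by simp [hu]) hu φ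
  rw [hmass] at this
  convert this using 2
  · refine sum_congr rfl fun k hk' => ?_
    rw [mem_Icc] at hk'
    obtain ⟨i, rfl⟩ := Nat.exists_eq_add_of_le hk'.1
    have h2 : ∀ j, (u j ^ a)⁻¹ * u j ^ (a + i) = u j ^ i := by
      intro j
      have hj : u j ≠ 0 := fun h0 => by simpa [h0] using hu j
      rw [pow_add, inv_mul_cancel_left₀ (pow_ne_zero _ hj)]
    simp only [h2, hk i (by omega)]
    push_cast
    congr 2
    ring
  · push_cast
    ring

/-- The multiplier `k ↦ k` is bounded by `b` on frequencies in `[0, b]` (Bernstein's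
inequality). -/
theorem CircleInvariant.natCast_mul_le (h : CircleInvariant S v) (b : ℕ) (φ : ℕ → ℂ) :
    S (∑ k ∈ Icc 0 b, ((k : ℂ) * φ k) • v k) ≤ b * S (∑ k ∈ Icc 0 b, φ k • v k) := by
  obtain ⟨w, u, hw, hu, hk⟩ := exists_fejer_measure b
  have hmass : ∑ j ∈ range (2 * b), w j = b := by
    have := hk 0 (by omega)
    simp only [pow_zero, mul_one, Nat.cast_zero, sub_zero] at this
    exact_mod_cast this
  -- The action of `(u j)⁻¹` twisted by `u j ^ b` reflects the frequency `k` to `b - k`.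
  have := h.average_le (range (2 * b)) (Icc 0 b) w hw
    (fun j => u j ^ b) (fun j => (u j)⁻¹) (by simp [hu]) (by simp [hu]) φ
  rw [hmass] at this
  convert this using 2
  refine sum_congr rfl fun k hk' => ?_
  rw [mem_Icc] at hk'
  have h2 : ∀ j, u j ^ b * (u j)⁻¹ ^ k = u j ^ (b - k) := by
    intro j
    have hj : u j ≠ 0 := fun h0 => by simpa [h0] using hu j
    rw [inv_pow, pow_sub₀ _ hj hk'.2]
  simp only [h2, hk (b - k) (by omega)]
  rw [Nat.cast_sub hk'.2]
  congr 2
  ring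

theorem tendsto_seminorm_sum (S : Seminorm ℂ V) (v : ℕ → V) (I : Finset ℕ) {ψ : ℕ → ℕ → ℂ}
    {φ : ℕ → ℂ} (hψ : ∀ k ∈ I, Filter.Tendsto (fun n => ψ n k) Filter.atTop (nhds (φ k))) :
    Filter.Tendsto (fun n => S (∑ k ∈ I, ψ n k • v k)) Filter.atTop
      (nhds (S (∑ k ∈ I, φ k • v k))) := by
  rw [tendsto_iff_dist_tendsto_zero]
  have h0 : Filter.Tendsto (fun n => ∑ k ∈ I, ‖ψ n k - φ k‖ * S (v k)) Filter.atTop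
      (nhds 0) := by
    rw [show (0 : ℝ) = ∑ k ∈ I, 0 * S (v k) by simp]
    exact tendsto_finsetSum _ fun k hk =>
      (tendsto_iff_norm_sub_tendsto_zero.mp (hψ k hk)).mul_const _
  refine squeeze_zero (fun _ => dist_nonneg) (fun n => ?_) h0
  rw [Real.dist_eq]
  refine (abs_sub_map_le_sub S _ _).trans ?_
  rw [← sum_sub_distrib]
  refine (seminorm_sum_le S _ _).trans (sum_le_sum fun k _ => ?_)
  rw [← sub_smul, map_smul_eq_mul]

/-- For frequencies in `[a, b]`, the affine multiplier `1 - s k` is bounded by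
`1 - s a` if `s b ≤ 1`. -/
theorem CircleInvariant.one_sub_mul_le (h : CircleInvariant S v) {a b : ℕ} (hab : a ≤ b) {s : ℝ}
    (hs : 0 ≤ s) (hsb : s * b ≤ 1) (φ : ℕ → ℂ) :
    S (∑ k ∈ Icc a b, ((1 - s * k : ℂ) * φ k) • v k) ≤
      (1 - s * a) * S (∑ k ∈ Icc a b, φ k • v k) := by
  have h1 : ∑ k ∈ Icc a b, ((1 - s * k : ℂ) * φ k) • v k =
      ((1 - s * b : ℝ) : ℂ) • ∑ k ∈ Icc a b, φ k • v k +
        (s : ℂ) • ∑ k ∈ Icc a b, ((b - k : ℂ) * φ k) • v k := by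
    simp only [smul_sum, smul_smul, ← sum_add_distrib, ← add_smul]
    refine sum_congr rfl fun k _ => ?_
    congr 1
    push_cast
    ring
  rw [h1]
  refine (map_add_le_add S _ _).trans ?_
  rw [map_smul_eq_mul, map_smul_eq_mul, Complex.norm_real, Complex.norm_real, Real.norm_eq_abs,
    Real.norm_eq_abs, abs_of_nonneg hs, abs_of_nonneg (by linarith)]
  have := mul_le_mul_of_nonneg_left (h.sub_mul_le hab φ) hs
  linarith

/-- The multiplier `k ↦ k` is bounded from below by `a` on frequencies in `[a, b]`: the identity is
`(1 - k / b) + k / b`, and the first summand is bounded by `1 - a / b`. -/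
theorem CircleInvariant.natCast_mul_ge (h : CircleInvariant S v) {a b : ℕ} (hab : a ≤ b)
    (φ : ℕ → ℂ) :
    a * S (∑ k ∈ Icc a b, φ k • v k) ≤ S (∑ k ∈ Icc a b, ((k : ℂ) * φ k) • v k) := by
  rcases Nat.eq_zero_or_pos b with rfl | hb
  · obtain rfl : a = 0 := by omega
    simp
  set s : ℝ := 1 / b with hs
  have hb' : (0 : ℝ) < b := by exact_mod_cast hb
  have hs0 : 0 < s := by positivity
  have h1 := h.one_sub_mul_le hab hs0.le (by rw [hs]; field_simp; exact le_rfl) φ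
  have h2 : ∑ k ∈ Icc a b, φ k • v k = ∑ k ∈ Icc a b, ((1 - s * k : ℂ) * φ k) • v k +
      (s : ℂ) • ∑ k ∈ Icc a b, ((k : ℂ) * φ k) • v k := by
    simp only [smul_sum, smul_smul, ← sum_add_distrib, ← add_smul]
    refine sum_congr rfl fun k _ => ?_
    congr 1
    ring
  have h3 := map_add_le_add S (∑ k ∈ Icc a b, ((1 - s * k : ℂ) * φ k) • v k)
    ((s : ℂ) • ∑ k ∈ Icc a b, ((k : ℂ) * φ k) • v k)
  rw [← h2, map_smul_eq_mul, Complex.norm_real, Real.norm_eq_abs, abs_of_pos hs0] at h3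
  have h4 : s * (a * S (∑ k ∈ Icc a b, φ k • v k)) ≤
      s * S (∑ k ∈ Icc a b, ((k : ℂ) * φ k) • v k) := by linarith
  exact le_of_mul_le_mul_left h4 hs0

theorem tendsto_one_add_div_pow (x : ℝ) : Filter.Tendsto
    (fun n : ℕ => (1 + (x : ℂ) / n) ^ n) Filter.atTop (nhds (Real.exp x : ℂ)) := by
  have := (Complex.continuous_ofReal.tendsto _).comp (Real.tendsto_one_add_div_pow_exp x)
  refine this.congr fun n => ?_
  simp

/-- On frequencies in `[a, b]`, the multiplier `exp (-t k)`, the limit of `(1 - t k / n) ^ n`, is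
bounded by `exp (-t a)`. -/
theorem CircleInvariant.exp_neg_mul_le (h : CircleInvariant S v) {a b : ℕ} (hab : a ≤ b) {t : ℝ}
    (ht : 0 ≤ t) (φ : ℕ → ℂ) :
    S (∑ k ∈ Icc a b, ((Real.exp (-t * k) : ℂ) * φ k) • v k) ≤
      Real.exp (-t * a) * S (∑ k ∈ Icc a b, φ k • v k) := by
  have hiter : ∀ s : ℝ, 0 ≤ s → s * b ≤ 1 → ∀ n : ℕ,
      S (∑ k ∈ Icc a b, ((1 - s * k : ℂ) ^ n * φ k) • v k) ≤
        (1 - s * a) ^ n * S (∑ k ∈ Icc a b, φ k • v k) := by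
    intro s hs hsb n
    have hsa : 0 ≤ 1 - s * a := by
      have : s * a ≤ s * b := by gcongr
      linarith
    induction n with
    | zero => simp
    | succ n ih =>
      have := h.one_sub_mul_le hab hs hsb (fun k => (1 - s * k : ℂ) ^ n * φ k)
      simp only [← mul_assoc, ← pow_succ'] at this
      refine this.trans ?_
      rw [pow_succ', mul_assoc]
      gcongr
  have hl := tendsto_seminorm_sum S v (Icc a b)
    (ψ := fun n k => (1 + ((-t * k : ℝ) : ℂ) / n) ^ n * φ k)
    (φ := fun k => (Real.exp (-t * k) : ℂ) * φ k)
    (fun k _ => (tendsto_one_add_div_pow (-t * k)).mul_const _)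
  have hr := (Real.tendsto_one_add_div_pow_exp (-t * a)).mul_const
    (S (∑ k ∈ Icc a b, φ k • v k))
  refine le_of_tendsto_of_tendsto hl hr ?_
  filter_upwards [Filter.eventually_ge_atTop (max 1 ⌈t * b⌉₊)] with n hn
  have hn1 : (1 : ℝ) ≤ n := by exact_mod_cast (le_max_left _ _).trans hn
  have hn2 : t * b ≤ n := (Nat.le_ceil _).trans (by exact_mod_cast (le_max_right _ _).trans hn)
  have := hiter (t / n) (by positivity)
    (by rw [div_mul_eq_mul_div, div_le_one (by linarith)]; exact hn2) n
  have h1 : ∀ k : ℕ, (1 + ((-t * k : ℝ) : ℂ) / n) = 1 - ((t / n : ℝ) : ℂ) * k := by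
    intro k
    push_cast
    ring
  have h2 : 1 + -t * (a : ℝ) / n = 1 - t / n * (a : ℝ) := by ring
  simp only [h1, h2]
  exact this

/-- On frequencies in `[0, b]`, the multiplier `exp (t k)`, the limit of `(1 + t k / n) ^ n`, is
bounded by `exp (t b)`. -/
theorem CircleInvariant.exp_mul_le (h : CircleInvariant S v) (b : ℕ) {t : ℝ}
    (ht : 0 ≤ t) (φ : ℕ → ℂ) :
    S (∑ k ∈ Icc 0 b, ((Real.exp (t * k) : ℂ) * φ k) • v k) ≤
      Real.exp (t * b) * S (∑ k ∈ Icc 0 b, φ k • v k) := by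
  have hiter : ∀ s : ℝ, 0 ≤ s → ∀ n : ℕ,
      S (∑ k ∈ Icc 0 b, ((1 + s * k : ℂ) ^ n * φ k) • v k) ≤
        (1 + s * b) ^ n * S (∑ k ∈ Icc 0 b, φ k • v k) := by
    intro s hs n
    induction n with
    | zero => simp
    | succ n ih =>
      have h1 : ∑ k ∈ Icc 0 b, ((1 + s * k : ℂ) ^ (n + 1) * φ k) • v k =
          ∑ k ∈ Icc 0 b, ((1 + s * k : ℂ) ^ n * φ k) • v k + (s : ℂ) •
            ∑ k ∈ Icc 0 b, ((k : ℂ) * ((1 + s * k : ℂ) ^ n * φ k)) • v k := by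
        simp only [smul_sum, smul_smul, ← sum_add_distrib, ← add_smul]
        refine sum_congr rfl fun k _ => ?_
        congr 1
        ring
      rw [h1]
      refine (map_add_le_add S _ _).trans ?_
      rw [map_smul_eq_mul, Complex.norm_real, Real.norm_eq_abs, abs_of_nonneg hs]
      have h2 := mul_le_mul_of_nonneg_left
        (h.natCast_mul_le b (fun k => (1 + s * k : ℂ) ^ n * φ k)) hs
      have h3 : (0 : ℝ) ≤ 1 + s * b := by positivity
      calc _ ≤ (1 + s * b) * S (∑ k ∈ Icc 0 b, ((1 + s * k : ℂ) ^ n * φ k) • v k) := by linarith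
        _ ≤ (1 + s * b) * ((1 + s * b) ^ n * S (∑ k ∈ Icc 0 b, φ k • v k)) := by gcongr
        _ = _ := by ring
  have hl := tendsto_seminorm_sum S v (Icc 0 b)
    (ψ := fun n k => (1 + ((t * k : ℝ) : ℂ) / n) ^ n * φ k)
    (φ := fun k => (Real.exp (t * k) : ℂ) * φ k)
    (fun k _ => (tendsto_one_add_div_pow (t * k)).mul_const _)
  have hr := (Real.tendsto_one_add_div_pow_exp (t * b)).mul_const
    (S (∑ k ∈ Icc 0 b, φ k • v k))
  refine le_of_tendsto_of_tendsto' hl hr fun n => ?_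
  have := hiter (t / n) (by positivity) n
  have h1 : ∀ k : ℕ, (1 + ((t * k : ℝ) : ℂ) / n) = 1 + ((t / n : ℝ) : ℂ) * k := by
    intro k
    push_cast
    ring
  have h2 : 1 + t * (b : ℝ) / n = 1 + t / n * (b : ℝ) := by ring
  simp only [h1, h2]
  exact this

end Multiplier


/-! ### Noncommutative Minkowski inequality for a tracial vector -/

section Tracial

open NormedSpace Filter Topology

variable {E : Type*} [NormedAddCommGroup E] [InnerProductSpace ℂ E] [CompleteSpace E]

/-- The vector functional `x ↦ ⟨Ω, x Ω⟩`. -/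
noncomputable def vectorState (Ω : E) : (E →L[ℂ] E) →L[ℂ] ℂ :=
  (innerSL ℂ Ω).comp (ContinuousLinearMap.apply ℂ E Ω)

omit [CompleteSpace E] in
theorem vectorState_apply (Ω : E) (x : E →L[ℂ] E) : vectorState Ω x = inner ℂ Ω (x Ω) := rfl

/-- The vector functional of `Ω` is a trace on the von Neumann algebra `M`. -/
def IsTracialVector (M : VonNeumannAlgebra E) (Ω : E) : Prop :=
  ∀ x ∈ M, ∀ y ∈ M, vectorState Ω (x * y) = vectorState Ω (y * x)

theorem mem_of_forall_commute {M : VonNeumannAlgebra E} {x : E →L[ℂ] E}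
    (h : ∀ g ∈ M.commutant, Commute x g) : x ∈ M := by
  rw [← M.commutant_commutant, VonNeumannAlgebra.mem_commutant_iff]
  exact fun g hg => (h g hg).symm

theorem commute_of_mem {M : VonNeumannAlgebra E} {x g : E →L[ℂ] E} (hx : x ∈ M)
    (hg : g ∈ M.commutant) : Commute x g :=
  VonNeumannAlgebra.mem_commutant_iff.mp hg x hx

theorem smul_mem' {M : VonNeumannAlgebra E} {x : E →L[ℂ] E} (c : ℂ) (hx : x ∈ M) : c • x ∈ M :=
  M.toStarSubalgebra.smul_mem hx c

theorem rpow_mem {M : VonNeumannAlgebra E} {a : E →L[ℂ] E} (ha : a ∈ M) (r : ℝ) : a ^ r ∈ M :=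
  mem_of_forall_commute fun _ hg => (commute_of_mem ha hg).cfc_nnreal _

theorem log_mem {M : VonNeumannAlgebra E} {a : E →L[ℂ] E} (ha : a ∈ M) : CFC.log a ∈ M :=
  mem_of_forall_commute fun _ hg => (commute_of_mem ha hg).cfc_real _

theorem exp_mem {M : VonNeumannAlgebra E} {a : E →L[ℂ] E} (ha : a ∈ M) : exp a ∈ M :=
  mem_of_forall_commute fun _ hg => (commute_of_mem ha hg).exp_left

theorem exp_smul_log {a : E →L[ℂ] E} (ha : IsStrictlyPositive a) (r : ℝ) :
    exp ((r : ℂ) • CFC.log a) = a ^ r := by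
  have hsp : ∀ x ∈ spectrum ℝ a, x ≠ 0 := fun x hx => (ha.spectrum_pos hx).ne'
  have hlog : ContinuousOn Real.log (spectrum ℝ a) := Real.continuousOn_log.mono hsp
  have hsa : IsSelfAdjoint a := ha.isSelfAdjoint
  rw [CFC.rpow_eq_cfc_real ha.nonneg, show (r : ℂ) • CFC.log a = r • CFC.log a from
    Complex.coe_smul r _, CFC.log, ← cfc_const_mul r Real.log a hlog,
    ← CFC.real_exp_eq_normedSpace_exp,
    ← cfc_comp' Real.exp (fun x => r * Real.log x) a (by fun_prop) (continuousOn_const.mul hlog)]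
  refine cfc_congr fun x hx => ?_
  rw [Real.rpow_def_of_pos (ha.spectrum_pos hx), mul_comm]

theorem exp_smul_eq_mul {L : E →L[ℂ] E} (z w : ℂ) :
    exp ((z + w) • L) = exp (z • L) * exp (w • L) := by
  let +nondep : NormedAlgebra ℚ (E →L[ℂ] E) := .restrictScalars ℚ ℂ _
  rw [add_smul, exp_add_of_commute]
  exact ((Commute.refl L).smul_left z).smul_right w

omit [CompleteSpace E] in
theorem norm_one_le : ‖(1 : E →L[ℂ] E)‖ ≤ 1 := ContinuousLinearMap.norm_id_le

theorem norm_le_norm_of_mem_spectrum {a : E →L[ℂ] E} {t : ℝ} (ht : t ∈ spectrum ℝ a) :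
    ‖t‖ ≤ ‖a‖ :=
  (spectrum.norm_le_norm_mul_of_mem ht).trans (mul_le_of_le_one_right (norm_nonneg a) norm_one_le)

theorem norm_exp_I_smul_le {L : E →L[ℂ] E} (hL : IsSelfAdjoint L) (r : ℝ) :
    ‖exp ((r * Complex.I : ℂ) • L)‖ ≤ 1 := by
  have hr : (r : ℂ) • L ∈ selfAdjoint (E →L[ℂ] E) := by
    rw [selfAdjoint.mem_iff, star_smul, hL.star_eq]
    simp
  set U := selfAdjoint.expUnitary ⟨(r : ℂ) • L, hr⟩ with hU
  have hUe : exp ((r * Complex.I : ℂ) • L) = U := by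
    rw [hU, selfAdjoint.expUnitary_coe, smul_smul, mul_comm]
  have h : ‖(U : E →L[ℂ] E)‖ * ‖(U : E →L[ℂ] E)‖ ≤ 1 := by
    rw [← CStarRing.norm_star_mul_self, Unitary.coe_star_mul_self]
    exact norm_one_le
  rw [hUe]
  nlinarith [norm_nonneg (U : E →L[ℂ] E)]

theorem norm_exp_smul_le {L : E →L[ℂ] E} (hL : IsSelfAdjoint L) (w : ℂ) :
    ‖exp (w • L)‖ ≤ Real.exp (|w.re| * ‖L‖) := by
  have h1 : ‖exp ((w.re : ℂ) • L)‖ ≤ Real.exp (|w.re| * ‖L‖) := by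
    have hsa : IsSelfAdjoint (w.re • L) := IsSelfAdjoint.smul (star_trivial _) hL
    rw [show (w.re : ℂ) • L = w.re • L from Complex.coe_smul _ _,
      ← CFC.real_exp_eq_normedSpace_exp]
    refine norm_cfc_le (Real.exp_pos _).le fun x hx => ?_
    rw [Real.norm_eq_abs, Real.abs_exp, Real.exp_le_exp]
    have := norm_le_norm_of_mem_spectrum hx
    rw [norm_smul, Real.norm_eq_abs, Real.norm_eq_abs] at this
    exact (le_abs_self x).trans this
  conv_lhs => rw [← Complex.re_add_im w, exp_smul_eq_mul]
  calc _ ≤ ‖exp ((w.re : ℂ) • L)‖ * ‖exp ((w.im * Complex.I : ℂ) • L)‖ := norm_mul_le _ _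
    _ ≤ Real.exp (|w.re| * ‖L‖) * 1 := by
        gcongr
        exact norm_exp_I_smul_le hL _
    _ = _ := mul_one _

omit [CompleteSpace E] in
theorem vectorState_re_nonneg (Ω : E) {a : E →L[ℂ] E} (ha : 0 ≤ a) :
    0 ≤ (vectorState Ω a).re := by
  have := ((ContinuousLinearMap.nonneg_iff_isPositive a).mp ha).inner_nonneg_right Ω
  exact (Complex.le_def.mp this).1

variable {M : VonNeumannAlgebra E} {Ω : E}

theorem IsTracialVector.norm_vectorState_mul_le (hΩ : IsTracialVector M Ω)
    {u a : E →L[ℂ] E} (hu : u ∈ M) (ha : a ∈ M) (ha0 : 0 ≤ a) :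
    ‖vectorState Ω (u * a)‖ ≤ ‖u‖ * (vectorState Ω a).re := by
  set b := a ^ (1 / 2 : ℝ) with hb
  have hbM : b ∈ M := rpow_mem ha _
  have hb0 : 0 ≤ b := CFC.rpow_nonneg
  have hbb : b * b = a := by
    rw [hb, ← CFC.sqrt_eq_rpow]
    exact CFC.sqrt_mul_sqrt_self a ha0
  have hsym : ∀ x y : E, inner ℂ x (b y) = inner ℂ (b x) y := fun x y => by
    rw [← ContinuousLinearMap.adjoint_inner_left, ← ContinuousLinearMap.star_eq_adjoint,
      (IsSelfAdjoint.of_nonneg hb0).star_eq]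
  have h1 : vectorState Ω (u * a) = inner ℂ (b Ω) (u (b Ω)) := by
    rw [← hbb, ← mul_assoc, hΩ _ (mul_mem hu hbM) _ hbM, vectorState_apply]
    exact hsym _ _
  have h2 : (vectorState Ω a).re = ‖b Ω‖ ^ 2 := by
    rw [← hbb, vectorState_apply, mul_apply_eq_comp, hsym, inner_self_eq_norm_sq_to_K]
    norm_cast
  rw [h1, h2]
  calc _ ≤ ‖b Ω‖ * ‖u (b Ω)‖ := norm_inner_le_norm _ _
    _ ≤ ‖b Ω‖ * (‖u‖ * ‖b Ω‖) := by gcongr; exact u.le_opNorm _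
    _ = _ := by ring

/-- Hölder's inequality in the form supplied by the three lines theorem: the analytic function
`z ↦ τ(a ^ (p (1 - z)) c b ^ (p z))` takes the value `τ(a ^ (p - 1) c b)` at `1 / p`. -/
theorem IsTracialVector.three_lines (hΩ : IsTracialVector M Ω) {a b c : E →L[ℂ] E}
    (ha : a ∈ M) (hb : b ∈ M) (hc : c ∈ M) (ha0 : IsStrictlyPositive a)
    (hb0 : IsStrictlyPositive b) (hc1 : ‖c‖ ≤ 1) {p : ℝ} (hp : 1 ≤ p) :
    ‖vectorState Ω (a ^ (p - 1) * c * b)‖ ≤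
      (vectorState Ω (a ^ p)).re ^ (1 - 1 / p) * (vectorState Ω (b ^ p)).re ^ (1 / p) := by
  have hp0 : 0 < p := by linarith
  set A := CFC.log a with hA
  set B := CFC.log b with hB
  have hAM : A ∈ M := log_mem ha
  have hBM : B ∈ M := log_mem hb
  have hAs : IsSelfAdjoint A := IsSelfAdjoint.log
  have hBs : IsSelfAdjoint B := IsSelfAdjoint.log
  have hexpM : ∀ {L : E →L[ℂ] E} (z : ℂ), L ∈ M → exp (z • L) ∈ M :=
    fun z hL => exp_mem (smul_mem' z hL)
  let F : ℂ → ℂ := fun z =>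
    vectorState Ω (exp ((p * (1 - z)) • A) * c * exp ((p * z) • B))
  have hF : F (1 / p : ℝ) = vectorState Ω (a ^ (p - 1) * c * b) := by
    have h1 : (p : ℂ) * (1 - ((1 / p : ℝ) : ℂ)) = ((p - 1 : ℝ) : ℂ) := by
      push_cast
      have : (p : ℂ) ≠ 0 := by exact_mod_cast hp0.ne'
      field_simp
    have h2 : (p : ℂ) * ((1 / p : ℝ) : ℂ) = ((1 : ℝ) : ℂ) := by
      push_cast
      have : (p : ℂ) ≠ 0 := by exact_mod_cast hp0.ne'
      field_simp
    simp only [F]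
    rw [h1, h2, hA, hB, exp_smul_log ha0, exp_smul_log hb0, CFC.rpow_one b hb0.nonneg]
  have hdiff : Differentiable ℂ F := by
    have h1 : ∀ (L : E →L[ℂ] E), Differentiable ℂ (fun z : ℂ => exp (z • L)) :=
      fun L z => (hasDerivAt_exp_smul_const L z).differentiableAt
    have h2 : Differentiable ℂ (fun z : ℂ => exp ((p * (1 - z)) • A)) :=
      (h1 A).comp (by fun_prop : Differentiable ℂ (fun z : ℂ => p * (1 - z)))
    have h3 : Differentiable ℂ (fun z : ℂ => exp ((p * z) • B)) :=
      (h1 B).comp (by fun_prop : Differentiable ℂ (fun z : ℂ => p * z))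
    exact (vectorState Ω).differentiable.comp ((h2.mul_const c).mul h3)
  have hbdd : BddAbove (norm ∘ F '' Complex.HadamardThreeLines.verticalClosedStrip 0 1) := by
    refine ⟨‖vectorState Ω‖ * (Real.exp (p * ‖A‖) * 1 * Real.exp (p * ‖B‖)), ?_⟩
    rintro _ ⟨z, hz, rfl⟩
    obtain ⟨hz0, hz1⟩ : 0 ≤ z.re ∧ z.re ≤ 1 := hz
    refine ((vectorState Ω).le_opNorm _).trans ?_
    gcongr
    refine (norm_mul_le _ _).trans ?_
    gcongr
    · refine (norm_mul_le _ _).trans ?_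
      gcongr
      refine (norm_exp_smul_le hAs _).trans ?_
      gcongr
      simp only [Complex.re_ofReal_mul, Complex.sub_re, Complex.one_re]
      rw [abs_of_nonneg (by nlinarith)]
      nlinarith
    · refine (norm_exp_smul_le hBs _).trans ?_
      gcongr
      simp only [Complex.re_ofReal_mul]
      rw [abs_of_nonneg (by nlinarith)]
      nlinarith
  have hleft : ∀ z ∈ Complex.re ⁻¹' {(0 : ℝ)}, ‖F z‖ ≤ (vectorState Ω (a ^ p)).re := by
    intro z hz
    have hz' : z = z.im * Complex.I := by
      conv_lhs => rw [← Complex.re_add_im z, show z.re = 0 from hz]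
      simp
    have h1 : (p : ℂ) * (1 - z) = ((p : ℝ) : ℂ) + ((-(p * z.im) : ℝ) : ℂ) * Complex.I := by
      conv_lhs => rw [hz']
      push_cast
      ring
    have h2 : (p : ℂ) * z = ((p * z.im : ℝ) : ℂ) * Complex.I := by
      conv_lhs => rw [hz']
      push_cast
      ring
    simp only [F]
    rw [h1, h2, exp_smul_eq_mul, hA, exp_smul_log ha0, ← hA, mul_assoc, mul_assoc,
      hΩ _ (rpow_mem ha p) _ (mul_mem (hexpM _ hAM) (mul_mem hc (hexpM _ hBM)))]
    refine (hΩ.norm_vectorState_mul_le (mul_mem (hexpM _ hAM) (mul_mem hc (hexpM _ hBM)))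
      (rpow_mem ha p) CFC.rpow_nonneg).trans ?_
    refine mul_le_of_le_one_left (vectorState_re_nonneg Ω CFC.rpow_nonneg) ?_
    refine (norm_mul_le _ _).trans (mul_le_one₀ (norm_exp_I_smul_le hAs _) (norm_nonneg _) ?_)
    exact (norm_mul_le _ _).trans (mul_le_one₀ hc1 (norm_nonneg _) (norm_exp_I_smul_le hBs _))
  have hright : ∀ z ∈ Complex.re ⁻¹' {(1 : ℝ)}, ‖F z‖ ≤ (vectorState Ω (b ^ p)).re := by
    intro z hz
    have hz' : z = 1 + z.im * Complex.I := by
      conv_lhs => rw [← Complex.re_add_im z, show z.re = 1 from hz]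
      simp
    have h1 : (p : ℂ) * (1 - z) = ((-(p * z.im) : ℝ) : ℂ) * Complex.I := by
      conv_lhs => rw [hz']
      push_cast
      ring
    have h2 : (p : ℂ) * z = ((p * z.im : ℝ) : ℂ) * Complex.I + ((p : ℝ) : ℂ) := by
      conv_lhs => rw [hz']
      push_cast
      ring
    simp only [F]
    rw [h1, h2, exp_smul_eq_mul, hB, exp_smul_log hb0, ← hB, ← mul_assoc]
    refine (hΩ.norm_vectorState_mul_le (mul_mem (mul_mem (hexpM _ hAM) hc) (hexpM _ hBM))
      (rpow_mem hb p) CFC.rpow_nonneg).trans ?_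
    refine mul_le_of_le_one_left (vectorState_re_nonneg Ω CFC.rpow_nonneg) ?_
    refine (norm_mul_le _ _).trans (mul_le_one₀ ?_ (norm_nonneg _) (norm_exp_I_smul_le hBs _))
    exact (norm_mul_le _ _).trans (mul_le_one₀ (norm_exp_I_smul_le hAs _) (norm_nonneg _) hc1)
  have hmem : ((1 / p : ℝ) : ℂ) ∈ Complex.HadamardThreeLines.verticalClosedStrip 0 1 := by
    refine ⟨?_, ?_⟩
    · simp only [Complex.ofReal_re]; positivity
    · simp only [Complex.ofReal_re]
      rw [div_le_one hp0]
      exact hp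
  have := Complex.HadamardThreeLines.norm_le_interp_of_mem_verticalClosedStrip' zero_lt_one hmem
    hdiff.diffContOnCl hbdd hleft hright
  rw [hF] at this
  simpa using this

/-- The element `x* x + ε`, positive and invertible for `ε > 0`: a regularization of `x* x` of which
arbitrary real powers can be taken. -/
noncomputable def regSq (x : E →L[ℂ] E) (ε : ℝ) : E →L[ℂ] E :=
  star x * x + algebraMap ℝ (E →L[ℂ] E) ε

theorem regSq_mem {x : E →L[ℂ] E} (hx : x ∈ M) (ε : ℝ) : regSq x ε ∈ M := by
  refine add_mem (mul_mem (star_mem hx) hx) ?_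
  rw [Algebra.algebraMap_eq_smul_one]
  exact (Complex.coe_smul ε (1 : E →L[ℂ] E)) ▸ smul_mem' _ (one_mem _)

theorem regSq_nonneg (x : E →L[ℂ] E) {ε : ℝ} (hε : 0 ≤ ε) : 0 ≤ regSq x ε :=
  add_nonneg (star_mul_self_nonneg x) (algebraMap_nonneg _ hε)

theorem regSq_strictlyPositive (x : E →L[ℂ] E) {ε : ℝ} (hε : 0 < ε) :
    IsStrictlyPositive (regSq x ε) :=
  .nonneg_add (star_mul_self_nonneg x) (isStrictlyPositive_algebraMap hε)

theorem norm_mul_rpow_regSq_le (x : E →L[ℂ] E) {ε : ℝ} (hε : 0 < ε) :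
    ‖x * regSq x ε ^ (-(1 / 2) : ℝ)‖ ≤ 1 := by
  set b := regSq x ε ^ (-(1 / 2) : ℝ) with hb
  have hb0 : 0 ≤ b := CFC.rpow_nonneg
  have h1 : star (x * b) * (x * b) = b * (star x * x) * b := by
    rw [star_mul, (IsSelfAdjoint.of_nonneg hb0).star_eq]
    simp only [mul_assoc]
  have h2 : b * (star x * x) * b ≤ 1 := by
    have h3 : star x * x ≤ regSq x ε :=
      le_add_of_nonneg_right (algebraMap_nonneg _ hε.le)
    refine (conjugate_le_conjugate_of_nonneg h3 hb0).trans_eq ?_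
    exact CFC.conjugate_rpow_neg_one_half _ (regSq_strictlyPositive x hε)
  have h4 : ‖star (x * b) * (x * b)‖ ≤ 1 := by
    rw [CStarAlgebra.norm_le_one_iff_of_nonneg _ (star_mul_self_nonneg _), h1]
    exact h2
  rw [CStarRing.norm_star_mul_self] at h4
  nlinarith [norm_nonneg (x * b)]

theorem norm_rpow_regSq_le (x : E →L[ℂ] E) {ε : ℝ} (hε : 0 < ε) :
    ‖regSq x ε ^ (-(1 / 2) : ℝ)‖ ≤ ε ^ (-(1 / 2) : ℝ) := by
  have h0 := regSq_nonneg x hε.le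
  rw [CFC.rpow_eq_cfc_real h0]
  refine norm_cfc_le (by positivity) fun t ht => ?_
  have h1 : ε ≤ t := (algebraMap_le_iff_le_spectrum (IsSelfAdjoint.of_nonneg h0)).mp
    (le_add_of_nonneg_left (star_mul_self_nonneg x)) t ht
  rw [Real.norm_eq_abs, abs_of_nonneg (Real.rpow_nonneg (by linarith) _)]
  exact Real.rpow_le_rpow_of_nonpos hε h1 (by norm_num)

theorem tendsto_rpow_regSq (x : E →L[ℂ] E) {r : ℝ} (hr : 0 ≤ r) :
    Tendsto (fun ε : ℝ => regSq x ε ^ r) (𝓝[>] 0) (𝓝 ((star x * x) ^ r)) := by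
  have hlim : Tendsto (fun ε : ℝ => regSq x ε) (𝓝[>] 0) (𝓝 (star x * x)) := by
    have h : Continuous fun ε : ℝ => regSq x ε :=
      continuous_const.add (continuous_algebraMap ℝ (E →L[ℂ] E))
    have := (h.tendsto 0).mono_left (nhdsWithin_le_nhds (s := Set.Ioi 0))
    simpa [regSq] using this
  have hsp : ∀ a : E →L[ℂ] E, ‖a‖ ≤ ‖star x * x‖ + 1 →
      spectrum ℝ≥0 a ⊆ Set.Icc 0 (‖star x * x‖₊ + 1) := by
    intro a ha t ht
    refine ⟨zero_le, ?_⟩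
    have h := norm_le_norm_of_mem_spectrum (a := a) (t := t)
      ((spectrum.algebraMap_mem_iff ℝ).mpr ht)
    rw [Real.norm_eq_abs, NNReal.abs_eq] at h
    exact_mod_cast h.trans ha
  refine hlim.cfc_nnreal (isCompact_Icc (a := (0 : ℝ≥0)) (b := ‖star x * x‖₊ + 1))
    (fun t : ℝ≥0 => t ^ r) ?_ ?_ ?_ (star_mul_self_nonneg x)
    (NNReal.continuous_rpow_const hr).continuousOn
  · filter_upwards [hlim.norm.eventually (gt_mem_nhds (lt_add_one _))] with ε hε
    exact hsp _ hε.le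
  · filter_upwards [self_mem_nhdsWithin] with ε (hε : 0 < ε)
    exact regSq_nonneg x hε.le
  · exact hsp _ (by linarith)

/-- Hölder's inequality with the operator `(s* s + ε) ^ (p / 2 - 1) s*`, the dual of `s` up to the
regularization. -/
theorem IsTracialVector.norm_dual_mul_le (hΩ : IsTracialVector M Ω) {s x : E →L[ℂ] E}
    (hs : s ∈ M) (hx : x ∈ M) {p : ℝ} (hp : 1 ≤ p) {ε : ℝ} (hε : 0 < ε) :
    ‖vectorState Ω (regSq s ε ^ (p / 2 - 1) * star s * x)‖ ≤
      (vectorState Ω (regSq s ε ^ (p / 2))).re ^ (1 - 1 / p) *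
        (vectorState Ω (regSq x ε ^ (p / 2))).re ^ (1 / p) := by
  have hs0 := regSq_strictlyPositive s hε
  have hx0 := regSq_strictlyPositive x hε
  have hsM := regSq_mem hs ε
  have hxM := regSq_mem hx ε
  set c := star (s * regSq s ε ^ (-(1 / 2) : ℝ)) * (x * regSq x ε ^ (-(1 / 2) : ℝ)) with hc
  have hc1 : ‖c‖ ≤ 1 := by
    refine (norm_mul_le _ _).trans (mul_le_one₀ ?_ (norm_nonneg _) (norm_mul_rpow_regSq_le x hε))
    rw [norm_star]
    exact norm_mul_rpow_regSq_le s hε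
  have key := hΩ.three_lines (rpow_mem hsM (1 / 2)) (rpow_mem hxM (1 / 2))
    (mul_mem (star_mem (mul_mem hs (rpow_mem hsM _))) (mul_mem hx (rpow_mem hxM _)))
    (hs0.rpow _ (1 / 2)) (hx0.rpow _ (1 / 2)) hc1 hp
  have hsa : star (regSq s ε ^ (-(1 / 2) : ℝ)) = regSq s ε ^ (-(1 / 2) : ℝ) :=
    (IsSelfAdjoint.of_nonneg CFC.rpow_nonneg).star_eq
  have h1 : (regSq s ε ^ (1 / 2 : ℝ)) ^ (p - 1) * c * regSq x ε ^ (1 / 2 : ℝ) =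
      regSq s ε ^ (p / 2 - 1) * star s * x := by
    rw [CFC.rpow_rpow _ _ _ (by norm_num) hs0, hc, star_mul, hsa]
    have h2 : regSq s ε ^ (1 / 2 * (p - 1)) * regSq s ε ^ (-(1 / 2) : ℝ) =
        regSq s ε ^ (p / 2 - 1) := by
      rw [← CFC.rpow_add hs0.isUnit]
      congr 1
      ring
    have h3 : regSq x ε ^ (-(1 / 2) : ℝ) * regSq x ε ^ (1 / 2 : ℝ) = 1 :=
      CFC.rpow_neg_mul_rpow _ hx0
    calc _ = regSq s ε ^ (1 / 2 * (p - 1)) * regSq s ε ^ (-(1 / 2) : ℝ) * star s * x *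
          (regSq x ε ^ (-(1 / 2) : ℝ) * regSq x ε ^ (1 / 2 : ℝ)) := by
            simp only [mul_assoc]
      _ = _ := by rw [h2, h3, mul_one]
  rw [h1, CFC.rpow_rpow _ _ _ (by norm_num) hs0, CFC.rpow_rpow _ _ _ (by norm_num) hx0,
    show (1 / 2 : ℝ) * p = p / 2 by ring] at key
  exact key

/-- The `p`-th power `τ((x* x) ^ (p / 2))` of the noncommutative `L_p`-norm. -/
noncomputable def moment (Ω : E) (p : ℝ) (x : E →L[ℂ] E) : ℝ :=
  (vectorState Ω ((star x * x) ^ (p / 2))).re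

theorem moment_nonneg (Ω : E) (p : ℝ) (x : E →L[ℂ] E) : 0 ≤ moment Ω p x :=
  vectorState_re_nonneg Ω CFC.rpow_nonneg

theorem tendsto_moment (x : E →L[ℂ] E) {r : ℝ} (hr : 0 ≤ r) :
    Tendsto (fun ε : ℝ => (vectorState Ω (regSq x ε ^ r)).re) (𝓝[>] 0)
      (𝓝 (vectorState Ω ((star x * x) ^ r)).re) :=
  (Complex.continuous_re.tendsto _).comp
    (((vectorState Ω).continuous.tendsto _).comp (tendsto_rpow_regSq x hr))

/-- Minkowski's inequality in the noncommutative `L_p`-space of a trace: `x + y` is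
paired with its dual operator. -/
theorem IsTracialVector.moment_add_le (hΩ : IsTracialVector M Ω) {x y : E →L[ℂ] E}
    (hx : x ∈ M) (hy : y ∈ M) {p : ℝ} (hp : 1 ≤ p) :
    moment Ω p (x + y) ^ (1 / p) ≤ moment Ω p x ^ (1 / p) + moment Ω p y ^ (1 / p) := by
  have hp0 : 0 < p := by linarith
  set s := x + y with hs
  have hsM : s ∈ M := add_mem hx hy
  have hbound : ∀ ε : ℝ, 0 < ε → (vectorState Ω (regSq s ε ^ (p / 2))).re ≤
      (vectorState Ω (regSq s ε ^ (p / 2))).re ^ (1 - 1 / p) *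
        ((vectorState Ω (regSq x ε ^ (p / 2))).re ^ (1 / p) +
          (vectorState Ω (regSq y ε ^ (p / 2))).re ^ (1 / p)) +
      ‖vectorState Ω‖ * (‖regSq s ε ^ ((p - 1) / 2)‖ * ε ^ (1 / 2 : ℝ)) := by
    intro ε hε
    have hs0 := regSq_strictlyPositive s hε
    -- As `s* s = (s* s + ε) - ε`, pairing `s` with its dual operator gives the moment up to an
    -- error of order `√ε`.
    have h1 : regSq s ε ^ (p / 2) = regSq s ε ^ (p / 2 - 1) * star s * x +
        regSq s ε ^ (p / 2 - 1) * star s * y +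
          ε • (regSq s ε ^ ((p - 1) / 2) * regSq s ε ^ (-(1 / 2) : ℝ)) := by
      rw [← mul_add, ← hs, ← CFC.rpow_add hs0.isUnit,
        show (p - 1) / 2 + -(1 / 2) = p / 2 - 1 by ring, mul_assoc,
        show star s * s = regSq s ε - ε • (1 : E →L[ℂ] E) by
          rw [regSq, Algebra.algebraMap_eq_smul_one, add_sub_cancel_right], mul_sub,
        mul_smul_comm, mul_one, sub_add_cancel]
      conv_rhs => enter [2]; rw [← CFC.rpow_one (regSq s ε) hs0.nonneg]
      rw [← CFC.rpow_add hs0.isUnit]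
      congr 1
      ring
    have h2 : ‖vectorState Ω (ε • (regSq s ε ^ ((p - 1) / 2) *
        regSq s ε ^ (-(1 / 2) : ℝ)))‖ ≤
        ‖vectorState Ω‖ * (‖regSq s ε ^ ((p - 1) / 2)‖ * ε ^ (1 / 2 : ℝ)) := by
      refine ((vectorState Ω).le_opNorm _).trans ?_
      gcongr
      rw [norm_smul, Real.norm_eq_abs, abs_of_pos hε]
      calc _ ≤ ε * (‖regSq s ε ^ ((p - 1) / 2)‖ * ‖regSq s ε ^ (-(1 / 2) : ℝ)‖) := by
            gcongr
            exact norm_mul_le _ _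
        _ ≤ ε * (‖regSq s ε ^ ((p - 1) / 2)‖ * ε ^ (-(1 / 2) : ℝ)) := by
            gcongr
            exact norm_rpow_regSq_le s hε
        _ = ‖regSq s ε ^ ((p - 1) / 2)‖ * (ε ^ (1 : ℝ) * ε ^ (-(1 / 2) : ℝ)) := by
            rw [Real.rpow_one]
            ring
        _ = _ := by
            rw [← Real.rpow_add hε]
            norm_num
    have h3 := congrArg (fun z => (vectorState Ω z).re) h1
    simp only [map_add, Complex.add_re] at h3
    rw [mul_add]
    have h4 := (Complex.re_le_norm _).trans (hΩ.norm_dual_mul_le hsM hx hp hε)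
    have h5 := (Complex.re_le_norm _).trans (hΩ.norm_dual_mul_le hsM hy hp hε)
    have h6 := (Complex.re_le_norm _).trans h2
    linarith
  have hp1 : 0 ≤ 1 - 1 / p := by
    rw [sub_nonneg, div_le_one hp0]
    exact hp
  have hl := tendsto_moment (Ω := Ω) s (r := p / 2) (by linarith)
  have hr : Tendsto (fun ε : ℝ => (vectorState Ω (regSq s ε ^ (p / 2))).re ^ (1 - 1 / p) *
        ((vectorState Ω (regSq x ε ^ (p / 2))).re ^ (1 / p) +
          (vectorState Ω (regSq y ε ^ (p / 2))).re ^ (1 / p)) +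
      ‖vectorState Ω‖ * (‖regSq s ε ^ ((p - 1) / 2)‖ * ε ^ (1 / 2 : ℝ))) (𝓝[>] 0)
      (𝓝 (moment Ω p s ^ (1 - 1 / p) * (moment Ω p x ^ (1 / p) + moment Ω p y ^ (1 / p)) +
        ‖vectorState Ω‖ * (‖(star s * s) ^ ((p - 1) / 2)‖ * 0))) := by
    have h0 : Tendsto (fun ε : ℝ => ε ^ (1 / 2 : ℝ)) (𝓝[>] 0) (𝓝 0) := by
      have := ((Real.continuous_rpow_const (q := 1 / 2) (by norm_num)).tendsto 0).mono_left
        (nhdsWithin_le_nhds (s := Set.Ioi (0 : ℝ)))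
      rwa [Real.zero_rpow (by norm_num)] at this
    have hpow : ∀ (z : E →L[ℂ] E) {r : ℝ}, 0 ≤ r →
        Tendsto (fun ε : ℝ => (vectorState Ω (regSq z ε ^ (p / 2))).re ^ r) (𝓝[>] 0)
          (𝓝 (moment Ω p z ^ r)) := fun z r hr =>
      (tendsto_moment z (by linarith)).rpow_const (Or.inr hr)
    exact ((hpow s hp1).mul ((hpow x (by positivity)).add (hpow y (by positivity)))).add
      (((tendsto_rpow_regSq s (by linarith)).norm.mul h0).const_mul _)
  have hle := le_of_tendsto_of_tendsto hl hr (by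
    filter_upwards [self_mem_nhdsWithin] with ε hε using hbound ε hε)
  rw [mul_zero, mul_zero, add_zero] at hle
  change moment Ω p s ≤ _ at hle
  -- It remains to divide by the factor `moment Ω p s ^ (1 - 1 / p)`.
  rcases (moment_nonneg Ω p s).eq_or_lt with h | h
  · rw [← h, Real.zero_rpow (by positivity)]
    exact add_nonneg (Real.rpow_nonneg (moment_nonneg _ _ _) _)
      (Real.rpow_nonneg (moment_nonneg _ _ _) _)
  · have h7 : moment Ω p s = moment Ω p s ^ (1 - 1 / p) * moment Ω p s ^ (1 / p) := by
      rw [← Real.rpow_add h]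
      simp
    nth_rewrite 1 [h7] at hle
    exact le_of_mul_le_mul_left hle (Real.rpow_pos_of_pos h _)

theorem moment_smul (c : ℂ) (x : E →L[ℂ] E) {p : ℝ} (hp : 1 ≤ p) :
    moment Ω p (c • x) ^ (1 / p) = ‖c‖ * moment Ω p x ^ (1 / p) := by
  have hp0 : 0 < p := by linarith
  have h1 : star (c • x) * (c • x) = (‖c‖₊ ^ 2) • (star x * x) := by
    rw [star_smul, smul_mul_smul_comm, Complex.star_def, Complex.conj_mul', ← Complex.ofReal_pow]
    rfl
  have h2 : ((‖c‖₊ ^ 2) • (star x * x)) ^ (p / 2) =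
      (‖c‖₊ ^ p) • ((star x * x) ^ (p / 2)) := by
    have hcont : Continuous fun t : ℝ≥0 => t ^ (p / 2) :=
      NNReal.continuous_rpow_const (by positivity)
    have hnn := star_mul_self_nonneg x
    rw [CFC.rpow_def, CFC.rpow_def, ← cfc_comp_smul (‖c‖₊ ^ 2) (fun t : ℝ≥0 => t ^ (p / 2)) _
      hcont.continuousOn, ← cfc_smul _ _ _ hcont.continuousOn]
    refine cfc_congr fun t _ => ?_
    simp only [smul_eq_mul]
    rw [NNReal.mul_rpow, ← NNReal.rpow_natCast, ← NNReal.rpow_mul]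
    congr 2
    push_cast
    ring
  have h3 : moment Ω p (c • x) = ‖c‖ ^ p * moment Ω p x := by
    rw [moment, h1, h2, moment, show (‖c‖₊ ^ p) • ((star x * x) ^ (p / 2)) =
      ((‖c‖ ^ p : ℝ) : ℂ) • ((star x * x) ^ (p / 2)) from rfl, map_smul, smul_eq_mul,
      Complex.re_ofReal_mul]
  rw [h3, Real.mul_rpow (by positivity) (moment_nonneg _ _ _), ← Real.rpow_mul (norm_nonneg _)]
  congr 1
  rw [mul_one_div_cancel hp0.ne', Real.rpow_one]

/-- The noncommutative `L_p`-norms are invariant under conjugation by a unitary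
that fixes the vector of the trace. -/
theorem moment_conj (U : E ≃ₗᵢ[ℂ] E) (hU : U Ω = Ω) (p : ℝ) (hp : 0 ≤ p) (x : E →L[ℂ] E) :
    moment Ω p (U.conjStarAlgEquiv x) = moment Ω p x := by
  have h1 : U.conjStarAlgEquiv ((star x * x) ^ (p / 2)) =
      (star (U.conjStarAlgEquiv x) * U.conjStarAlgEquiv x) ^ (p / 2) := by
    rw [← map_star, ← map_mul]
    have hnn : 0 ≤ star x * x := star_mul_self_nonneg x
    have hc : Continuous U.conjStarAlgEquiv := (StarAlgEquiv.isometry _).continuous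
    exact StarAlgHomClass.map_cfc (S := ℂ) U.conjStarAlgEquiv (fun t : ℝ≥0 => t ^ (p / 2))
      (star x * x) (NNReal.continuous_rpow_const (by linarith)).continuousOn hc hnn (by
        rw [map_mul, map_star]
        exact star_mul_self_nonneg _)
  have hU' : U.symm Ω = Ω := by rw [LinearIsometryEquiv.symm_apply_eq, hU]
  rw [moment, ← h1, moment, vectorState_apply, vectorState_apply,
    LinearIsometryEquiv.conjStarAlgEquiv_apply_apply, hU']
  nth_rewrite 1 [← hU]
  rw [LinearIsometryEquiv.inner_map_map]

end Tracial

open scoped TensorProduct DirectSum InnerProductSpace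

/-! ### Reversal of tensors and right creation on a fixed level -/

section Level

variable {H : Type*} [NormedAddCommGroup H] [InnerProductSpace ℝ H]

theorem tensorAnnihilate_cons_zero' (q : ℝ) (ξ η : H) (u : ⨂[ℝ]^0 H) :
    tensorAnnihilate q 0 ξ (tensorCons 0 η u) = ⟪ξ, η⟫_ℝ • u := by
  suffices h : (tensorAnnihilate q 0 ξ).comp (tensorCons 0 η) = ⟪ξ, η⟫_ℝ • LinearMap.id from
    LinearMap.congr_fun h u
  ext v
  simp only [LinearMap.compMultilinearMap_apply, LinearMap.comp_apply,
    tensorCons_tprod, tensorAnnihilate_tprod]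
  simp

theorem tensorAnnihilate_cons_succ' (q : ℝ) {n : ℕ} (ξ η : H) (u : ⨂[ℝ]^(n + 1) H) :
    tensorAnnihilate q (n + 1) ξ (tensorCons (n + 1) η u) =
      ⟪ξ, η⟫_ℝ • u + q • tensorCons n η (tensorAnnihilate q n ξ u) := by
  suffices h : (tensorAnnihilate q (n + 1) ξ).comp (tensorCons (n + 1) η) =
      ⟪ξ, η⟫_ℝ • LinearMap.id + q • (tensorCons n η).comp (tensorAnnihilate q n ξ) from
    LinearMap.congr_fun h u
  ext v
  simp only [LinearMap.compMultilinearMap_apply, LinearMap.comp_apply, LinearMap.add_apply,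
    LinearMap.smul_apply, LinearMap.id_apply,
    tensorCons_tprod, tensorAnnihilate_tprod, map_sum, map_smul]
  rw [Fin.sum_univ_succ]
  congr 1
  · simp
  · rw [Finset.smul_sum]
    refine Finset.sum_congr rfl fun j _ => ?_
    rw [smul_smul]
    congr 1
    · simp [pow_succ]
      ring
    · congr 1
      ext i
      cases i using Fin.cases <;> simp

theorem inversions_rev_conj {n : ℕ} (σ : Equiv.Perm (Fin n)) :
    inversions (Fin.revPerm * σ * Fin.revPerm) = inversions σ := by
  refine Finset.card_bij (fun p _ => (p.2.rev, p.1.rev)) ?_ ?_ ?_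
  · simp +contextual
  · simp +contextual [Prod.ext_iff]
  · rintro ⟨a, b⟩ h
    refine ⟨(b.rev, a.rev), ?_, by simp⟩
    simpa using h

/-- Reversal of the tensor factors. -/
noncomputable def tensorFlip (n : ℕ) : (⨂[ℝ]^n H) →ₗ[ℝ] (⨂[ℝ]^n H) :=
  (PiTensorProduct.reindex ℝ (fun _ : Fin n => H) Fin.revPerm).toLinearMap

theorem tensorFlip_tprod {n : ℕ} (v : Fin n → H) :
    tensorFlip n (PiTensorProduct.tprod ℝ v) = PiTensorProduct.tprod ℝ (fun i => v i.rev) := by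
  rw [tensorFlip, LinearEquiv.coe_coe, PiTensorProduct.reindex_tprod]
  rfl

theorem tensorFlip_flip {n : ℕ} (u : ⨂[ℝ]^n H) : tensorFlip n (tensorFlip n u) = u := by
  suffices h : (tensorFlip n).comp (tensorFlip n) = (LinearMap.id : (⨂[ℝ]^n H) →ₗ[ℝ] _) from
    LinearMap.congr_fun h u
  ext v
  simp only [LinearMap.compMultilinearMap_apply, LinearMap.comp_apply, tensorFlip_tprod,
    LinearMap.id_apply]
  congr 1
  funext i
  exact congrArg v (Fin.rev_rev i)

theorem levelForm_flip (q : ℝ) {n : ℕ} (u v : ⨂[ℝ]^n H) :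
    levelForm q H n (tensorFlip n u) (tensorFlip n v) = levelForm q H n u v := by
  suffices h : (levelForm q H n).compl₁₂ (tensorFlip n) (tensorFlip n) = levelForm q H n from
    LinearMap.congr_fun (LinearMap.congr_fun h u) v
  ext v w
  simp only [LinearMap.compMultilinearMap_apply, LinearMap.compl₁₂_apply, tensorFlip_tprod,
    levelForm_tprod]
  refine Fintype.sum_equiv (MulAut.conj (Fin.revPerm (n := n))).toEquiv _ _ fun σ => ?_
  have hinv : (Fin.revPerm (n := n))⁻¹ = Fin.revPerm := rfl
  simp only [MulEquiv.toEquiv_eq_coe, MulEquiv.coe_toEquiv, MulAut.conj_apply, hinv,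
    inversions_rev_conj]
  congr 1
  rw [← Equiv.prod_comp Fin.revPerm]
  refine Finset.prod_congr rfl fun i _ => ?_
  congr 2
  exact Fin.rev_rev i

/-- `ξ₁ ⊗ ⋯ ⊗ ξₙ ↦ ξ₁ ⊗ ⋯ ⊗ ξₙ ⊗ η`. -/
noncomputable def tensorSnoc (n : ℕ) (η : H) : (⨂[ℝ]^n H) →ₗ[ℝ] (⨂[ℝ]^(n + 1) H) :=
  (tensorFlip (n + 1)).comp ((tensorCons n η).comp (tensorFlip n))

theorem tensorSnoc_tprod {n : ℕ} (η : H) (v : Fin n → H) :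
    tensorSnoc n η (PiTensorProduct.tprod ℝ v) =
      PiTensorProduct.tprod ℝ (Fin.snoc v η : Fin (n + 1) → H) := by
  simp only [tensorSnoc, LinearMap.comp_apply, tensorFlip_tprod, tensorCons_tprod]
  congr 1
  ext i
  cases i using Fin.lastCases <;> simp [Fin.rev_castSucc]

theorem tensorCons_snoc {n : ℕ} (ξ η : H) (u : ⨂[ℝ]^n H) :
    tensorCons (n + 1) ξ (tensorSnoc n η u) = tensorSnoc (n + 1) η (tensorCons n ξ u) := by
  suffices h : (tensorCons (n + 1) ξ).comp (tensorSnoc n η) =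
      (tensorSnoc (n + 1) η).comp (tensorCons n ξ) from LinearMap.congr_fun h u
  ext v
  simp only [LinearMap.compMultilinearMap_apply, LinearMap.comp_apply, tensorCons_tprod,
    tensorSnoc_tprod, Fin.cons_snoc_eq_snoc_cons]

theorem tensorAnnihilate_snoc_zero (q : ℝ) (ξ η : H) (u : ⨂[ℝ]^0 H) :
    tensorAnnihilate q 0 ξ (tensorSnoc 0 η u) = ⟪ξ, η⟫_ℝ • u := by
  suffices h : (tensorAnnihilate q 0 ξ).comp (tensorSnoc 0 η) = ⟪ξ, η⟫_ℝ • LinearMap.id from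
    LinearMap.congr_fun h u
  ext v
  simp only [LinearMap.compMultilinearMap_apply, LinearMap.comp_apply,
    tensorSnoc_tprod, tensorAnnihilate_tprod]
  simp [Fin.snoc]
  congr 2
  exact Subsingleton.elim _ _

theorem tensorAnnihilate_snoc_succ (q : ℝ) {n : ℕ} (ξ η : H) (u : ⨂[ℝ]^(n + 1) H) :
    tensorAnnihilate q (n + 1) ξ (tensorSnoc (n + 1) η u) =
      tensorSnoc n η (tensorAnnihilate q n ξ u) + (q ^ (n + 1) * ⟪ξ, η⟫_ℝ) • u := by
  suffices h : (tensorAnnihilate q (n + 1) ξ).comp (tensorSnoc (n + 1) η) =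
      (tensorSnoc n η).comp (tensorAnnihilate q n ξ) +
        (q ^ (n + 1) * ⟪ξ, η⟫_ℝ) • LinearMap.id from
    LinearMap.congr_fun h u
  ext v
  simp only [LinearMap.compMultilinearMap_apply, LinearMap.comp_apply, LinearMap.add_apply,
    LinearMap.smul_apply, LinearMap.id_apply,
    tensorSnoc_tprod, tensorAnnihilate_tprod, map_sum, map_smul]
  rw [Fin.sum_univ_castSucc]
  congr 1
  · refine Finset.sum_congr rfl fun j _ => ?_
    congr 1
    · simp
    · congr 1
      ext i
      cases i using Fin.lastCases with
      | last => simp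
      | cast i => simp
  · simp

end Level

/-! ### Operators on the `q`-Fock space -/

section Fock

variable (q : Set.Ioo (-1 : ℝ) 1) {H : Type*} [NormedAddCommGroup H] [InnerProductSpace ℝ H]

/-- The inclusion of the real `n`-th tensor power into the `q`-Fock space. -/
noncomputable def realTensor (n : ℕ) : (⨂[ℝ]^n H) →ₗ[ℝ] Fock q H where
  toFun u := toFock q (toPreFock q ((1 : ℂ) ⊗ₜ[ℝ] DirectSum.lof ℝ ℕ (fun n => ⨂[ℝ]^n H) n u))
  map_add' u v := by rw [map_add, TensorProduct.tmul_add, map_add, map_add]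
  map_smul' r u := by
    rw [map_smul, TensorProduct.tmul_smul, RingHom.id_apply, ← Complex.coe_smul, ← map_smul,
      ← map_smul]
    congr 2

theorem elementaryTensor_eq {n : ℕ} (ξ : Fin n → H) :
    elementaryTensor q ξ = realTensor q n (PiTensorProduct.tprod ℝ ξ) := rfl

theorem inner_realTensor {n : ℕ} (u v : ⨂[ℝ]^n H) :
    inner ℂ (realTensor q n u) (realTensor q n v) = (levelForm q H n u v : ℂ) := by
  change inner ℂ (toFock q _) (toFock q _) = _
  rw [LinearIsometry.inner_map_map, inner_toPreFock, complexForm_tmul, fockForm_lof]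
  simp [DirectSum.lof_eq_of]

theorem inner_realTensor_of_ne {m n : ℕ} (h : m ≠ n) (u : ⨂[ℝ]^m H) (v : ⨂[ℝ]^n H) :
    inner ℂ (realTensor q m u) (realTensor q n v) = 0 := by
  change inner ℂ (toFock q _) (toFock q _) = _
  rw [LinearIsometry.inner_map_map, inner_toPreFock, complexForm_tmul, fockForm_lof,
    DirectSum.lof_eq_of, DirectSum.of_eq_of_ne _ _ _ h]
  simp

theorem dense_span_elementaryTensor :
    (Submodule.span ℂ {v : Fock q H | ∃ (n : ℕ) (ξ : Fin n → H),
      v = elementaryTensor q ξ}).topologicalClosure = ⊤ := by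
  set K := Submodule.span ℂ {v : Fock q H | ∃ (n : ℕ) (ξ : Fin n → H), v = elementaryTensor q ξ}
    with hK
  have h1 : ∀ (n : ℕ) (u : ⨂[ℝ]^n H), realTensor q n u ∈ K := by
    intro n u
    induction u using PiTensorProduct.induction_on with
    | smul_tprod r v =>
      rw [map_smul, ← Complex.coe_smul]
      exact K.smul_mem _ (Submodule.subset_span ⟨n, v, rfl⟩)
    | add x y hx hy =>
      rw [map_add]
      exact K.add_mem hx hy
  have h2 : ∀ z : ℂ ⊗[ℝ] RealFock H, toFock q (toPreFock q z) ∈ K := by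
    intro z
    induction z using TensorProduct.induction_on with
    | zero => simp
    | add x y hx hy => rw [map_add, map_add]; exact K.add_mem hx hy
    | tmul a u =>
      have h3 : a ⊗ₜ[ℝ] u = a • ((1 : ℂ) ⊗ₜ[ℝ] u) := by
        rw [TensorProduct.smul_tmul', smul_eq_mul, mul_one]
      rw [h3, map_smul, map_smul]
      refine K.smul_mem _ ?_
      clear h3
      induction u using DirectSum.induction_on with
      | zero => simp
      | add x y hx hy =>
        rw [TensorProduct.tmul_add, map_add, map_add]
        exact K.add_mem hx hy
      | of n u => exact h1 n u
  rw [← Submodule.dense_iff_topologicalClosure_eq_top]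
  refine (denseRange_toFock q).mono ?_
  rintro _ ⟨z, rfl⟩
  obtain ⟨z, rfl⟩ := (toPreFock q).surjective z
  exact h2 z

theorem clm_ext {F : Type*} [TopologicalSpace F] [T2Space F] [AddCommMonoid F] [Module ℂ F]
    {A B : Fock q H →L[ℂ] F} (h : ∀ (n : ℕ) (ξ : Fin n → H),
      A (elementaryTensor q ξ) = B (elementaryTensor q ξ)) : A = B := by
  refine ContinuousLinearMap.ext_on
    (s := {v : Fock q H | ∃ (n : ℕ) (ξ : Fin n → H), v = elementaryTensor q ξ}) ?_ ?_
  · rw [Submodule.dense_iff_topologicalClosure_eq_top]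
    exact dense_span_elementaryTensor q
  · rintro _ ⟨n, ξ, rfl⟩
    exact h n ξ

theorem eq_of_inner_elementaryTensor {x y : Fock q H} (h : ∀ (n : ℕ) (ξ : Fin n → H),
    inner ℂ x (elementaryTensor q ξ) = inner ℂ y (elementaryTensor q ξ)) : x = y := by
  have : innerSL ℂ x = innerSL ℂ y := clm_ext q h
  exact (innerSL_inj (𝕜 := ℂ)).mp this

theorem creation_realTensor (ξ : H) {n : ℕ} (u : ⨂[ℝ]^n H) :
    creation q ξ (realTensor q n u) = realTensor q (n + 1) (tensorCons n ξ u) := by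
  induction u using PiTensorProduct.induction_on with
  | smul_tprod r v =>
    simp only [map_smul]
    rw [← Complex.coe_smul, map_smul, ← Complex.coe_smul, ← elementaryTensor_eq,
      creation_elementaryTensor, tensorCons_tprod, elementaryTensor_eq]
  | add x y hx hy => simp only [map_add, hx, hy]

theorem annihilation_realTensor_succ (ξ : H) {n : ℕ} (u : ⨂[ℝ]^(n + 1) H) :
    (creation q ξ).adjoint (realTensor q (n + 1) u) =
      realTensor q n (tensorAnnihilate q n ξ u) := by
  refine eq_of_inner_elementaryTensor q fun m η => ?_
  rw [ContinuousLinearMap.adjoint_inner_left, elementaryTensor_eq, creation_realTensor]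
  by_cases h : m = n
  · subst h
    rw [inner_realTensor, inner_realTensor, levelForm_symm, levelForm_cons, levelForm_symm]
  · rw [inner_realTensor_of_ne _ (by omega), inner_realTensor_of_ne _ (by omega)]

theorem annihilation_realTensor_zero (ξ : H) (u : ⨂[ℝ]^0 H) :
    (creation q ξ).adjoint (realTensor q 0 u) = 0 := by
  refine eq_of_inner_elementaryTensor q fun m η => ?_
  rw [ContinuousLinearMap.adjoint_inner_left, elementaryTensor_eq, creation_realTensor,
    inner_realTensor_of_ne _ (by omega), inner_zero_left]

/-- The `q`-commutation relation. -/
theorem annihilation_mul_creation (ξ η : H) :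
    (creation q ξ).adjoint * creation q η =
      (⟪ξ, η⟫_ℝ : ℂ) • 1 + (q : ℂ) • (creation q η * (creation q ξ).adjoint) := by
  refine clm_ext q fun n v => ?_
  rw [elementaryTensor_eq]
  generalize PiTensorProduct.tprod ℝ v = u
  change (creation q ξ).adjoint (creation q η _) = (⟪ξ, η⟫_ℝ : ℂ) • (realTensor q n u) +
    (q : ℂ) • (creation q η ((creation q ξ).adjoint _))
  rw [creation_realTensor, annihilation_realTensor_succ]
  cases n with
  | zero =>
    rw [annihilation_realTensor_zero, tensorAnnihilate_cons_zero', map_zero, smul_zero, add_zero,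
      map_smul, Complex.coe_smul]
  | succ n =>
    rw [annihilation_realTensor_succ, creation_realTensor, tensorAnnihilate_cons_succ', map_add,
      map_smul, map_smul, Complex.coe_smul, Complex.coe_smul]

section LevelMap

theorem fockForm_lmap_le {T : ∀ n : ℕ, (⨂[ℝ]^n H) →ₗ[ℝ] (⨂[ℝ]^n H)}
    (hT : ∀ (n : ℕ) (u : ⨂[ℝ]^n H), levelForm q H n (T n u) (T n u) ≤ levelForm q H n u u)
    (u : RealFock H) :
    fockForm q H (DirectSum.lmap T u) (DirectSum.lmap T u) ≤ 1 * fockForm q H u u := by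
  classical
  have h : fockForm q H (DirectSum.lmap T u) (DirectSum.lmap T u) =
      ∑ n ∈ DFinsupp.support u, levelForm q H n (T n (u n)) (T n (u n)) := by
    conv_lhs => enter [1, 2]; rw [eq_sum_lof u]
    simp only [map_sum, LinearMap.sum_apply, DirectSum.lmap_lof, fockForm_lof,
      DirectSum.lmap_apply]
  rw [h, one_mul, fockForm_eq_sum]
  exact Finset.sum_le_sum fun n _ => hT n (u n)

/-- The operator on the `q`-Fock space that acts by a contraction `T n` on the `n`-th real tensor
power. -/
noncomputable def levelMap (T : ∀ n : ℕ, (⨂[ℝ]^n H) →ₗ[ℝ] (⨂[ℝ]^n H))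
    (hT : ∀ (n : ℕ) (u : ⨂[ℝ]^n H), levelForm q H n (T n u) (T n u) ≤ levelForm q H n u u) :
    Fock q H →L[ℂ] Fock q H :=
  fockMap q (preFockMap q (DirectSum.lmap T) 1 zero_le_one (fockForm_lmap_le q hT))

theorem levelMap_realTensor {T : ∀ n : ℕ, (⨂[ℝ]^n H) →ₗ[ℝ] (⨂[ℝ]^n H)}
    (hT : ∀ (n : ℕ) (u : ⨂[ℝ]^n H), levelForm q H n (T n u) (T n u) ≤ levelForm q H n u u)
    {n : ℕ} (u : ⨂[ℝ]^n H) :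
    levelMap q T hT (realTensor q n u) = realTensor q n (T n u) := by
  change fockMap q _ (toFock q (toPreFock q _)) = _
  rw [fockMap_toFock, preFockMap, LinearMap.mkContinuous_apply, LinearEquiv.conj_apply_apply,
    LinearEquiv.symm_apply_apply, LinearMap.baseChange_tmul, DirectSum.lmap_lof]
  rfl

/-- The operators given by level maps `S` and `T` that are adjoint for `⟨·,·⟩_q` are adjoint. -/
theorem levelMap_adjoint {S T : ∀ n : ℕ, (⨂[ℝ]^n H) →ₗ[ℝ] (⨂[ℝ]^n H)}
    (hS : ∀ (n : ℕ) (u : ⨂[ℝ]^n H), levelForm q H n (S n u) (S n u) ≤ levelForm q H n u u)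
    (hT : ∀ (n : ℕ) (u : ⨂[ℝ]^n H), levelForm q H n (T n u) (T n u) ≤ levelForm q H n u u)
    (hST : ∀ (n : ℕ) (u v : ⨂[ℝ]^n H),
      levelForm q H n (S n u) v = levelForm q H n u (T n v)) :
    (levelMap q T hT).adjoint = levelMap q S hS := by
  refine clm_ext q fun n v => eq_of_inner_elementaryTensor q fun m w => ?_
  rw [ContinuousLinearMap.adjoint_inner_left, elementaryTensor_eq, elementaryTensor_eq,
    levelMap_realTensor, levelMap_realTensor]
  by_cases h : n = m
  · subst h
    rw [inner_realTensor, inner_realTensor, hST]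
  · rw [inner_realTensor_of_ne _ h, inner_realTensor_of_ne _ h]

end LevelMap

/-! ### Right field operators -/

section RightField

/-- The self-adjoint unitary that reverses the order of the tensor factors. -/
noncomputable def flip : Fock q H →L[ℂ] Fock q H :=
  levelMap q tensorFlip fun _ u => (levelForm_flip _ u u).le

theorem flip_realTensor {n : ℕ} (u : ⨂[ℝ]^n H) :
    flip q (realTensor q n u) = realTensor q n (tensorFlip n u) := levelMap_realTensor q _ u

theorem flip_adjoint : (flip q : Fock q H →L[ℂ] Fock q H).adjoint = flip q :=
  levelMap_adjoint q _ _ fun n u v => by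
    rw [← levelForm_flip (q : ℝ) u (tensorFlip n v), tensorFlip_flip]

/-- Second quantization of `q • id`: multiplication by `q ^ n` on the `n`-th tensor power. -/
noncomputable def qDilation : Fock q H →L[ℂ] Fock q H :=
  levelMap q (fun n => (q : ℝ) ^ n • LinearMap.id) fun n u => by
    simp only [LinearMap.smul_apply, LinearMap.id_apply, map_smul, smul_eq_mul]
    rw [← mul_assoc, ← pow_add, ← two_mul, pow_mul, ← sq_abs, ← pow_mul]
    exact mul_le_of_le_one_left (levelForm_nonneg _ (abs_lt_one q).le _)
      (pow_le_one₀ (abs_nonneg _) (abs_lt_one q).le)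

theorem qDilation_realTensor {n : ℕ} (u : ⨂[ℝ]^n H) :
    qDilation q (realTensor q n u) = realTensor q n ((q : ℝ) ^ n • u) := levelMap_realTensor q _ u

theorem qDilation_adjoint : (qDilation q : Fock q H →L[ℂ] Fock q H).adjoint = qDilation q :=
  levelMap_adjoint q _ _ fun n u v => by simp

/-- The right creation operator `ξ₁ ⊗ ⋯ ⊗ ξₙ ↦ ξ₁ ⊗ ⋯ ⊗ ξₙ ⊗ η`. -/
noncomputable def rightCreation (η : H) : Fock q H →L[ℂ] Fock q H :=
  flip q * creation q η * flip q

theorem rightCreation_realTensor (η : H) {n : ℕ} (u : ⨂[ℝ]^n H) :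
    rightCreation q η (realTensor q n u) = realTensor q (n + 1) (tensorSnoc n η u) := by
  change flip q (creation q η (flip q _)) = _
  rw [flip_realTensor, creation_realTensor, flip_realTensor]
  rfl

theorem creation_mul_rightCreation (ξ η : H) :
    creation q ξ * rightCreation q η = rightCreation q η * creation q ξ := by
  refine clm_ext q fun n v => ?_
  change creation q ξ (rightCreation q η _) = rightCreation q η (creation q ξ _)
  rw [elementaryTensor_eq, rightCreation_realTensor, creation_realTensor, creation_realTensor,
    rightCreation_realTensor, tensorCons_snoc]

theorem annihilation_mul_rightCreation (ξ η : H) :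
    (creation q ξ).adjoint * rightCreation q η =
      rightCreation q η * (creation q ξ).adjoint + (⟪ξ, η⟫_ℝ : ℂ) • qDilation q := by
  refine clm_ext q fun n v => ?_
  rw [elementaryTensor_eq]
  generalize PiTensorProduct.tprod ℝ v = u
  change (creation q ξ).adjoint (rightCreation q η _) =
    rightCreation q η ((creation q ξ).adjoint _) + (⟪ξ, η⟫_ℝ : ℂ) • (qDilation q (realTensor q n u))
  rw [rightCreation_realTensor, annihilation_realTensor_succ, qDilation_realTensor]
  cases n with
  | zero =>
    rw [annihilation_realTensor_zero, tensorAnnihilate_snoc_zero, map_zero, zero_add,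
      Complex.coe_smul, ← map_smul, pow_zero, one_smul]
  | succ n =>
    rw [annihilation_realTensor_succ, rightCreation_realTensor, tensorAnnihilate_snoc_succ,
      map_add, Complex.coe_smul, ← map_smul, smul_smul, mul_comm]

/-- The right field operator, built from right creation as `X_q(η)` is from left creation. -/
noncomputable def rightFieldOp (η : H) : Fock q H →L[ℂ] Fock q H :=
  rightCreation q η + (rightCreation q η).adjoint

/-- The contributions of `q`-dilations to the commutators of left creation with right annihilation
and of left annihilation with right creation cancel. -/
theorem commute_fieldOp_rightFieldOp (ξ η : H) :
    Commute (fieldOp q ξ) (rightFieldOp q η) := by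
  have h1 := creation_mul_rightCreation q ξ η
  have h2 := annihilation_mul_rightCreation q ξ η
  have h3 := congrArg star h1
  have h4 := congrArg star h2
  have hQ : star (qDilation q : Fock q H →L[ℂ] Fock q H) = qDilation q := qDilation_adjoint q
  simp only [← ContinuousLinearMap.star_eq_adjoint] at h2 h4
  simp only [star_mul, star_add, star_smul, star_star, hQ] at h3 h4
  rw [Complex.star_def, Complex.conj_ofReal] at h4
  change (creation q ξ + star (creation q ξ)) * (rightCreation q η + star (rightCreation q η)) =
    (rightCreation q η + star (rightCreation q η)) * (creation q ξ + star (creation q ξ))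
  rw [add_mul, mul_add, mul_add, add_mul, mul_add, mul_add, h1, h2, h4, h3]
  abel

end RightField

end Fock


/-! ### The vacuum state is a faithful trace -/

section Trace

variable (q : Set.Ioo (-1 : ℝ) 1) {H : Type*} [NormedAddCommGroup H] [InnerProductSpace ℝ H]

theorem star_fieldOp (ξ : H) : star (fieldOp q ξ) = fieldOp q ξ := by
  rw [fieldOp, ← ContinuousLinearMap.star_eq_adjoint, star_add, star_star, add_comm]

theorem star_rightFieldOp (ξ : H) : star (rightFieldOp q ξ) = rightFieldOp q ξ := by
  rw [rightFieldOp, ← ContinuousLinearMap.star_eq_adjoint, star_add, star_star, add_comm]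

theorem fieldOp_mem (ξ : H) : fieldOp q ξ ∈ qGaussianAlgebra q H := by
  change fieldOp q ξ ∈ StarSubalgebra.centralizer ℂ _
  rw [StarSubalgebra.mem_centralizer_iff]
  intro z hz
  have h := (StarSubalgebra.mem_centralizer_iff ℂ).mp hz (fieldOp q ξ) ⟨ξ, rfl⟩
  have h' := (StarSubalgebra.mem_centralizer_iff ℂ).mp (star_mem hz) (fieldOp q ξ) ⟨ξ, rfl⟩
  exact ⟨h.1.symm, h'.1.symm⟩

theorem rightFieldOp_mem (ξ : H) : rightFieldOp q ξ ∈ (qGaussianAlgebra q H).commutant := by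
  rw [VonNeumannAlgebra.mem_commutant_iff]
  intro g hg
  refine ((StarSubalgebra.mem_centralizer_iff ℂ).mp hg (rightFieldOp q ξ) ?_).1.symm
  change rightFieldOp q ξ ∈ StarSubalgebra.centralizer ℂ _
  rw [StarSubalgebra.mem_centralizer_iff]
  rintro _ ⟨η, rfl⟩
  rw [star_fieldOp]
  exact ⟨commute_fieldOp_rightFieldOp q η ξ, commute_fieldOp_rightFieldOp q η ξ⟩

theorem vacuum_eq : vacuum q H = realTensor q 0 (PiTensorProduct.tprod ℝ Fin.elim0) := rfl

theorem annihilation_vacuum (ξ : H) : (creation q ξ).adjoint (vacuum q H) = 0 :=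
  annihilation_realTensor_zero q ξ _

theorem flip_vacuum : flip q (vacuum q H) = vacuum q H := by
  rw [vacuum_eq, flip_realTensor, tensorFlip_tprod]
  congr 2

theorem rightFieldOp_vacuum (ξ : H) :
    rightFieldOp q ξ (vacuum q H) = fieldOp q ξ (vacuum q H) := by
  have h1 : (rightCreation q ξ).adjoint (vacuum q H) = 0 := by
    have h : (rightCreation q ξ).adjoint = flip q * (creation q ξ).adjoint * flip q := by
      simp only [rightCreation, ← ContinuousLinearMap.star_eq_adjoint, star_mul]
      rw [ContinuousLinearMap.star_eq_adjoint (flip q), flip_adjoint, mul_assoc]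
    rw [h]
    change flip q ((creation q ξ).adjoint (flip q _)) = 0
    rw [flip_vacuum, annihilation_vacuum, map_zero]
  have h2 : rightCreation q ξ (vacuum q H) = creation q ξ (vacuum q H) := by
    rw [vacuum_eq, rightCreation_realTensor, creation_realTensor, tensorSnoc_tprod,
      tensorCons_tprod]
    congr 2
    funext i
    fin_cases i
    rfl
  rw [rightFieldOp, fieldOp, add_apply, add_apply, h1, h2, annihilation_vacuum]

variable (H) in
/-- The polynomials in the field operators. -/
noncomputable def fieldPolynomials : Subalgebra ℂ (Fock q H →L[ℂ] Fock q H) :=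
  Algebra.adjoin ℂ (Set.range (fieldOp q))

/-- The vacuum vector is cyclic: by induction on the degree, every elementary tensor is obtained by
applying a polynomial in the field operators to it. -/
theorem elementaryTensor_mem_orbit (n : ℕ) (ξ : Fin n → H) :
    ∃ w ∈ fieldPolynomials q H, w (vacuum q H) = elementaryTensor q ξ := by
  have hreal : ∀ m : ℕ, (∀ ξ : Fin m → H, ∃ w ∈ fieldPolynomials q H,
      w (vacuum q H) = elementaryTensor q ξ) → ∀ u : ⨂[ℝ]^m H, ∃ w ∈ fieldPolynomials q H,
      w (vacuum q H) = realTensor q m u := by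
    intro m hm u
    induction u using PiTensorProduct.induction_on with
    | smul_tprod r v =>
      obtain ⟨w, hw, h⟩ := hm v
      refine ⟨(r : ℂ) • w, Subalgebra.smul_mem _ hw _, ?_⟩
      rw [map_smul, ← Complex.coe_smul, ← elementaryTensor_eq, ← h]
      rfl
    | add x y hx hy =>
      obtain ⟨w, hw, h⟩ := hx
      obtain ⟨w', hw', h'⟩ := hy
      exact ⟨w + w', add_mem hw hw', by rw [map_add, ← h, ← h']; rfl⟩
  induction n using Nat.strong_induction_on with
  | _ n ih =>
    cases n with
    | zero =>
      refine ⟨1, one_mem _, ?_⟩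
      rw [Subsingleton.elim ξ Fin.elim0]
      rfl
    | succ n =>
      obtain ⟨w, hw, h⟩ := ih n (by omega) (Fin.tail ξ)
      have hX : fieldOp q (ξ 0) ∈ fieldPolynomials q H := Algebra.subset_adjoin ⟨_, rfl⟩
      have h1 : creation q (ξ 0) (elementaryTensor q (Fin.tail ξ)) = elementaryTensor q ξ := by
        rw [creation_elementaryTensor, Fin.cons_self_tail]
      -- The field operator produces the wanted tensor and a correction of lower degree.
      have h2 : ∃ w' ∈ fieldPolynomials q H, w' (vacuum q H) =
          (creation q (ξ 0)).adjoint (elementaryTensor q (Fin.tail ξ)) := by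
        cases n with
        | zero =>
          exact ⟨0, zero_mem _, by rw [elementaryTensor_eq, annihilation_realTensor_zero]; rfl⟩
        | succ n =>
          rw [elementaryTensor_eq, annihilation_realTensor_succ]
          exact hreal n (ih n (by omega)) _
      obtain ⟨w', hw', h'⟩ := h2
      refine ⟨fieldOp q (ξ 0) * w - w', sub_mem (mul_mem hX hw) hw', ?_⟩
      rw [sub_apply, mul_apply_eq_comp, h, h', fieldOp, add_apply, h1, add_sub_cancel_right]

/-- Every polynomial in the field operators has a mirror image in the commutant that acts on the
vacuum in the same way. -/
theorem exists_mirror {w : Fock q H →L[ℂ] Fock q H} (hw : w ∈ fieldPolynomials q H) :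
    w ∈ qGaussianAlgebra q H ∧ ∃ w' ∈ (qGaussianAlgebra q H).commutant,
      w' (vacuum q H) = w (vacuum q H) ∧ star w' (vacuum q H) = star w (vacuum q H) := by
  induction hw using Algebra.adjoin_induction with
  | mem x hx =>
    obtain ⟨ξ, rfl⟩ := hx
    refine ⟨fieldOp_mem q ξ, rightFieldOp q ξ, rightFieldOp_mem q ξ, rightFieldOp_vacuum q ξ, ?_⟩
    rw [star_fieldOp, star_rightFieldOp, rightFieldOp_vacuum]
  | algebraMap r =>
    rw [Algebra.algebraMap_eq_smul_one]
    exact ⟨smul_mem' r (one_mem _), _, smul_mem' r (one_mem _), rfl, rfl⟩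
  | add x y _ _ hx hy =>
    obtain ⟨hx, x', hx', h1, h2⟩ := hx
    obtain ⟨hy, y', hy', h3, h4⟩ := hy
    refine ⟨add_mem hx hy, x' + y', add_mem hx' hy', ?_, ?_⟩
    · rw [add_apply, add_apply, h1, h3]
    · rw [star_add, star_add, add_apply, add_apply, h2, h4]
  | mul x y _ _ hx hy =>
    obtain ⟨hx, x', hx', h1, h2⟩ := hx
    obtain ⟨hy, y', hy', h3, h4⟩ := hy
    refine ⟨mul_mem hx hy, y' * x', mul_mem hy' hx', ?_, ?_⟩
    · have hc := congrArg (fun T => T (vacuum q H)) (commute_of_mem hx hy').eq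
      simp only [mul_apply_eq_comp] at hc
      rw [mul_apply_eq_comp, h1, ← hc, h3, mul_apply_eq_comp]
    · have hc := congrArg (fun T => T (vacuum q H))
        (commute_of_mem (star_mem hy) (star_mem hx')).eq
      simp only [mul_apply_eq_comp] at hc
      rw [star_mul, star_mul, mul_apply_eq_comp, mul_apply_eq_comp, h4, ← hc, h2]

theorem dense_orbit : Dense {v : Fock q H | ∃ w ∈ fieldPolynomials q H, w (vacuum q H) = v} := by
  have h : Dense ((Submodule.span ℂ {v : Fock q H | ∃ (n : ℕ) (ξ : Fin n → H),
      v = elementaryTensor q ξ} : Submodule ℂ (Fock q H)) : Set (Fock q H)) := by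
    rw [Submodule.dense_iff_topologicalClosure_eq_top]
    exact dense_span_elementaryTensor q
  refine h.mono fun v hv => ?_
  induction hv using Submodule.span_induction with
  | mem x hx =>
    obtain ⟨n, ξ, rfl⟩ := hx
    exact elementaryTensor_mem_orbit q n ξ
  | zero => exact ⟨0, zero_mem _, rfl⟩
  | add x y _ _ hx hy =>
    obtain ⟨w, hw, rfl⟩ := hx
    obtain ⟨w', hw', rfl⟩ := hy
    exact ⟨w + w', add_mem hw hw', rfl⟩
  | smul a x _ hx =>
    obtain ⟨w, hw, rfl⟩ := hx
    exact ⟨a • w, Subalgebra.smul_mem _ hw _, rfl⟩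

/-- The vacuum vector is separating for the `q`-Gaussian algebra. -/
theorem eq_zero_of_apply_vacuum {x : Fock q H →L[ℂ] Fock q H} (hx : x ∈ qGaussianAlgebra q H)
    (h : x (vacuum q H) = 0) : x = 0 := by
  refine ContinuousLinearMap.ext_on (s := {v : Fock q H | ∃ w ∈ fieldPolynomials q H,
    w (vacuum q H) = v}) ((dense_orbit q).mono Submodule.subset_span) ?_
  rintro _ ⟨w, hw, rfl⟩
  obtain ⟨-, w', hw', h1, -⟩ := exists_mirror q hw
  have hc := congrArg (fun T => T (vacuum q H)) (commute_of_mem hx hw').eq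
  simp only [mul_apply_eq_comp] at hc
  rw [← h1, hc, h, map_zero, zero_apply]

theorem eq_of_apply_vacuum {x y : Fock q H →L[ℂ] Fock q H} (hx : x ∈ qGaussianAlgebra q H)
    (hy : y ∈ qGaussianAlgebra q H) (h : x (vacuum q H) = y (vacuum q H)) : x = y :=
  sub_eq_zero.mp (eq_zero_of_apply_vacuum q (sub_mem hx hy) (by rw [sub_apply, h, sub_self]))

theorem inner_star_apply {E : Type*} [NormedAddCommGroup E] [InnerProductSpace ℂ E]
    [CompleteSpace E] (x : E →L[ℂ] E) (u v : E) :
    inner ℂ (star x u) v = inner ℂ u (x v) := by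
  rw [ContinuousLinearMap.star_eq_adjoint, ContinuousLinearMap.adjoint_inner_left]

theorem vectorState_mul {E : Type*} [NormedAddCommGroup E] [InnerProductSpace ℂ E]
    [CompleteSpace E] (Ω : E) (x y : E →L[ℂ] E) :
    vectorState Ω (x * y) = inner ℂ (star x Ω) (y Ω) := by
  rw [inner_star_apply, vectorState_apply, mul_apply_eq_comp]

/-- The trace property when one of the factors is a polynomial `w` in the field operators: its
mirror image moves `w` from one side of `x` to the other. -/
theorem vectorState_mul_comm_of_polynomial {x w : Fock q H →L[ℂ] Fock q H}
    (hx : x ∈ qGaussianAlgebra q H) (hw : w ∈ fieldPolynomials q H) :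
    vectorState (vacuum q H) (x * w) = vectorState (vacuum q H) (w * x) := by
  obtain ⟨-, w', hw', h1, h2⟩ := exists_mirror q hw
  have hc := congrArg (fun T => T (vacuum q H)) (commute_of_mem hx hw').eq
  simp only [mul_apply_eq_comp] at hc
  rw [vectorState_mul _ w, ← h2, inner_star_apply, ← hc, h1, vectorState_apply,
    mul_apply_eq_comp]

/-- The bound `‖z* Ω‖ ≤ ‖z Ω‖`, by testing `z* Ω` against the dense set of vectors `w Ω` with `w` a
polynomial in the field operators. -/
theorem norm_star_apply_vacuum_le {z : Fock q H →L[ℂ] Fock q H}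
    (hz : z ∈ qGaussianAlgebra q H) : ‖star z (vacuum q H)‖ ≤ ‖z (vacuum q H)‖ := by
  have hself : ∀ w ∈ fieldPolynomials q H, ‖star w (vacuum q H)‖ = ‖w (vacuum q H)‖ := by
    intro w hw
    have hwM := (exists_mirror q hw).1
    have h := vectorState_mul_comm_of_polynomial q (star_mem hwM) hw
    have h1 : ∀ y : Fock q H →L[ℂ] Fock q H,
        vectorState (vacuum q H) (star y * y) = (‖y (vacuum q H)‖ ^ 2 : ℝ) := by
      intro y
      rw [vectorState_mul, star_star, inner_self_eq_norm_sq_to_K]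
      norm_cast
    have h2 := h1 (star w)
    rw [star_star, ← h, h1] at h2
    have h3 : ‖w (vacuum q H)‖ ^ 2 = ‖star w (vacuum q H)‖ ^ 2 := by exact_mod_cast h2
    exact ((sq_eq_sq₀ (norm_nonneg _) (norm_nonneg _)).mp h3).symm
  have hbound : ∀ v : Fock q H,
      ‖(inner ℂ (star z (vacuum q H)) v : ℂ)‖ ≤ ‖z (vacuum q H)‖ * ‖v‖ := by
    intro v
    refine (dense_orbit q).induction (P := fun v =>
      ‖(inner ℂ (star z (vacuum q H)) v : ℂ)‖ ≤ ‖z (vacuum q H)‖ * ‖v‖) ?_ ?_ v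
    · rintro _ ⟨w, hw, rfl⟩
      have h := vectorState_mul_comm_of_polynomial q hz hw
      rw [vectorState_mul, vectorState_mul] at h
      rw [h, mul_comm, ← hself w hw]
      exact norm_inner_le_norm _ _
    · exact isClosed_le (by fun_prop) (by fun_prop)
  have h := hbound (star z (vacuum q H))
  rw [inner_self_eq_norm_sq_to_K] at h
  simp only [norm_pow, Complex.coe_algebraMap, Complex.norm_real, norm_norm] at h
  by_contra hlt
  push Not at hlt
  have : 0 < ‖star z (vacuum q H)‖ := (norm_nonneg _).trans_lt hlt
  nlinarith

/-- The vacuum state is a trace on the `q`-Gaussian algebra: both sides are continuous in `y` for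
the norm `‖y Ω‖ = ‖y* Ω‖`, and agree if `y` is a polynomial in the field operators. -/
theorem isTracialVector_vacuum : IsTracialVector (qGaussianAlgebra q H) (vacuum q H) := by
  intro x hx y hy
  rw [← sub_eq_zero, ← norm_le_zero_iff]
  set C := ‖star x (vacuum q H)‖ + ‖x (vacuum q H)‖ with hC
  have hC0 : 0 ≤ C := by positivity
  have key : ∀ δ : ℝ, 0 < δ →
      ‖vectorState (vacuum q H) (x * y) - vectorState (vacuum q H) (y * x)‖ ≤ C * δ := by
    intro δ hδ
    obtain ⟨_, ⟨w, hw, rfl⟩, hdist⟩ := (dense_orbit q).exists_dist_lt (y (vacuum q H)) hδ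
    have hzM : y - w ∈ qGaussianAlgebra q H := sub_mem hy (exists_mirror q hw).1
    have hz : ‖(y - w) (vacuum q H)‖ ≤ δ := by
      rw [sub_apply, ← dist_eq_norm]
      exact hdist.le
    have hz' := (norm_star_apply_vacuum_le q hzM).trans hz
    have h1 : vectorState (vacuum q H) (x * y) - vectorState (vacuum q H) (y * x) =
        vectorState (vacuum q H) (x * (y - w)) - vectorState (vacuum q H) ((y - w) * x) := by
      rw [mul_sub, sub_mul, map_sub, map_sub, vectorState_mul_comm_of_polynomial q hx hw]
      ring
    rw [h1, vectorState_mul, vectorState_mul]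
    refine (norm_sub_le _ _).trans ?_
    rw [hC, add_mul]
    refine add_le_add ?_ ?_
    · refine (norm_inner_le_norm _ _).trans ?_
      gcongr
    · refine (norm_inner_le_norm _ _).trans ?_
      rw [mul_comm]
      gcongr
  refine le_of_forall_pos_le_add fun ε hε => ?_
  refine (key (ε / (C + 1)) (by positivity)).trans ?_
  rw [zero_add, mul_div_assoc', div_le_iff₀ (by positivity)]
  nlinarith

end Trace


/-! ### Second quantization of orthogonal maps -/

section Conjugation

variable {E : Type*} [NormedAddCommGroup E] [InnerProductSpace ℂ E] [CompleteSpace E]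
  (U : E ≃ₗᵢ[ℂ] E)

theorem conj_add (x y : E →L[ℂ] E) :
    U.conjStarAlgEquiv (x + y) = U.conjStarAlgEquiv x + U.conjStarAlgEquiv y := map_add _ _ _

theorem conj_zero : U.conjStarAlgEquiv 0 = 0 := map_zero _

theorem conj_smul (c : ℂ) (x : E →L[ℂ] E) :
    U.conjStarAlgEquiv (c • x) = c • U.conjStarAlgEquiv x := map_smul _ _ _

theorem conj_mul (x y : E →L[ℂ] E) :
    U.conjStarAlgEquiv (x * y) = U.conjStarAlgEquiv x * U.conjStarAlgEquiv y := map_mul _ _ _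

theorem conj_one : U.conjStarAlgEquiv 1 = 1 := map_one _

theorem conj_star (x : E →L[ℂ] E) :
    U.conjStarAlgEquiv (star x) = star (U.conjStarAlgEquiv x) := map_star _ _

theorem conj_sum {ι : Type*} (I : Finset ι) (f : ι → E →L[ℂ] E) :
    U.conjStarAlgEquiv (∑ i ∈ I, f i) = ∑ i ∈ I, U.conjStarAlgEquiv (f i) := map_sum _ _ _

theorem norm_conj (x : E →L[ℂ] E) : ‖U.conjStarAlgEquiv x‖ = ‖x‖ := by
  have h := (StarAlgEquiv.isometry U.conjStarAlgEquiv).dist_eq x 0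
  rwa [conj_zero, dist_zero_right, dist_zero_right] at h

end Conjugation

section SecondQuantization

variable (q : Set.Ioo (-1 : ℝ) 1) {K : Type*} [NormedAddCommGroup K] [InnerProductSpace ℝ K]

theorem levelForm_map (q : ℝ) (O : K ≃ₗᵢ[ℝ] K) {n : ℕ} (u v : ⨂[ℝ]^n K) :
    levelForm q K n (PiTensorProduct.map (fun _ => O.toLinearEquiv.toLinearMap) u)
      (PiTensorProduct.map (fun _ => O.toLinearEquiv.toLinearMap) v) = levelForm q K n u v := by
  suffices h : (levelForm q K n).compl₁₂
      (PiTensorProduct.map (fun _ => O.toLinearEquiv.toLinearMap))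
      (PiTensorProduct.map (fun _ => O.toLinearEquiv.toLinearMap)) = levelForm q K n from
    LinearMap.congr_fun (LinearMap.congr_fun h u) v
  ext v w
  simp only [LinearMap.compMultilinearMap_apply, LinearMap.compl₁₂_apply,
    PiTensorProduct.map_tprod, levelForm_tprod]
  simp

/-- The second quantization of an orthogonal map, as a bounded operator. -/
noncomputable def secondQuantizationMap (O : K ≃ₗᵢ[ℝ] K) : Fock q K →L[ℂ] Fock q K :=
  levelMap q (fun _ => PiTensorProduct.map fun _ => O.toLinearEquiv.toLinearMap)
    fun _ u => (levelForm_map _ O u u).le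

theorem secondQuantizationMap_elementaryTensor (O : K ≃ₗᵢ[ℝ] K) {n : ℕ} (ξ : Fin n → K) :
    secondQuantizationMap q O (elementaryTensor q ξ) = elementaryTensor q fun i => O (ξ i) := by
  rw [secondQuantizationMap, elementaryTensor_eq, levelMap_realTensor, PiTensorProduct.map_tprod]
  rfl

theorem secondQuantizationMap_symm_mul (O : K ≃ₗᵢ[ℝ] K) :
    secondQuantizationMap q O.symm * secondQuantizationMap q O = 1 := by
  refine clm_ext q fun n v => ?_
  rw [mul_apply_eq_comp, secondQuantizationMap_elementaryTensor,
    secondQuantizationMap_elementaryTensor]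
  simp

theorem secondQuantizationMap_adjoint (O : K ≃ₗᵢ[ℝ] K) :
    (secondQuantizationMap q O).adjoint = secondQuantizationMap q O.symm := by
  refine levelMap_adjoint q _ _ fun n u v => ?_
  have h : PiTensorProduct.map (fun _ : Fin n => O.toLinearEquiv.toLinearMap)
      (PiTensorProduct.map (fun _ : Fin n => O.symm.toLinearEquiv.toLinearMap) u) = u := by
    rw [← LinearMap.comp_apply, ← PiTensorProduct.map_comp]
    have : (fun _ : Fin n => O.toLinearEquiv.toLinearMap ∘ₗ O.symm.toLinearEquiv.toLinearMap) =
        fun _ => LinearMap.id := by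
      funext
      ext
      simp
    rw [this, PiTensorProduct.map_id, LinearMap.id_apply]
  rw [← levelForm_map (q : ℝ) O, h]

/-- The second quantization of an orthogonal map:
`ξ₁ ⊗ ⋯ ⊗ ξₙ ↦ O ξ₁ ⊗ ⋯ ⊗ O ξₙ`. -/
noncomputable def secondQuantization (O : K ≃ₗᵢ[ℝ] K) : Fock q K ≃ₗᵢ[ℂ] Fock q K where
  toLinearEquiv := LinearEquiv.ofLinearMap (secondQuantizationMap q O).toLinearMap
    (secondQuantizationMap q O.symm).toLinearMap
    (by
      ext v
      exact congrArg (fun T => T v) (secondQuantizationMap_symm_mul q O.symm))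
    (by
      ext v
      exact congrArg (fun T => T v) (secondQuantizationMap_symm_mul q O))
  norm_map' v := by
    refine (ContinuousLinearMap.norm_map_iff_adjoint_comp_self _).mpr ?_ v
    rw [secondQuantizationMap_adjoint]
    exact secondQuantizationMap_symm_mul q O

theorem secondQuantization_elementaryTensor (O : K ≃ₗᵢ[ℝ] K) {n : ℕ} (ξ : Fin n → K) :
    secondQuantization q O (elementaryTensor q ξ) = elementaryTensor q fun i => O (ξ i) :=
  secondQuantizationMap_elementaryTensor q O ξ

theorem secondQuantization_vacuum (O : K ≃ₗᵢ[ℝ] K) :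
    secondQuantization q O (vacuum q K) = vacuum q K := by
  rw [vacuum, secondQuantization_elementaryTensor]
  congr 1
  exact Subsingleton.elim _ _

theorem conj_creation (O : K ≃ₗᵢ[ℝ] K) (ξ : K) :
    (secondQuantization q O).conjStarAlgEquiv (creation q ξ) = creation q (O ξ) := by
  refine clm_ext q fun n v => ?_
  rw [LinearIsometryEquiv.conjStarAlgEquiv_apply_apply]
  have h : (secondQuantization q O).symm (elementaryTensor q v) =
      elementaryTensor q fun i => O.symm (v i) :=
    secondQuantizationMap_elementaryTensor q O.symm v
  rw [h, creation_elementaryTensor, secondQuantization_elementaryTensor,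
    creation_elementaryTensor]
  congr 1
  funext i
  cases i using Fin.cases <;> simp

theorem conj_fieldOp (O : K ≃ₗᵢ[ℝ] K) (ξ : K) :
    (secondQuantization q O).conjStarAlgEquiv (fieldOp q ξ) = fieldOp q (O ξ) := by
  rw [fieldOp, ← ContinuousLinearMap.star_eq_adjoint, conj_add, conj_star, conj_creation, fieldOp,
    ContinuousLinearMap.star_eq_adjoint]

theorem creation_add (ξ η : K) : creation q (ξ + η) = creation q ξ + creation q η := by
  refine clm_ext q fun n v => ?_
  rw [add_apply, creation_elementaryTensor, creation_elementaryTensor, creation_elementaryTensor,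
    elementaryTensor_eq, elementaryTensor_eq, elementaryTensor_eq, ← map_add,
    MultilinearMap.cons_add]

theorem creation_smul (r : ℝ) (ξ : K) : creation q (r • ξ) = (r : ℂ) • creation q ξ := by
  refine clm_ext q fun n v => ?_
  rw [smul_apply, creation_elementaryTensor, creation_elementaryTensor,
    elementaryTensor_eq, elementaryTensor_eq, Complex.coe_smul, ← map_smul,
    MultilinearMap.cons_smul]

theorem fieldOp_add (ξ η : K) : fieldOp q (ξ + η) = fieldOp q ξ + fieldOp q η := by
  rw [fieldOp, fieldOp, fieldOp, creation_add, map_add]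
  abel

theorem fieldOp_smul (r : ℝ) (ξ : K) : fieldOp q (r • ξ) = (r : ℂ) • fieldOp q ξ := by
  rw [fieldOp, fieldOp, creation_smul, ← ContinuousLinearMap.star_eq_adjoint,
    ← ContinuousLinearMap.star_eq_adjoint, star_smul, Complex.star_def, Complex.conj_ofReal,
    smul_add]

end SecondQuantization

/-! ### The degree in the Fock space -/

section Degree

variable (q : Set.Ioo (-1 : ℝ) 1) {K : Type*} [NormedAddCommGroup K] [InnerProductSpace ℝ K]

variable (K) in
/-- The linear combinations of elementary tensors whose degrees lie in `S`. -/
noncomputable def degreeSpan (S : Set ℕ) : Submodule ℂ (Fock q K) :=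
  Submodule.span ℂ {v : Fock q K | ∃ n ∈ S, ∃ ξ : Fin n → K, v = elementaryTensor q ξ}

theorem inner_eq_zero_of_degreeSpan {S T : Set ℕ} (hST : Disjoint S T) {v w : Fock q K}
    (hv : v ∈ degreeSpan q K S) (hw : w ∈ degreeSpan q K T) : inner ℂ v w = 0 := by
  induction hv using Submodule.span_induction with
  | zero => simp
  | add x y _ _ hx hy => rw [inner_add_left, hx, hy, add_zero]
  | smul a x _ hx => rw [inner_smul_left, hx, mul_zero]
  | mem x hx =>
    obtain ⟨m, hm, ξ, rfl⟩ := hx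
    induction hw using Submodule.span_induction with
    | zero => simp
    | add x y _ _ hx hy => rw [inner_add_right, hx, hy, add_zero]
    | smul a x _ hx => rw [inner_smul_right, hx, mul_zero]
    | mem x hx =>
      obtain ⟨n, hn, η, rfl⟩ := hx
      refine inner_realTensor_of_ne q ?_ _ _
      rintro rfl
      exact Set.disjoint_left.mp hST hm hn

theorem fockSemigroup_of_degreeSpan (t : ℝ≥0) {k : ℕ} {v : Fock q K}
    (hv : v ∈ degreeSpan q K {k}) :
    fockSemigroup q t v = (Real.exp (-(t : ℝ) * k) : ℂ) • v := by
  induction hv using Submodule.span_induction with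
  | zero => simp
  | add x y _ _ hx hy => rw [map_add, hx, hy, smul_add]
  | smul a x _ hx => rw [map_smul, hx, smul_comm]
  | mem x hx =>
    obtain ⟨n, hn, ξ, rfl⟩ := hx
    rw [Set.mem_singleton_iff] at hn
    subst hn
    rw [fockSemigroup_elementaryTensor, elementaryTensor_eq, MultilinearMap.map_smul_univ, map_smul,
      elementaryTensor_eq, Complex.coe_smul, Finset.prod_const, Finset.card_univ, Fintype.card_fin,
      ← Real.exp_nat_mul, mul_comm]

theorem creation_mem_degreeSpan (ξ : K) {k : ℕ} {v : Fock q K} (hv : v ∈ degreeSpan q K {k}) :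
    creation q ξ v ∈ degreeSpan q K {k + 1} := by
  induction hv using Submodule.span_induction with
  | zero => simp
  | add x y _ _ hx hy => rw [map_add]; exact add_mem hx hy
  | smul a x _ hx => rw [map_smul]; exact Submodule.smul_mem _ _ hx
  | mem x hx =>
    obtain ⟨n, hn, η, rfl⟩ := hx
    rw [Set.mem_singleton_iff] at hn
    subst hn
    rw [creation_elementaryTensor]
    exact Submodule.subset_span ⟨_, rfl, _, rfl⟩

theorem vacuum_mem_degreeSpan : vacuum q K ∈ degreeSpan q K {0} :=
  Submodule.subset_span ⟨0, rfl, _, rfl⟩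

theorem vacuum_ne_zero : vacuum q K ≠ 0 := by
  intro h
  have h1 : inner ℂ (vacuum q K) (vacuum q K) = (1 : ℂ) := by
    rw [vacuum_eq, inner_realTensor, levelForm_tprod]
    simp [inversions]
  rw [h, inner_zero_left] at h1
  exact zero_ne_one h1

end Degree

/-! ### Gauge rotations and homogeneous holomorphic polynomials -/

section Holomorphic

variable (q : Set.Ioo (-1 : ℝ) 1) {H : Type*} [NormedAddCommGroup H] [InnerProductSpace ℝ H]

/-- The rotation `(ξ, η) ↦ (a ξ - b η, b ξ + a η)` of `H ⊕ H`. -/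
noncomputable def rotationMap (a b : ℝ) : Double H →ₗ[ℝ] Double H where
  toFun z := WithLp.toLp 2 (a • z.fst - b • z.snd, b • z.fst + a • z.snd)
  map_add' z w := by
    apply WithLp.ofLp_injective
    refine Prod.ext ?_ ?_
    · change a • (z.fst + w.fst) - b • (z.snd + w.snd) =
        (a • z.fst - b • z.snd) + (a • w.fst - b • w.snd)
      module
    · change b • (z.fst + w.fst) + a • (z.snd + w.snd) =
        (b • z.fst + a • z.snd) + (b • w.fst + a • w.snd)
      module
  map_smul' r z := by
    apply WithLp.ofLp_injective
    refine Prod.ext ?_ ?_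
    · change a • (r • z.fst) - b • (r • z.snd) = r • (a • z.fst - b • z.snd)
      module
    · change b • (r • z.fst) + a • (r • z.snd) = r • (b • z.fst + a • z.snd)
      module

theorem rotationMap_neg {a b : ℝ} (h : a ^ 2 + b ^ 2 = 1) (z : Double H) :
    rotationMap a (-b) (rotationMap a b z) = z := by
  apply WithLp.ofLp_injective
  refine Prod.ext ?_ ?_
  · change a • (a • z.fst - b • z.snd) - (-b) • (b • z.fst + a • z.snd) = z.fst
    calc _ = (a ^ 2 + b ^ 2) • z.fst := by module
      _ = _ := by rw [h, one_smul]
  · change (-b) • (a • z.fst - b • z.snd) + a • (b • z.fst + a • z.snd) = z.snd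
    calc _ = (a ^ 2 + b ^ 2) • z.snd := by module
      _ = _ := by rw [h, one_smul]

theorem norm_rotationMap {a b : ℝ} (h : a ^ 2 + b ^ 2 = 1) (z : Double H) :
    ‖rotationMap a b z‖ = ‖z‖ := by
  refine (sq_eq_sq₀ (norm_nonneg _) (norm_nonneg _)).mp ?_
  rw [WithLp.prod_norm_sq_eq_of_L2, WithLp.prod_norm_sq_eq_of_L2]
  change ‖a • z.fst - b • z.snd‖ ^ 2 + ‖b • z.fst + a • z.snd‖ ^ 2 = _
  rw [norm_sub_sq_real, norm_add_sq_real]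
  simp only [norm_smul, real_inner_smul_left, real_inner_smul_right, mul_pow,
    Real.norm_eq_abs, sq_abs]
  linear_combination (‖z.fst‖ ^ 2 + ‖z.snd‖ ^ 2) * h

theorem re_sq_add_im_sq {u : ℂ} (hu : ‖u‖ = 1) : u.re ^ 2 + u.im ^ 2 = 1 := by
  have := Complex.sq_norm u
  rw [hu, Complex.normSq_apply] at this
  linarith

/-- The rotation of `H ⊕ H` by the angle of a unit complex number. -/
noncomputable def rotation (u : ℂ) (hu : ‖u‖ = 1) : Double H ≃ₗᵢ[ℝ] Double H where
  toLinearEquiv := LinearEquiv.ofLinearMap (rotationMap u.re u.im) (rotationMap u.re (-u.im))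
    (LinearMap.ext fun z => by
      have := rotationMap_neg (b := -u.im) ((neg_sq u.im).symm ▸ re_sq_add_im_sq hu) z
      rwa [neg_neg] at this)
    (LinearMap.ext fun z => rotationMap_neg (re_sq_add_im_sq hu) z)
  norm_map' z := norm_rotationMap (re_sq_add_im_sq hu) z

theorem rotation_apply (u : ℂ) (hu : ‖u‖ = 1) (z : Double H) :
    rotation u hu z = WithLp.toLp 2 (u.re • z.fst - u.im • z.snd, u.im • z.fst + u.re • z.snd) :=
  rfl

/-- The gauge automorphism attached to a unit complex number multiplies the holomorphic variables by
its conjugate. -/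
theorem conj_holomorphicVar (u : ℂ) (hu : ‖u‖ = 1) (ξ : H) :
    (secondQuantization q (rotation u hu)).conjStarAlgEquiv (holomorphicVar q ξ) =
      (starRingEnd ℂ) u • holomorphicVar q ξ := by
  have h1 : rotation u hu (WithLp.toLp 2 (ξ, (0 : H))) =
      u.re • WithLp.toLp 2 (ξ, (0 : H)) + u.im • WithLp.toLp 2 ((0 : H), ξ) := by
    rw [rotation_apply]
    apply WithLp.ofLp_injective
    refine Prod.ext ?_ ?_ <;> simp
  have h2 : rotation u hu (WithLp.toLp 2 ((0 : H), ξ)) =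
      (-u.im) • WithLp.toLp 2 (ξ, (0 : H)) + u.re • WithLp.toLp 2 ((0 : H), ξ) := by
    rw [rotation_apply]
    apply WithLp.ofLp_injective
    refine Prod.ext ?_ ?_ <;> simp
  have hconj : (starRingEnd ℂ) u = u.re - u.im * Complex.I := by
    apply Complex.ext <;> simp
  rw [holomorphicVar, conj_smul, conj_add, conj_smul, conj_fieldOp, conj_fieldOp, h1, h2,
    fieldOp_add, fieldOp_add, fieldOp_smul, fieldOp_smul, fieldOp_smul, fieldOp_smul,
    smul_comm ((starRingEnd ℂ) u), hconj]
  congr 1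
  have hI := Complex.I_mul_I
  generalize fieldOp q (WithLp.toLp 2 (ξ, (0 : H))) = X
  generalize fieldOp q (WithLp.toLp 2 ((0 : H), ξ)) = Y
  have h3 : ((u.re : ℂ) - u.im * Complex.I) * Complex.I = u.im + Complex.I * u.re := by
    linear_combination (-(u.im : ℂ)) * hI
  have h4 : ((u.re : ℂ) - u.im * Complex.I) • (X + Complex.I • Y) =
      ((u.re : ℂ) - u.im * Complex.I) • X + (u.im + Complex.I * u.re) • Y := by
    rw [smul_add, smul_smul, h3]
  rw [h4]
  push_cast
  module

theorem holomorphicVar_mem (ξ : H) : holomorphicVar q ξ ∈ qGaussianAlgebra q (Double H) :=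
  smul_mem' _ (add_mem (fieldOp_mem q _) (smul_mem' _ (fieldOp_mem q _)))

/-- The creation part of the holomorphic variable `Z_q(ξ)`. -/
noncomputable def holomorphicCreation (ξ : H) : Fock q (Double H) →L[ℂ] Fock q (Double H) :=
  ((1 / √2 : ℝ) : ℂ) • (creation q (WithLp.toLp 2 (ξ, (0 : H))) +
    Complex.I • creation q (WithLp.toLp 2 ((0 : H), ξ)))

/-- The annihilation part of the holomorphic variable `Z_q(ξ)`. -/
noncomputable def holomorphicAnnihilation (ξ : H) : Fock q (Double H) →L[ℂ] Fock q (Double H) :=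
  ((1 / √2 : ℝ) : ℂ) • ((creation q (WithLp.toLp 2 (ξ, (0 : H)))).adjoint +
    Complex.I • (creation q (WithLp.toLp 2 ((0 : H), ξ))).adjoint)

theorem holomorphicVar_eq (ξ : H) :
    holomorphicVar q ξ = holomorphicCreation q ξ + holomorphicAnnihilation q ξ := by
  simp only [holomorphicVar, holomorphicCreation, holomorphicAnnihilation, fieldOp, smul_add]
  abel

/-- The annihilation and creation parts of holomorphic variables satisfy the `q`-commutation
relation without scalar term: the two contributions to the bilinear pairing of `(η, i η)` with `(ξ, i ξ)`
cancel. -/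
theorem holomorphicAnnihilation_mul_creation (η ξ : H) :
    holomorphicAnnihilation q η * holomorphicCreation q ξ =
      (q : ℂ) • (holomorphicCreation q ξ * holomorphicAnnihilation q η) := by
  simp only [holomorphicAnnihilation, holomorphicCreation, add_mul, mul_add,
    annihilation_mul_creation, WithLp.prod_inner_apply, smul_mul_assoc, mul_smul_comm]
  simp only [inner_zero_left, inner_zero_right, add_zero, zero_add, Complex.ofReal_zero, zero_smul,
    smul_add, smul_smul]
  have hI : Complex.I * Complex.I = -1 := Complex.I_mul_I
  generalize ((1 / √2 : ℝ) : ℂ) = c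
  match_scalars
  · linear_combination (c ^ 2 * ((inner ℝ η ξ : ℝ) : ℂ)) * hI
  all_goals ring

variable (H) in
/-- The homogeneous holomorphic elements of degree `k`: operators `x` of the `q`-Gaussian algebra
that the gauge rotation by `u` multiplies by `conj u ^ k`, for which `x Ω` is homogeneous of
degree `k` and annihilated by the annihilation parts of the holomorphic variables. -/
noncomputable def holomorphicHomogeneous (k : ℕ) :
    Submodule ℂ (Fock q (Double H) →L[ℂ] Fock q (Double H)) where
  carrier := {x | x ∈ qGaussianAlgebra q (Double H) ∧
    (∀ (u : ℂ) (hu : ‖u‖ = 1), (secondQuantization q (rotation u hu)).conjStarAlgEquiv x =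
      (starRingEnd ℂ) u ^ k • x) ∧
    x (vacuum q (Double H)) ∈ degreeSpan q (Double H) {k} ∧
    ∀ ξ : H, holomorphicAnnihilation q ξ (x (vacuum q (Double H))) = 0}
  add_mem' := by
    rintro x y ⟨h1, h2, h3, h4⟩ ⟨h1', h2', h3', h4'⟩
    refine ⟨add_mem h1 h1', fun u hu => ?_, ?_, fun ξ => ?_⟩
    · rw [conj_add, h2, h2', smul_add]
    · exact add_mem h3 h3'
    · rw [add_apply, map_add, h4, h4', add_zero]
  zero_mem' := ⟨zero_mem _, fun u hu => by rw [conj_zero, smul_zero], zero_mem _, fun ξ => by simp⟩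
  smul_mem' := by
    rintro c x ⟨h1, h2, h3, h4⟩
    refine ⟨smul_mem' c h1, fun u hu => ?_, Submodule.smul_mem _ c h3, fun ξ => ?_⟩
    · rw [conj_smul, h2, smul_comm]
    · rw [smul_apply, map_smul, h4, smul_zero]

theorem one_mem_holomorphicHomogeneous : 1 ∈ holomorphicHomogeneous q H 0 := by
  refine ⟨one_mem _, fun u hu => by rw [conj_one, pow_zero, one_smul], vacuum_mem_degreeSpan q,
    fun ξ => ?_⟩
  rw [one_apply_eq_self, holomorphicAnnihilation, smul_apply, add_apply, smul_apply,
    annihilation_vacuum, annihilation_vacuum]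
  simp

variable {q} in
theorem holomorphicVar_apply_vacuum {k : ℕ} {x : Fock q (Double H) →L[ℂ] Fock q (Double H)}
    (hx : x ∈ holomorphicHomogeneous q H k) (ξ : H) :
    (holomorphicVar q ξ * x) (vacuum q (Double H)) =
      holomorphicCreation q ξ (x (vacuum q (Double H))) := by
  rw [mul_apply_eq_comp, holomorphicVar_eq, add_apply, hx.2.2.2 ξ, add_zero]

variable {q} in
theorem holomorphicVar_mul_mem {k : ℕ} {x : Fock q (Double H) →L[ℂ] Fock q (Double H)}
    (hx : x ∈ holomorphicHomogeneous q H k) (ξ : H) :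
    holomorphicVar q ξ * x ∈ holomorphicHomogeneous q H (k + 1) := by
  refine ⟨mul_mem (holomorphicVar_mem q ξ) hx.1, fun u hu => ?_, ?_, fun η => ?_⟩
  · rw [conj_mul, conj_holomorphicVar, hx.2.1, smul_mul_smul_comm, pow_succ']
  · rw [holomorphicVar_apply_vacuum hx, holomorphicCreation, smul_apply, add_apply, smul_apply]
    exact Submodule.smul_mem _ _ (add_mem (creation_mem_degreeSpan q _ hx.2.2.1)
      (Submodule.smul_mem _ _ (creation_mem_degreeSpan q _ hx.2.2.1)))
  · rw [holomorphicVar_apply_vacuum hx, ← mul_apply_eq_comp, holomorphicAnnihilation_mul_creation,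
      smul_apply, mul_apply_eq_comp, hx.2.2.2 η, map_zero, smul_zero]

/-- Every holomorphic polynomial is a finite sum of homogeneous ones. -/
theorem exists_eq_sum_homogeneous {x : Fock q (Double H) →L[ℂ] Fock q (Double H)}
    (hx : x ∈ holomorphicAlgebra q H) :
    ∃ f : ℕ →₀ (Fock q (Double H) →L[ℂ] Fock q (Double H)),
      (∀ k, f k ∈ holomorphicHomogeneous q H k) ∧ ∑ k ∈ f.support, f k = x := by
  have h : x ∈ ⨆ k, holomorphicHomogeneous q H k := by
    have hx' : x ∈ Subalgebra.toSubmodule (holomorphicAlgebra q H) := hx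
    rw [holomorphicAlgebra, Algebra.adjoin_eq_span] at hx'
    refine Submodule.span_le.mpr ?_ hx'
    intro y hy
    have : ∃ k, y ∈ holomorphicHomogeneous q H k := by
      induction hy using Submonoid.closure_induction_left with
      | one => exact ⟨0, one_mem_holomorphicHomogeneous q⟩
      | mul_left z hz y _ ih =>
        obtain ⟨ξ, rfl⟩ := hz
        obtain ⟨k, hk⟩ := ih
        exact ⟨k + 1, holomorphicVar_mul_mem hk ξ⟩
    obtain ⟨k, hk⟩ := this
    exact Submodule.mem_iSup_of_mem k hk
  obtain ⟨f, hf, hsum⟩ := (Submodule.mem_iSup_iff_exists_finsupp _ _).mp h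
  exact ⟨f, hf, hsum⟩

theorem holomorphicVar_pow_mem (ξ : H) (d : ℕ) :
    holomorphicVar q ξ ^ d ∈ holomorphicHomogeneous q H d := by
  induction d with
  | zero => exact one_mem_holomorphicHomogeneous q
  | succ d ih =>
    rw [pow_succ']
    exact holomorphicVar_mul_mem ih ξ

/-- Annihilation by `(ξ, 0)` lowers the power of `Z_q(ξ)` by one, with the `q`-integer
`1 + q + ⋯ + q ^ d` as a factor. -/
theorem annihilation_holomorphicVar_pow (ξ : H) (d : ℕ) :
    (creation q (WithLp.toLp 2 (ξ, (0 : H)))).adjoint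
        ((holomorphicVar q ξ ^ (d + 1)) (vacuum q (Double H))) =
      ((1 / √2 * ‖ξ‖ ^ 2 * ∑ j ∈ Finset.range (d + 1), (q : ℝ) ^ j : ℝ) : ℂ) •
        (holomorphicVar q ξ ^ d) (vacuum q (Double H)) := by
  set a := (creation q (WithLp.toLp 2 (ξ, (0 : H)))).adjoint with ha
  have hcomm : a * holomorphicCreation q ξ =
      ((1 / √2 * ‖ξ‖ ^ 2 : ℝ) : ℂ) • 1 + (q : ℂ) • (holomorphicCreation q ξ * a) := by
    simp only [ha, holomorphicCreation, mul_smul_comm, mul_add, annihilation_mul_creation,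
      WithLp.prod_inner_apply, smul_mul_assoc, add_mul]
    simp only [inner_zero_left, inner_zero_right, add_zero, Complex.ofReal_zero,
      zero_smul, smul_add, smul_smul, real_inner_self_eq_norm_sq]
    push_cast
    module
  have hstep : ∀ d, a ((holomorphicVar q ξ ^ (d + 1)) (vacuum q (Double H))) =
      ((1 / √2 * ‖ξ‖ ^ 2 : ℝ) : ℂ) • (holomorphicVar q ξ ^ d) (vacuum q (Double H)) +
        (q : ℂ) • holomorphicCreation q ξ
          (a ((holomorphicVar q ξ ^ d) (vacuum q (Double H)))) := by
    intro d
    rw [pow_succ', holomorphicVar_apply_vacuum (holomorphicVar_pow_mem q ξ d),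
      ← mul_apply_eq_comp, hcomm]
    rfl
  induction d with
  | zero =>
    rw [hstep, pow_zero, one_apply_eq_self, ha, annihilation_vacuum]
    simp
  | succ d ih =>
    rw [hstep, ih, map_smul, ← holomorphicVar_apply_vacuum (holomorphicVar_pow_mem q ξ d),
      ← pow_succ', smul_smul, ← add_smul, Finset.sum_range_succ' _ (d + 1)]
    congr 1
    simp only [pow_succ, ← Finset.sum_mul]
    push_cast
    ring

/-- The powers of `Z_q(ξ)` do not vanish: the `q`-integers in `annihilation_holomorphicVar_pow` are
positive since `q > -1`. -/
theorem holomorphicVar_pow_apply_vacuum_ne_zero {ξ : H} (hξ : ξ ≠ 0) (d : ℕ) :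
    (holomorphicVar q ξ ^ d) (vacuum q (Double H)) ≠ 0 := by
  induction d with
  | zero => exact vacuum_ne_zero q
  | succ d ih =>
    intro h
    have h1 := annihilation_holomorphicVar_pow q ξ d
    rw [h, map_zero, eq_comm, smul_eq_zero] at h1
    refine h1.elim (fun h2 => ?_) ih
    have hpos : 0 < ∑ j ∈ Finset.range (d + 1), (q : ℝ) ^ j :=
      geom_sum_pos' (by linarith [q.2.1]) (by omega)
    have hξ' : 0 < ‖ξ‖ := norm_pos_iff.mpr hξ
    have : 0 < 1 / √2 * ‖ξ‖ ^ 2 * ∑ j ∈ Finset.range (d + 1), (q : ℝ) ^ j := by positivity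
    exact this.ne' (by exact_mod_cast h2)

end Holomorphic


/-! ### The `L_p`-norms -/

section Separating

variable {E : Type*} [NormedAddCommGroup E] [InnerProductSpace ℂ E] [CompleteSpace E]

/-- The vector functional of a separating vector is faithful. -/
theorem moment_pos {M : VonNeumannAlgebra E} {Ω : E} (h : ∀ b ∈ M, b Ω = 0 → b = 0)
    {x : E →L[ℂ] E} (hx : x ∈ M) (hx0 : x ≠ 0) {p : ℝ} (hp : 0 < p) : 0 < moment Ω p x := by
  refine (moment_nonneg Ω p x).lt_of_ne fun h0 => hx0 ?_
  have hnn : 0 ≤ star x * x := star_mul_self_nonneg x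
  set a := (star x * x) ^ (p / 2) with ha
  have ha0 : 0 ≤ a := CFC.rpow_nonneg
  have haM : a ∈ M := rpow_mem (mul_mem (star_mem hx) hx) _
  have hb : CFC.sqrt a * CFC.sqrt a = a := CFC.sqrt_mul_sqrt_self a ha0
  have hbM : CFC.sqrt a ∈ M := by
    rw [CFC.sqrt_eq_rpow]
    exact rpow_mem haM _
  have hbs : star (CFC.sqrt a) = CFC.sqrt a := (CFC.sqrt_nonneg a).isSelfAdjoint.star_eq
  have h1 : ‖CFC.sqrt a Ω‖ ^ 2 = 0 := by
    have h2 : moment Ω p x = (vectorState Ω (CFC.sqrt a * CFC.sqrt a)).re := by rw [hb]; rfl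
    rw [vectorState_mul, hbs] at h2
    rw [← inner_self_eq_norm_sq (𝕜 := ℂ), h0]
    exact h2.symm
  have hb0 : CFC.sqrt a = 0 := h _ hbM (norm_eq_zero.mp (pow_eq_zero_iff two_ne_zero |>.mp h1))
  have ha00 : a = 0 := by rw [← hb, hb0, mul_zero]
  have h3 : star x * x = 0 := by
    have h4 := CFC.rpow_rpow_of_exponent_nonneg (star x * x) (p / 2) (2 / p) (by positivity)
      (by positivity) hnn
    rw [← ha, ha00, show p / 2 * (2 / p) = 1 by field_simp, CFC.rpow_one _ hnn] at h4
    rw [← h4]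
    exact CFC.zero_rpow (by positivity)
  exact (CStarRing.star_mul_self_eq_zero_iff x).mp h3

end Separating

section LpNorm

variable {q : Set.Ioo (-1 : ℝ) 1} {K : Type*} [NormedAddCommGroup K] [InnerProductSpace ℝ K]
  {p : ℝ≥0∞}

theorem lpNorm_top (x : Fock q K →L[ℂ] Fock q K) : lpNorm q ⊤ x = ‖x‖ := if_pos rfl

theorem lpNorm_eq_moment (h : p ≠ ⊤) (x : Fock q K →L[ℂ] Fock q K) :
    lpNorm q p x = moment (vacuum q K) p.toReal x ^ (1 / p.toReal) := by
  rw [lpNorm, if_neg h]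
  rfl

theorem one_le_toReal (hp : 1 ≤ p) (h : p ≠ ⊤) : 1 ≤ p.toReal := by
  rw [← ENNReal.toReal_one]
  exact ENNReal.toReal_mono h hp

theorem lpNorm_add_le (hp : 1 ≤ p) {x y : Fock q K →L[ℂ] Fock q K} (hx : x ∈ qGaussianAlgebra q K)
    (hy : y ∈ qGaussianAlgebra q K) : lpNorm q p (x + y) ≤ lpNorm q p x + lpNorm q p y := by
  by_cases h : p = ⊤
  · subst h
    simp only [lpNorm_top]
    exact norm_add_le x y
  · simp only [lpNorm_eq_moment h]
    exact (isTracialVector_vacuum q).moment_add_le hx hy (one_le_toReal hp h)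

theorem lpNorm_smul (hp : 1 ≤ p) (c : ℂ) (x : Fock q K →L[ℂ] Fock q K) :
    lpNorm q p (c • x) = ‖c‖ * lpNorm q p x := by
  by_cases h : p = ⊤
  · subst h
    simp only [lpNorm_top]
    exact norm_smul c x
  · simp only [lpNorm_eq_moment h]
    exact moment_smul c x (one_le_toReal hp h)

theorem lpNorm_conj (hp : 1 ≤ p) (O : K ≃ₗᵢ[ℝ] K) (x : Fock q K →L[ℂ] Fock q K) :
    lpNorm q p ((secondQuantization q O).conjStarAlgEquiv x) = lpNorm q p x := by
  by_cases h : p = ⊤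
  · subst h
    simp only [lpNorm_top]
    exact norm_conj _ x
  · simp only [lpNorm_eq_moment h]
    rw [moment_conj _ (secondQuantization_vacuum q O) _ (by linarith [one_le_toReal hp h])]

theorem lpNorm_pos (hp : 1 ≤ p) {x : Fock q K →L[ℂ] Fock q K} (hx : x ∈ qGaussianAlgebra q K)
    (hx0 : x ≠ 0) : 0 < lpNorm q p x := by
  by_cases h : p = ⊤
  · subst h
    rw [lpNorm_top]
    exact norm_pos_iff.mpr hx0
  · rw [lpNorm_eq_moment h]
    exact Real.rpow_pos_of_pos (moment_pos (fun b hb => eq_zero_of_apply_vacuum q hb) hx hx0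
      (by linarith [one_le_toReal hp h])) _

variable (q K) in
/-- The noncommutative `L_p`-norm as a seminorm on the `q`-Gaussian algebra. -/
noncomputable def lpSeminorm (hp : 1 ≤ p) :
    Seminorm ℂ (qGaussianAlgebra q K).toStarSubalgebra :=
  Seminorm.of (fun x => lpNorm q p (x : Fock q K →L[ℂ] Fock q K))
    (fun x y => lpNorm_add_le hp x.2 y.2) (fun c _ => lpNorm_smul hp c _)

theorem lpSeminorm_sum (hp : 1 ≤ p) (v : ℕ → (qGaussianAlgebra q K).toStarSubalgebra)
    (I : Finset ℕ) (φ : ℕ → ℂ) :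
    lpSeminorm q K hp (∑ k ∈ I, φ k • v k) =
      lpNorm q p (∑ k ∈ I, φ k • (v k : Fock q K →L[ℂ] Fock q K)) := by
  change lpNorm q p ((∑ k ∈ I, φ k • v k : (qGaussianAlgebra q K).toStarSubalgebra) :
    Fock q K →L[ℂ] Fock q K) = _
  congr 1
  exact map_sum (qGaussianAlgebra q K).toStarSubalgebra.subtype _ _

end LpNorm

/-! ### The Ornstein–Uhlenbeck semigroup and the number operator -/

section Semigroup

variable {q : Set.Ioo (-1 : ℝ) 1} {K : Type*} [NormedAddCommGroup K] [InnerProductSpace ℝ K]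
  {x y z : Fock q K →L[ℂ] Fock q K}

theorem IsOrnsteinUhlenbeck.unique {t : ℝ≥0} (hy : IsOrnsteinUhlenbeck q t x y)
    (hz : IsOrnsteinUhlenbeck q t x z) : y = z :=
  eq_of_apply_vacuum q hy.1 hz.1 (hy.2.trans hz.2.symm)

theorem IsOrnsteinUhlenbeck.ornsteinUhlenbeck_eq {t : ℝ≥0} (hy : IsOrnsteinUhlenbeck q t x y) :
    ornsteinUhlenbeck q t x = y := by
  have h : ∃ y, IsOrnsteinUhlenbeck q t x y := ⟨y, hy⟩
  rw [ornsteinUhlenbeck, dif_pos h]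
  exact h.choose_spec.unique hy

theorem IsNumber.unique (hy : IsNumber q x y) (hz : IsNumber q x z) : y = z :=
  eq_of_apply_vacuum q hy.1 hz.1 (tendsto_nhds_unique hy.2 hz.2)

theorem IsNumber.numberOperator_eq (hy : IsNumber q x y) : numberOperator q x = y := by
  have h : ∃ y, IsNumber q x y := ⟨y, hy⟩
  rw [numberOperator, dif_pos h]
  exact h.choose_spec.unique hy

theorem tendsto_inv_mul_one_sub_exp (k : ℕ) :
    Filter.Tendsto (fun t : ℝ≥0 => ((t : ℝ)⁻¹ : ℂ) * (1 - (Real.exp (-(t : ℝ) * k) : ℂ)))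
      (nhdsWithin 0 (Set.Ioi 0)) (nhds (k : ℂ)) := by
  have h1 : HasDerivAt (fun s : ℝ => -Real.exp (-s * k)) k 0 := by
    have := (((hasDerivAt_id (0 : ℝ)).neg.mul_const (k : ℝ)).exp).fun_neg
    simpa using this
  have h2 : Filter.Tendsto (fun t : ℝ≥0 => (t : ℝ)) (nhdsWithin 0 (Set.Ioi 0))
      (nhdsWithin 0 (Set.Ioi 0)) := by
    refine tendsto_nhdsWithin_iff.mpr ⟨?_, ?_⟩
    · exact (NNReal.continuous_coe.tendsto 0).mono_left nhdsWithin_le_nhds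
    · filter_upwards [self_mem_nhdsWithin] with t ht
      exact NNReal.coe_pos.mpr ht
  have h3 := (Complex.continuous_ofReal.tendsto (k : ℝ)).comp
    (h1.tendsto_slope_zero_right.comp h2)
  simp only [Complex.ofReal_natCast] at h3
  refine h3.congr fun t => ?_
  simp only [Function.comp_apply, zero_add, smul_eq_mul, neg_zero, zero_mul, Real.exp_zero]
  push_cast
  ring

variable (f : ℕ → Fock q K →L[ℂ] Fock q K) (I : Finset ℕ)
  (hf : ∀ k ∈ I, f k ∈ qGaussianAlgebra q K) (hf' : ∀ k ∈ I, f k (vacuum q K) ∈ degreeSpan q K {k})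

include hf hf' in
theorem isOrnsteinUhlenbeck_sum (t : ℝ≥0) :
    IsOrnsteinUhlenbeck q t (∑ k ∈ I, f k) (∑ k ∈ I, (Real.exp (-(t : ℝ) * k) : ℂ) • f k) := by
  refine ⟨sum_mem fun k hk => smul_mem' _ (hf k hk), ?_⟩
  rw [sum_apply, sum_apply, map_sum]
  refine Finset.sum_congr rfl fun k hk => ?_
  rw [fockSemigroup_of_degreeSpan q t (hf' k hk), smul_apply]

include hf hf' in
theorem isNumber_sum : IsNumber q (∑ k ∈ I, f k) (∑ k ∈ I, (k : ℂ) • f k) := by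
  refine ⟨sum_mem fun k hk => smul_mem' _ (hf k hk), ?_⟩
  have h : ∀ t : ℝ≥0, ((t : ℝ)⁻¹ : ℂ) • ((∑ k ∈ I, f k) (vacuum q K) -
      fockSemigroup q t ((∑ k ∈ I, f k) (vacuum q K))) =
      ∑ k ∈ I, (((t : ℝ)⁻¹ : ℂ) * (1 - (Real.exp (-(t : ℝ) * k) : ℂ))) • f k (vacuum q K) := by
    intro t
    rw [sum_apply, map_sum, ← Finset.sum_sub_distrib, Finset.smul_sum]
    refine Finset.sum_congr rfl fun k hk => ?_
    rw [fockSemigroup_of_degreeSpan q t (hf' k hk), mul_smul, sub_smul, one_smul]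
  refine Filter.Tendsto.congr (fun t => (h t).symm) ?_
  simp only [sum_apply, smul_apply]
  exact tendsto_finsetSum _ fun k _ => (tendsto_inv_mul_one_sub_exp k).smul_const _

end Semigroup

/-! ### Multipliers on holomorphic polynomials -/

section Components

variable {q : Set.Ioo (-1 : ℝ) 1} {H : Type*} [NormedAddCommGroup H] [InnerProductSpace ℝ H]
  {p : ℝ≥0∞}

/-- The gauge rotations are automorphisms preserving all `L_p`-norms, so the `L_p`-norm of a
holomorphic polynomial does not change when its homogeneous components are multiplied by the powers
of a unit complex number. -/
theorem circleInvariant_lpSeminorm (hp : 1 ≤ p)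
    (v : ℕ → (qGaussianAlgebra q (Double H)).toStarSubalgebra)
    (hv : ∀ k, (v k : Fock q (Double H) →L[ℂ] Fock q (Double H)) ∈
      holomorphicHomogeneous q H k) :
    CircleInvariant (lpSeminorm q (Double H) hp) v := by
  intro I φ u hu
  have hu' : ‖(starRingEnd ℂ) u‖ = 1 := by rw [RCLike.norm_conj, hu]
  rw [lpSeminorm_sum, lpSeminorm_sum, ← lpNorm_conj hp (rotation _ hu') (∑ k ∈ I, φ k • _),
    conj_sum]
  congr 1
  refine Finset.sum_congr rfl fun k _ => ?_
  rw [conj_smul, (hv k).2.1 _ hu', Complex.conj_conj, smul_smul, mul_comm]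

/-- If the degrees of a holomorphic polynomial lie in `S`, its homogeneous components of degree
outside of `S` vanish, by orthogonality. -/
theorem exists_eq_sum_of_mem_degreeSpace {x : Fock q (Double H) →L[ℂ] Fock q (Double H)}
    (hx : x ∈ holomorphicAlgebra q H) {S : Set ℕ} (hS : x ∈ degreeSpace q (Double H) S) :
    ∃ f : ℕ →₀ (Fock q (Double H) →L[ℂ] Fock q (Double H)),
      (∀ k, f k ∈ holomorphicHomogeneous q H k) ∧ (↑f.support ⊆ S) ∧
        ∑ k ∈ f.support, f k = x := by
  obtain ⟨f, hf, hsum⟩ := exists_eq_sum_homogeneous q hx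
  refine ⟨f, hf, fun k hk => ?_, hsum⟩
  by_contra hkS
  have h1 : inner ℂ (f k (vacuum q (Double H))) (x (vacuum q (Double H))) = 0 :=
    inner_eq_zero_of_degreeSpan q (Set.disjoint_singleton_left.mpr hkS) (hf k).2.2.1 hS.2
  rw [← hsum, sum_apply, inner_sum, Finset.sum_eq_single_of_mem k hk
    fun j _ hj => inner_eq_zero_of_degreeSpan q (Set.disjoint_singleton.mpr hj.symm)
      (hf k).2.2.1 (hf j).2.2.1, inner_self_eq_zero] at h1
  exact Finsupp.mem_support_iff.mp hk (eq_zero_of_apply_vacuum q (hf k).1 h1)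

theorem sum_support_eq {A : Type*} [AddCommMonoid A] (f : ℕ →₀ A) {I : Finset ℕ}
    (h : f.support ⊆ I) : ∑ k ∈ I, f k = ∑ k ∈ f.support, f k :=
  (Finset.sum_subset h fun _ _ hk => Finsupp.notMem_support_iff.mp hk).symm

variable (f : ℕ → Fock q (Double H) →L[ℂ] Fock q (Double H))
  (hf : ∀ k, f k ∈ holomorphicHomogeneous q H k)

include hf in
theorem ornsteinUhlenbeck_sum (I : Finset ℕ) (t : ℝ≥0) :
    ornsteinUhlenbeck q t (∑ k ∈ I, f k) = ∑ k ∈ I, (Real.exp (-(t : ℝ) * k) : ℂ) • f k :=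
  (isOrnsteinUhlenbeck_sum f I (fun k _ => (hf k).1) (fun k _ => (hf k).2.2.1)
    t).ornsteinUhlenbeck_eq

include hf in
theorem numberOperator_sum (I : Finset ℕ) :
    numberOperator q (∑ k ∈ I, f k) = ∑ k ∈ I, (k : ℂ) • f k :=
  (isNumber_sum f I (fun k _ => (hf k).1) (fun k _ => (hf k).2.2.1)).numberOperator_eq

include hf in
theorem lpNorm_le_of_tail (hp : 1 ≤ p) {a b : ℕ} (hab : a ≤ b) :
    (∀ t : ℝ≥0, lpNorm q p (ornsteinUhlenbeck q t (∑ k ∈ Finset.Icc a b, f k)) ≤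
      Real.exp (-(t : ℝ) * a) * lpNorm q p (∑ k ∈ Finset.Icc a b, f k)) ∧
    a * lpNorm q p (∑ k ∈ Finset.Icc a b, f k) ≤
      lpNorm q p (numberOperator q (∑ k ∈ Finset.Icc a b, f k)) := by
  have hv := circleInvariant_lpSeminorm hp (fun k => ⟨f k, (hf k).1⟩) hf
  constructor
  · intro t
    have h := hv.exp_neg_mul_le hab t.2 fun _ => 1
    simp only [lpSeminorm_sum, mul_one] at h
    simp only [one_smul] at h
    rw [ornsteinUhlenbeck_sum f hf]
    exact h
  · have h := hv.natCast_mul_ge hab fun _ => 1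
    simp only [lpSeminorm_sum, mul_one] at h
    simp only [one_smul] at h
    rw [numberOperator_sum f hf]
    exact h

include hf in
theorem lpNorm_le_of_lowDegree (hp : 1 ≤ p) (b : ℕ) :
    lpNorm q p (numberOperator q (∑ k ∈ Finset.Icc 0 b, f k)) ≤
      b * lpNorm q p (∑ k ∈ Finset.Icc 0 b, f k) ∧
    ∀ t : ℝ≥0, Real.exp (-(t : ℝ) * b) * lpNorm q p (∑ k ∈ Finset.Icc 0 b, f k) ≤
      lpNorm q p (ornsteinUhlenbeck q t (∑ k ∈ Finset.Icc 0 b, f k)) := by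
  have hv := circleInvariant_lpSeminorm hp (fun k => ⟨f k, (hf k).1⟩) hf
  constructor
  · have h := hv.natCast_mul_le b fun _ => 1
    simp only [lpSeminorm_sum, mul_one] at h
    simp only [one_smul] at h
    rw [numberOperator_sum f hf]
    exact h
  · intro t
    -- The multiplier `exp (t k)` recovers the polynomial from its image under `P_t`.
    have h := hv.exp_mul_le b t.2 fun k => (Real.exp (-(t : ℝ) * k) : ℂ)
    have h1 : ∀ k : ℕ, (Real.exp ((t : ℝ) * k) : ℂ) * (Real.exp (-(t : ℝ) * k) : ℂ) = 1 := by
      intro k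
      rw [← Complex.ofReal_mul, ← Real.exp_add, neg_mul, add_neg_cancel, Real.exp_zero,
        Complex.ofReal_one]
    simp only [lpSeminorm_sum, NNReal.val_eq_coe, h1] at h
    simp only [one_smul] at h
    rw [ornsteinUhlenbeck_sum f hf, neg_mul, Real.exp_neg, inv_mul_le_iff₀ (Real.exp_pos _)]
    exact h

end Components

end QGaussian

theorem theorem4 (q : Set.Ioo (-1 : ℝ) 1) {H : Type*} [NormedAddCommGroup H]
    [InnerProductSpace ℝ H] [CompleteSpace H] (p : ℝ≥0∞) (hp : 1 ≤ p) (d : ℕ) (hd : 1 ≤ d) :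
    (∀ x ∈ holomorphicAlgebra q H,
      (∀ t : ℝ≥0, ∃! y, IsOrnsteinUhlenbeck q t x y) ∧ (∃! y, IsNumber q x y) ∧
      (x ∈ tailSpace q (Double H) d →
        (∀ t : ℝ≥0, lpNorm q p (ornsteinUhlenbeck q t x) ≤
          Real.exp (-(t : ℝ) * d) * lpNorm q p x) ∧
        d * lpNorm q p x ≤ lpNorm q p (numberOperator q x)) ∧
      (x ∈ lowDegreeSpace q (Double H) d →
        lpNorm q p (numberOperator q x) ≤ d * lpNorm q p x ∧
        ∀ t : ℝ≥0, Real.exp (-(t : ℝ) * d) * lpNorm q p x ≤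
          lpNorm q p (ornsteinUhlenbeck q t x))) ∧
    (Nontrivial H → ∃ x ∈ holomorphicAlgebra q H,
      x ∈ tailSpace q (Double H) d ∧ x ∈ lowDegreeSpace q (Double H) d ∧ 0 < lpNorm q p x ∧
      (∀ t : ℝ≥0, lpNorm q p (ornsteinUhlenbeck q t x) =
        Real.exp (-(t : ℝ) * d) * lpNorm q p x) ∧
      lpNorm q p (numberOperator q x) = d * lpNorm q p x) := by
  refine ⟨fun x hx => ⟨fun t => ?_, ?_, fun hS => ?_, fun hS => ?_⟩, fun hH => ?_⟩
  · obtain ⟨f, hf, rfl⟩ := exists_eq_sum_homogeneous q hx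
    have h := isOrnsteinUhlenbeck_sum f f.support (fun k _ => (hf k).1)
      (fun k _ => (hf k).2.2.1) t
    exact ⟨_, h, fun y hy => hy.unique h⟩
  · obtain ⟨f, hf, rfl⟩ := exists_eq_sum_homogeneous q hx
    have h := isNumber_sum f f.support (fun k _ => (hf k).1) (fun k _ => (hf k).2.2.1)
    exact ⟨_, h, fun y hy => hy.unique h⟩
  · obtain ⟨f, hf, hfS, rfl⟩ := exists_eq_sum_of_mem_degreeSpace hx hS
    rw [← sum_support_eq f (I := Finset.Icc d (max d (f.support.sup id))) fun k hk =>
      Finset.mem_Icc.mpr ⟨hfS hk, (Finset.le_sup (f := id) hk).trans (le_max_right _ _)⟩]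
    exact lpNorm_le_of_tail f hf hp (le_max_left _ _)
  · obtain ⟨f, hf, hfS, rfl⟩ := exists_eq_sum_of_mem_degreeSpace hx hS
    rw [← sum_support_eq f (I := Finset.Icc 0 d) fun k hk =>
      Finset.mem_Icc.mpr ⟨k.zero_le, hfS hk⟩]
    exact lpNorm_le_of_lowDegree f hf hp d
  · obtain ⟨ξ, hξ⟩ := exists_ne (0 : H)
    have hmem := holomorphicVar_pow_mem q ξ d
    have hdeg : ∀ S : Set ℕ, d ∈ S →
        holomorphicVar q ξ ^ d ∈ degreeSpace q (Double H) S := fun S hdS =>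
      ⟨hmem.1, Submodule.span_mono (by
        rintro _ ⟨n, rfl, η, rfl⟩
        exact ⟨n, hdS, η, rfl⟩) hmem.2.2.1⟩
    refine ⟨holomorphicVar q ξ ^ d, pow_mem (Algebra.subset_adjoin (Set.mem_range_self ξ)) d,
      hdeg _ Set.self_mem_Ici, hdeg _ Set.self_mem_Iic, ?_, fun t => ?_, ?_⟩
    · refine lpNorm_pos hp hmem.1 fun h0 => holomorphicVar_pow_apply_vacuum_ne_zero q hξ d ?_
      rw [h0, zero_apply]
    · have h := ornsteinUhlenbeck_sum _ (holomorphicVar_pow_mem q ξ) {d} t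
      rw [Finset.sum_singleton, Finset.sum_singleton] at h
      rw [h, lpNorm_smul hp, Complex.norm_real, Real.norm_of_nonneg (Real.exp_pos _).le]
    · have h := numberOperator_sum _ (holomorphicVar_pow_mem q ξ) {d}
      rw [Finset.sum_singleton, Finset.sum_singleton] at h
      rw [h, lpNorm_smul hp, Complex.norm_natCast]
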